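/- Conventions. A space is $k$-connected if every map $S^{i}\to X$ with $-1\le i\le k$ extends to $D^{i+1}$ (so $(-1)$-connected means nonempty, and there is no condition for $k\le -2$). A map $f\colon X\to Y$ is $k$-connected if all its homotopy fibres are $(k-1)$-connected, i.e. if for $0\le d\le k$ every square formed by $a\colon S^{d-1}\to X$ and $b\colon D^d\to Y$ with $b|_{S^{d-1}}=f\circ a$ admits a map $c\colon D^d\to X$ extending $a$ with $f\circ c\simeq b$ relative to $S^{d-1}$. A simplicial complex is $d$-spherical if it has dimension $d$ and is $(d-1)$-connected (the empty complex has dimension $-1$); it is Cohen--Macaulay if it is $d$-spherical for some finite $d$ and the link of every $p$-simplex is $(d-p-1)$-spherical. A poset has the topology of its order complex, the simplicial complex of its nonempty finite chains. For a unital ring $R$ (modules are left modules) and a free $R$-module $M$, let $B(M)$ be the simplicial complex whose simplices are the nonempty finite subsets of bases of $M$, and put $B_n(R)=B(R^n)$ and $B^m_n(R)=\mathrm{Link}_{B(R^{m+n})}(\{e_1,\dots,e_m\})$, with simplex posets $\mathbb B_n(R)$ and $\mathbb B^m_n(R)$; let $\mathbb B_n(R)^{(n-2)}$ be the simplex poset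 of the $(n-2)$-skeleton of $B_n(R)$. Let $\mathbb T_n(R)$ be the poset, under inclusion, of nonzero proper free direct summands of $R^n$, and let $\mathbb T^m_n(R)\subseteq\mathbb T_{m+n}(R)$ be the subposet of those that are summands of a complement of $R^m$ in $R^{m+n}=R^m\oplus R^n$. Let $T_n(R)$ and $T^m_n(R)$ be their order complexes. Lemma. Let $R$ be a unital ring that has the invariant basis number property, over which every stably free module is free, and for which $B_k(R)$ is Cohen--Macaulay for all $k\ge 0$. Let $n\ge 0$ and $m>0$. Then 1. the poset map $\mathrm{span}\colon \mathbb B_n(R)^{(n-2)}\to\mathbb T_n(R)$, $\sigma\mapsto\langle\sigma\rangle$, is $(n-2)$-connected; 2. the poset map $\mathrm{span}\colon \mathbb B^m_n(R)\to\mathbb T^m_n(R)$, $\sigma\mapsto\langle\sigma\rangle$, is $(n-1)$-connected; 3. $T_n(R)$ is Cohen--Macaulay, of dimension $n-2$ if $n\ge 1$; 4. $T^m_n(R)$ is $(n-1)$-spherical. -/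

import Mathlib

universe u v

namespace TitsSpan

/-! ### Geometric realization of simplicial complexes -/

section Realization

variable {ι : Type u} {κ : Type v}

/-- The points of the geometric realization `|K|` of a simplicial complex, in barycentric
coordinates: finitely supported families of nonnegative reals with sum `1` whose support is a
simplex of `K`. -/
def Realization (K : PreAbstractSimplicialComplex ι) : Type u :=
  {x : ι →₀ ℝ // (∀ i, 0 ≤ x i) ∧ (x.sum fun _ a => a) = 1 ∧ x.support ∈ K.faces}

theorem mapDomain_mem (L : PreAbstractSimplicialComplex κ) (φ : ι → κ) (x : ι →₀ ℝ)
    (h0 : ∀ i, 0 ≤ x i) (h1 : (x.sum fun _ a => a) = 1) (t : Finset κ) (ht : t ∈ L.faces)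
    (hφ : ∀ i ∈ x.support, φ i ∈ t) :
    (∀ j, 0 ≤ x.mapDomain φ j) ∧ ((x.mapDomain φ).sum fun _ a => a) = 1 ∧
      (x.mapDomain φ).support ∈ L.faces := by
  classical
  have hsum : ((x.mapDomain φ).sum fun _ a => a) = 1 := by
    rw [Finsupp.sum_mapDomain_index (fun _ => rfl) (fun _ _ _ => rfl)]
    exact h1
  refine ⟨fun j => ?_, hsum, ?_⟩
  · rw [Finsupp.mapDomain, Finsupp.sum_apply]
    refine Finset.sum_nonneg fun i _ => ?_
    change 0 ≤ Finsupp.single (φ i) (x i) j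
    rw [Finsupp.single_apply]
    split_ifs
    · exact h0 i
    · exact le_rfl
  · refine (L.isRelLowerSet_faces ht).2 (?_ : (x.mapDomain φ).support ⊆ t) ?_
    · intro j hj
      obtain ⟨i, hi, rfl⟩ := Finset.mem_image.1 (Finsupp.mapDomain_support hj)
      exact hφ i hi
    · rw [Finset.nonempty_iff_ne_empty]
      intro he
      rw [Finsupp.sum, he] at hsum
      simp at hsum

/-- The inclusion of the closed simplex spanned by a face `s` into `|K|`
(extension of barycentric coordinates by zero). -/
noncomputable def simplexIncl (K : PreAbstractSimplicialComplex ι) (s : K.faces)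
    (y : stdSimplex ℝ ↥s.1) : Realization K :=
  ⟨(Finsupp.equivFunOnFinite.symm (y : ↥s.1 → ℝ)).mapDomain Subtype.val,
    mapDomain_mem K Subtype.val _ (fun i => y.2.1 i)
      (by rw [Finsupp.sum_fintype _ _ (fun _ => rfl)]; exact y.2.2) s s.2 (fun i _ => i.2)⟩

/-- The weak topology: a set is open in `|K|` if and only if its intersection with every closed
simplex is open in that simplex (with its Euclidean topology). -/
noncomputable instance (K : PreAbstractSimplicialComplex ι) : TopologicalSpace (Realization K) :=
  ⨆ s : K.faces, TopologicalSpace.coinduced (simplexIncl K s) inferInstance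

open Classical in
/-- The continuous map `|K| → |L|` induced by a simplicial map, i.e. by a map on vertices
that sends simplices to simplices; it is affine on every simplex. -/
noncomputable def realizationMap (K : PreAbstractSimplicialComplex ι)
    (L : PreAbstractSimplicialComplex κ) (φ : ι → κ)
    (hφ : ∀ s ∈ K.faces, s.image φ ∈ L.faces) : C(Realization K, Realization L) where
  toFun x := ⟨x.1.mapDomain φ, mapDomain_mem L φ x.1 x.2.1 x.2.2.1 _ (hφ _ x.2.2.2)
    (fun _ hi => Finset.mem_image_of_mem φ hi)⟩
  continuous_toFun := by
    refine continuous_iSup_dom.2 fun s => continuous_coinduced_dom.2 ?_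
    let t : L.faces := ⟨s.1.image φ, hφ s s.2⟩
    let ψ : ↥s.1 → ↥t.1 := fun i => ⟨φ i, Finset.mem_image_of_mem φ i.2⟩
    have hc : Continuous (simplexIncl L t) :=
      continuous_iSup_rng (i := t) continuous_coinduced_rng
    refine (hc.comp (stdSimplex.continuous_map ψ)).congr fun y => Subtype.ext ?_
    change Finsupp.mapDomain Subtype.val (Finsupp.equivFunOnFinite.symm
        (FunOnFinite.linearMap ℝ ℝ ψ (y : ↥s.1 → ℝ))) =
      Finsupp.mapDomain φ (Finsupp.mapDomain Subtype.val
        (Finsupp.equivFunOnFinite.symm (y : ↥s.1 → ℝ)))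
    have h : Finsupp.equivFunOnFinite.symm
        (FunOnFinite.linearMap ℝ ℝ ψ (y : ↥s.1 → ℝ)) =
      Finsupp.mapDomain ψ (Finsupp.equivFunOnFinite.symm (y : ↥s.1 → ℝ)) := by
      ext j
      simp only [FunOnFinite.linearMap]
      rfl
    rw [h, ← Finsupp.mapDomain_comp, ← Finsupp.mapDomain_comp]
    rfl

end Realization

/-! ### Connectivity -/

/-- The closed unit disk `D^d`. -/
abbrev Disk (d : ℕ) : Type := Metric.closedBall (0 : EuclideanSpace ℝ (Fin d)) 1

/-- The unit sphere `S^(d-1)`, the boundary of `D^d` (empty for `d = 0`). -/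
abbrev Sphere (d : ℕ) : Type := Metric.sphere (0 : EuclideanSpace ℝ (Fin d)) 1

/-- The inclusion of the boundary sphere in the disk. -/
def bdry {d : ℕ} (s : Sphere d) : Disk d := ⟨s, Metric.sphere_subset_closedBall s.2⟩

/-- A space is `k`-connected if every map `S^(d-1) → X` with `d - 1 ≤ k` extends to the disk `D^d`.
Thus `(-1)`-connected means nonempty, every space is `k`-connected for `k ≤ -2`, and for `0 ≤ k`
this says that `X` is nonempty and that `π_i(X, x)` is trivial for all `i ≤ k` and all `x`. -/
def IsConn (k : ℤ) (X : Type u) [TopologicalSpace X] : Prop :=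
  ∀ d : ℕ, (d : ℤ) - 1 ≤ k → ∀ a : C(Sphere d, X), ∃ c : C(Disk d, X), ∀ s, c (bdry s) = a s

/-- A map `f : X → Y` is `k`-connected if for all `0 ≤ d ≤ k`, every map of pairs from
`(D^d, S^(d-1))` to (the mapping cylinder of `f`, `X`) can be compressed into `X` relative to
`S^(d-1)`, i.e. all relative homotopy sets `π_d(f)` with `d ≤ k` vanish. Equivalently, at all base
points `π_i(f)` is bijective for `i < k` and surjective for `i = k`; equivalently, all homotopy
fibres of `f` are `(k-1)`-connected. There is no condition if `k < 0`. -/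
def IsConnMap (k : ℤ) {X : Type u} {Y : Type v} [TopologicalSpace X] [TopologicalSpace Y]
    (f : C(X, Y)) : Prop :=
  ∀ d : ℕ, (d : ℤ) ≤ k → ∀ (a : C(Sphere d, X)) (b : C(Disk d, Y)),
    (∀ s, b (bdry s) = f (a s)) →
      ∃ c : C(Disk d, X), (∀ s, c (bdry s) = a s) ∧
        (f.comp c).HomotopicRel b (Set.range (bdry (d := d)))

/-! ### Links, skeleta, sphericity and the Cohen--Macaulay property -/

section Complexes

variable {ι : Type u}

/-- `K` has finite dimension `d`. A simplex with `p + 1` vertices has dimension `p`; the empty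
complex has dimension `-1`. -/
def HasDim (K : PreAbstractSimplicialComplex ι) (d : ℤ) : Prop :=
  IsGreatest (insert (-1) ((fun s : Finset ι => (s.card : ℤ) - 1) '' K.faces)) d

open Classical in
/-- The link of `σ` in `K`: all simplices `τ` disjoint from `σ` such that `τ ∪ σ ∈ K`. -/
def link (K : PreAbstractSimplicialComplex ι) (σ : Finset ι) : PreAbstractSimplicialComplex ι where
  faces := {τ | τ.Nonempty ∧ Disjoint τ σ ∧ τ ∪ σ ∈ K.faces}
  isRelLowerSet_faces := by
    rintro τ ⟨h0, h1, h2⟩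
    refine ⟨h0, fun ρ hρ hne => ⟨hne, h1.mono_left hρ, ?_⟩⟩
    exact (K.isRelLowerSet_faces h2).2 (Finset.union_subset_union_left hρ)
      (hne.mono Finset.subset_union_left)

/-- The `k`-skeleton: all simplices of dimension at most `k`. -/
def skeleton (K : PreAbstractSimplicialComplex ι) (k : ℤ) : PreAbstractSimplicialComplex ι where
  faces := {s | s ∈ K.faces ∧ (s.card : ℤ) - 1 ≤ k}
  isRelLowerSet_faces := by
    rintro s ⟨h0, h1⟩
    refine ⟨(K.isRelLowerSet_faces h0).1, fun t ht hne =>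
      ⟨(K.isRelLowerSet_faces h0).2 ht hne, ?_⟩⟩
    have : (t.card : ℤ) ≤ s.card := by exact_mod_cast Finset.card_le_card ht
    linarith

/-- `K` is `d`-spherical: it has dimension `d` and is `(d-1)`-connected. -/
def IsSpherical (d : ℤ) (K : PreAbstractSimplicialComplex ι) : Prop :=
  HasDim K d ∧ IsConn (d - 1) (Realization K)

/-- `K` is Cohen--Macaulay: it has some finite dimension `d`, it is `d`-spherical, and the link of
every `p`-simplex is `(d - p - 1)`-spherical. -/
def IsCohenMacaulay (K : PreAbstractSimplicialComplex ι) : Prop :=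
  ∃ d : ℤ, IsSpherical d K ∧
    ∀ (p : ℕ), ∀ σ ∈ K.faces, σ.card = p + 1 → IsSpherical (d - p - 1) (link K σ)

/-- The simplex poset of `K`: its (nonempty) simplices ordered by inclusion. -/
abbrev FacePoset (K : PreAbstractSimplicialComplex ι) : Type u := {s : Finset ι // s ∈ K.faces}

/-- The order complex of a poset: its simplices are the nonempty finite chains. Its realization is
the geometric realization of the poset. -/
def orderComplex (P : Type u) [PartialOrder P] : PreAbstractSimplicialComplex P where
  faces := {s | s.Nonempty ∧ IsChain (· ≤ ·) (s : Set P)}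
  isRelLowerSet_faces := by
    rintro s ⟨h0, h1⟩
    exact ⟨h0, fun t ht hne => ⟨hne, h1.mono (Finset.coe_subset.2 ht)⟩⟩

/-- The map on geometric realizations induced by a map of posets. -/
noncomputable def posetMap {P : Type u} {Q : Type v} [PartialOrder P] [PartialOrder Q]
    (f : P →o Q) : C(Realization (orderComplex P), Realization (orderComplex Q)) :=
  realizationMap _ _ f (by
    classical
    rintro s ⟨h0, h1⟩
    refine ⟨?_, ?_⟩
    · convert h0.image f
    · intro x hx y hy _
      simp only [Finset.coe_image, Set.mem_image] at hx hy
      obtain ⟨x, hx, rfl⟩ := hx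
      obtain ⟨y, hy, rfl⟩ := hy
      exact (h1.total hx hy).imp (fun h => f.monotone h) (fun h => f.monotone h))

end Complexes

/-! ### Partial bases and Tits complexes -/

section Modules

variable (R : Type u) [Ring R]

/-- A subset of a module which is a basis. -/
def IsBasisSet {M : Type v} [AddCommGroup M] [Module R M] (b : Set M) : Prop :=
  LinearIndepOn R id b ∧ Submodule.span R b = ⊤

/-- The complex of partial bases `B(M)`: simplices are nonempty finite subsets of bases of `M`. -/
def partialBases (M : Type v) [AddCommGroup M] [Module R M] : PreAbstractSimplicialComplex M where
  faces := {σ | σ.Nonempty ∧ ∃ b : Set M, IsBasisSet R b ∧ (σ : Set M) ⊆ b}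
  isRelLowerSet_faces := by
    rintro s ⟨h0, b, hb, h1⟩
    exact ⟨h0, fun t ht hne => ⟨hne, b, hb, (Finset.coe_subset.2 ht).trans h1⟩⟩

/-- `B_n(R) = B(R^n)`. -/
abbrev B (n : ℕ) : PreAbstractSimplicialComplex (Fin n → R) := partialBases R (Fin n → R)

open Classical in
/-- The first `m` standard unit vectors `e_1, …, e_m` of `R^(m+n)`. -/
noncomputable def firstUnitVectors (m n : ℕ) : Finset (Fin (m + n) → R) :=
  Finset.univ.image fun i : Fin m => Pi.single (Fin.castAdd n i) (1 : R)

/-- `B^m_n(R)`, the link of `{e_1, …, e_m}` in `B(R^(m+n))`. -/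
noncomputable abbrev relB (m n : ℕ) : PreAbstractSimplicialComplex (Fin (m + n) → R) :=
  link (partialBases R (Fin (m + n) → R)) (firstUnitVectors R m n)

/-- The standard summand `R^m` of `R^(m+n) = R^m ⊕ R^n`: vectors whose last `n` entries vanish. -/
def firstSummand (m n : ℕ) : Submodule R (Fin (m + n) → R) where
  carrier := {x | ∀ j : Fin n, x (Fin.natAdd m j) = 0}
  add_mem' := by
    intro x y hx hy j
    simp [hx j, hy j]
  zero_mem' := by
    intro j
    rfl
  smul_mem' := by
    intro c x hx j
    simp [hx j]

variable {R} in
/-- `V` is a nonzero proper free summand of `M` (its complement is not required to be free). -/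
def IsProperFreeSummand {M : Type v} [AddCommGroup M] [Module R M] (V : Submodule R M) : Prop :=
  V ≠ ⊥ ∧ V ≠ ⊤ ∧ Module.Free R V ∧ ∃ C : Submodule R M, IsCompl V C

variable {R} in
/-- `V` is a summand of a complement `C` of `N`: `M = N ⊕ C` and `C = V ⊕ W`. -/
def IsSummandOfComplement {M : Type v} [AddCommGroup M] [Module R M] (N V : Submodule R M) :
    Prop :=
  ∃ C : Submodule R M, IsCompl N C ∧ ∃ W : Submodule R M, Disjoint V W ∧ V ⊔ W = C

/-- The poset `𝕋(M)` of nonzero proper free summands of `M`, ordered by inclusion. -/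
abbrev TitsPoset (M : Type v) [AddCommGroup M] [Module R M] : Type v :=
  {V : Submodule R M // IsProperFreeSummand V}

variable {R} in
/-- The subposet `𝕋(M, N)` of `𝕋(M)` of summands of complements of `N`. -/
abbrev RelTitsPoset {M : Type v} [AddCommGroup M] [Module R M] (N : Submodule R M) : Type v :=
  {V : Submodule R M // IsProperFreeSummand V ∧ IsSummandOfComplement N V}

/-- The poset `𝕋_n(R) = 𝕋(R^n)`. -/
abbrev TPoset (n : ℕ) : Type u := TitsPoset R (Fin n → R)

/-- The Tits complex `T_n(R)`, as a simplicial complex. -/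
abbrev T (n : ℕ) : PreAbstractSimplicialComplex (TPoset R n) := orderComplex (TPoset R n)

/-- The poset `𝕋^m_n(R) = 𝕋(R^(m+n), R^m)`. -/
abbrev relTPoset (m n : ℕ) : Type u := RelTitsPoset (firstSummand R m n)

/-- The relative Tits complex `T^m_n(R)`, as a simplicial complex. -/
abbrev relT (m n : ℕ) : PreAbstractSimplicialComplex (relTPoset R m n) :=
  orderComplex (relTPoset R m n)

/-- `R` is Hermite: every stably free `R`-module is free. -/
def IsHermite : Prop :=
  ∀ (M : Type u) [AddCommGroup M] [Module R M], Module.IsStablyFree R M → Module.Free R M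

/-! ### The span maps -/

variable {R}

theorem isCompl_span {M : Type v} [AddCommGroup M] [Module R M] {b s : Set M}
    (hb : IsBasisSet R b) (hs : s ⊆ b) :
    IsCompl (Submodule.span R s) (Submodule.span R (b \ s)) := by
  constructor
  · have h := LinearIndependent.disjoint_span_image (v := fun x : b => (x : M)) (R := R) hb.1
      (s := Subtype.val ⁻¹' s) (t := Subtype.val ⁻¹' (b \ s))
      (by rw [Set.disjoint_left]; intro x hx hx'; exact hx'.2 hx)
    rwa [Subtype.image_preimage_coe, Subtype.image_preimage_coe,
      Set.inter_eq_right.2 hs, Set.inter_eq_right.2 Set.sdiff_subset] at h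
  · rw [codisjoint_iff, ← Submodule.span_union, Set.union_sdiff_cancel hs, hb.2]

theorem isProperFreeSummand_span [Nontrivial R] {M : Type v} [AddCommGroup M] [Module R M]
    {b s : Set M} (hb : IsBasisSet R b) (hs : s ⊆ b) (hne : s.Nonempty) (hp : ¬ b ⊆ s) :
    IsProperFreeSummand (Submodule.span R s) := by
  have key : ∀ t : Set M, t ⊆ b → t.Nonempty → Submodule.span R t ≠ ⊥ := by
    rintro t ht ⟨x, hx⟩ h
    have h0 : x = 0 := (Submodule.span_eq_bot.1 h) x hx
    exact LinearIndependent.ne_zero (⟨x, ht hx⟩ : b) hb.1 h0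
  refine ⟨key s hs hne, fun h => ?_, ?_, _, isCompl_span hb hs⟩
  · have hc := isCompl_span hb hs
    rw [h] at hc
    obtain ⟨x, hx, hx'⟩ := Set.not_subset.1 hp
    exact key (b \ s) Set.sdiff_subset ⟨x, hx, hx'⟩ (by simpa using hc.disjoint)
  · have h : LinearIndependent R ((↑) : s → M) := hb.1.mono hs
    have h' := Module.Free.of_basis (Module.Basis.span h)
    rwa [Subtype.range_coe] at h'

theorem isSummandOfComplement_span {M : Type v} [AddCommGroup M] [Module R M]
    {b s t : Set M} (hb : IsBasisSet R b) (hs : s ⊆ b) (ht : t ⊆ b) (hd : Disjoint t s) :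
    IsSummandOfComplement (Submodule.span R s) (Submodule.span R t) := by
  refine ⟨_, isCompl_span hb hs, Submodule.span R ((b \ s) \ t), ?_, ?_⟩
  · exact (isCompl_span hb ht).disjoint.mono_right
      (Submodule.span_mono (Set.sdiff_subset_sdiff_left Set.sdiff_subset))
  · rw [← Submodule.span_union, Set.union_sdiff_cancel]
    exact fun x hx => ⟨ht hx, fun hx' => Set.disjoint_left.1 hd hx hx'⟩

theorem span_firstUnitVectors (m n : ℕ) :
    Submodule.span R (firstUnitVectors R m n : Set (Fin (m + n) → R)) = firstSummand R m n := by
  classical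
  apply le_antisymm
  · rw [Submodule.span_le]
    intro x hx
    simp only [firstUnitVectors, Finset.coe_image, Set.mem_image] at hx
    obtain ⟨i, -, rfl⟩ := hx
    intro j
    refine Pi.single_eq_of_ne (fun h => ?_) _
    have := congrArg Fin.val h
    simp at this
    omega
  · intro x hx
    rw [pi_eq_sum_univ' x, Fin.sum_univ_add]
    refine add_mem (sum_mem fun i _ => ?_) (sum_mem fun j _ => ?_)
    · refine Submodule.smul_mem _ _ (Submodule.subset_span ?_)
      simp only [firstUnitVectors, Finset.coe_image, Set.mem_image]
      refine ⟨i, by simp, ?_⟩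
      ext k
      simp [Pi.single_apply]
    · rw [hx j, zero_smul]
      exact zero_mem _

theorem not_subset_of_card_lt [InvariantBasisNumber R] {n : ℕ} {b : Set (Fin n → R)}
    (hb : IsBasisSet R b) (σ : Finset (Fin n → R)) (hσ : (σ.card : ℤ) - 1 ≤ (n : ℤ) - 2) :
    ¬ b ⊆ (σ : Set (Fin n → R)) := by
  intro h
  have : Nontrivial R := nontrivial_of_invariantBasisNumber R
  have hfin : b.Finite := σ.finite_toSet.subset h
  have : Fintype b := hfin.fintype
  let β : Module.Basis b R (Fin n → R) :=
    Module.Basis.mk (v := fun x : b => (x : Fin n → R)) hb.1 (by rw [Subtype.range_coe, hb.2])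
  have e := Fintype.card_congr (β.indexEquiv (Pi.basisFun R (Fin n)))
  rw [Fintype.card_fin, ← Set.toFinset_card] at e
  have : b.toFinset.card ≤ σ.card := Finset.card_le_card (by simpa using h)
  omega

/-- The poset map `span : 𝔹_n(R)^(n-2) → 𝕋_n(R)`, `σ ↦ ⟨σ⟩`. -/
def spanMap (R : Type u) [Ring R] [InvariantBasisNumber R] (n : ℕ) :
    FacePoset (skeleton (B R n) ((n : ℤ) - 2)) →o TPoset R n where
  toFun σ := ⟨Submodule.span R (σ.1 : Set (Fin n → R)), by
    have : Nontrivial R := nontrivial_of_invariantBasisNumber R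
    obtain ⟨σ, ⟨hne, b, hb, hσb⟩, hσ⟩ := σ
    exact isProperFreeSummand_span hb hσb hne (not_subset_of_card_lt hb σ hσ)⟩
  monotone' _ _ h := Submodule.span_mono (Finset.coe_subset.2 h)

theorem link_partialBases {M : Type v} [AddCommGroup M] [Module R M] {σ τ : Finset M}
    (h : τ ∈ (link (partialBases R M) σ).faces) : τ.Nonempty ∧ Disjoint τ σ ∧
      ∃ b : Set M, IsBasisSet R b ∧ (τ : Set M) ⊆ b ∧ (σ : Set M) ⊆ b := by
  classical
  obtain ⟨hne, hdisj, -, b, hb, hb'⟩ := h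
  rw [Finset.coe_union, Set.union_subset_iff] at hb'
  exact ⟨hne, hdisj, b, hb, hb'⟩

theorem single_mem_firstUnitVectors (m n : ℕ) (i : Fin m) :
    Pi.single (Fin.castAdd n i) (1 : R) ∈ firstUnitVectors R m n := by
  simp [firstUnitVectors]

/-- For `m > 0`, the poset map `span : 𝔹^m_n(R) → 𝕋^m_n(R)`, `σ ↦ ⟨σ⟩`. -/
def relSpanMap (R : Type u) [Ring R] [InvariantBasisNumber R] (m n : ℕ) (hm : 0 < m) :
    FacePoset (relB R m n) →o relTPoset R m n where
  toFun σ := ⟨Submodule.span R (σ.1 : Set (Fin (m + n) → R)), by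
    have : Nontrivial R := nontrivial_of_invariantBasisNumber R
    obtain ⟨σ, hσ⟩ := σ
    obtain ⟨hne, hdisj, b, hb, h1, h2⟩ := link_partialBases hσ
    have he := single_mem_firstUnitVectors (R := R) m n ⟨0, hm⟩
    have h3 : ¬ b ⊆ (σ : Set (Fin (m + n) → R)) := fun h =>
      Finset.disjoint_left.1 hdisj (h (h2 he)) he
    refine ⟨isProperFreeSummand_span hb h1 hne h3, ?_⟩
    rw [← span_firstUnitVectors]
    exact isSummandOfComplement_span hb h2 h1 (Finset.disjoint_coe.2 hdisj)⟩
  monotone' _ _ h := Submodule.span_mono (Finset.coe_subset.2 h)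

end Modules

end TitsSpan

open TitsSpan

/-!
All four claims come from one poset. For a summand `N` of a free module `X` with basis `ν`, consider
the nonzero free submodules `V` that are summands of a complement of `N` in `X`, possibly with the
requirement that `V` be proper (`IsRelSummand`). The case `N = ⊥`, with `V` proper, is `𝕋_n(R)`; the
case `N = R^m` is `𝕋^m_n(R)`. Taking spans gives a poset map to it from the partial bases of `X`
that extend `ν`, restricted to a skeleton if `V` is required to be proper. The hypothesis that the
`B_k(R)` are Cohen--Macaulay gives the connectivity of the source.

The tool is a version of Quillen's fibre theorem (`isConnMap_posetMap`, `IsConn.of_posetMap`), for a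
strictly monotone height `t` on the target: if the fibres `{x | f x ≤ y}` are `(t(y) - 1)`-connected
and the posets of elements above `y` are `(n - t(y) - 2)`-connected, then `f` is `n`-connected. For
the span map and `t(V) = rank V - 1`, the fibre over `V` consists of the partial bases of `V`
(`mem_skeleton_link_and_span_le_iff`), which form a copy of `B_k(R)` for `k = rank V`. The elements
above `V` correspond, by intersection with a complement, to a poset of the same kind of smaller rank
(`exists_orderIso_above`). So the connectivity of the poset follows by induction on the rank
(`isConn_relSummands`), and the fibre theorem then gives that of the span map. That stably free
modules are free enters in the fact that complements of free summands of free modules are free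
(`HasRank.of_sup`). Chains of summands are counted by ranks (`card_le_of_isChain`,
`exists_complete_flag`), which gives the dimensions. The link of a flag is a join of Tits complexes
of the successive quotients, which is highly connected by `IsConn.join` (`isConn_flagLink`).

The topology is done with explicit barycentric coordinates. A map from a compact space involves only
finitely many vertices and is continuous if its coordinates are (`exists_map`), and two maps whose
values lie in common simplices are homotopic along straight lines. General position for maps from
disks and spheres to `ℝ^N` (`SmallDim`) yields cellular approximation (`exists_homotopic_cellular`).
Combined with extension over simplices (`exists_extension`) it shows that maps from a space of
dimension at most `n` can be deformed off a vertex whose link is `(n - 1)`-connected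
(`exists_homotopic_avoid_vertex`). The fibre theorem follows by applying this to the mapping
cylinder of `f`, whose target vertices `y` are removed in the order of increasing height: at that
moment the link of `y` is the join of the fibre over `y` and of the poset above `y`. The passage
from a complex to its simplex poset is `IsConn.facePoset`, where the inverse of the barycentric
subdivision map is given by the superlevel sets of the coordinates.
-/

namespace TitsSpan

/-! ### Maps into and out of the realization -/

section Basics

variable {ι : Type*} {κ : Type*} {K : PreAbstractSimplicialComplex ι}

/-- The barycentric coordinates of a point of a realization. -/
def Realization.bary (x : Realization K) : ι →₀ ℝ := x.1

theorem Realization.ext {x y : Realization K} (h : ∀ i, x.bary i = y.bary i) : x = y :=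
  Subtype.ext (Finsupp.ext h)

theorem Realization.nonneg (x : Realization K) (i : ι) : 0 ≤ x.bary i := x.2.1 i

theorem Realization.support_mem (x : Realization K) : x.bary.support ∈ K.faces := x.2.2.2

theorem Realization.pos_iff (x : Realization K) (i : ι) : 0 < x.bary i ↔ i ∈ x.bary.support := by
  rw [Finsupp.mem_support_iff]
  exact ⟨ne_of_gt, fun h => lt_of_le_of_ne (x.nonneg i) h.symm⟩

theorem Realization.sum_eq_one (x : Realization K) {F : Finset ι} (hF : x.bary.support ⊆ F) :
    ∑ i ∈ F, x.bary i = 1 := by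
  refine Eq.trans ?_ x.2.2.1
  exact (Finset.sum_subset hF fun i _ h => Finsupp.notMem_support_iff.1 h).symm

theorem Realization.le_one (x : Realization K) (i : ι) : x.bary i ≤ 1 := by
  by_cases h : i ∈ x.bary.support
  · rw [← x.sum_eq_one subset_rfl]
    exact Finset.single_le_sum (f := fun i => x.bary i) (fun j _ => x.nonneg j) h
  · rw [Finsupp.notMem_support_iff.1 h]
    exact zero_le_one

theorem continuous_simplexIncl (s : K.faces) : Continuous (simplexIncl K s) :=
  continuous_iSup_rng (i := s) continuous_coinduced_rng

theorem Realization.continuous_dom {X : Type*} [TopologicalSpace X] {f : Realization K → X}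
    (h : ∀ s : K.faces, Continuous (f ∘ simplexIncl K s)) : Continuous f :=
  continuous_iSup_dom.2 fun s => continuous_coinduced_dom.2 (h s)

theorem simplexIncl_apply_mem (s : K.faces) (y : stdSimplex ℝ ↥s.1) (i : ↥s.1) :
    (simplexIncl K s y).bary i = y.1 i := by
  change Finsupp.mapDomain Subtype.val _ (i : ι) = _
  rw [Finsupp.mapDomain_apply Subtype.val_injective]
  rfl

theorem simplexIncl_apply_of_notMem (s : K.faces) (y : stdSimplex ℝ ↥s.1) {i : ι}
    (hi : i ∉ s.1) : (simplexIncl K s y).bary i = 0 := by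
  change Finsupp.mapDomain Subtype.val _ (i : ι) = _
  refine Finsupp.mapDomain_of_notMem_range _ _ ?_
  rintro ⟨j, rfl⟩
  exact hi j.2

theorem support_simplexIncl_subset (s : K.faces) (y : stdSimplex ℝ ↥s.1) :
    (simplexIncl K s y).bary.support ⊆ s.1 := by
  intro i hi
  by_contra h
  exact Finsupp.mem_support_iff.1 hi (simplexIncl_apply_of_notMem s y h)

theorem Realization.continuous_sum_mul (w : ι → ℝ) :
    Continuous fun x : Realization K => x.bary.sum fun i a => w i * a := by
  refine Realization.continuous_dom fun s => ?_
  have h : ((fun x : Realization K => x.bary.sum fun i a => w i * a) ∘ simplexIncl K s) =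
      fun y => ∑ i : ↥s.1, w i * y.1 i := by
    funext y
    change (simplexIncl K s y).bary.sum _ = _
    rw [Finsupp.sum_of_support_subset _ (support_simplexIncl_subset s y) _ (by simp),
      ← Finset.sum_coe_sort]
    exact Finset.sum_congr rfl fun i _ => by rw [simplexIncl_apply_mem]
  rw [h]
  exact continuous_finsetSum _ fun i _ =>
    continuous_const.mul ((continuous_apply i).comp continuous_subtype_val)

theorem Realization.continuous_coord (i : ι) :
    Continuous fun x : Realization K => x.bary i := by
  classical
  refine (Realization.continuous_sum_mul fun j => if j = i then 1 else 0).congr fun x => ?_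
  rw [Finsupp.sum]
  simp only [ite_mul, one_mul, zero_mul, Finset.sum_ite_eq', Finsupp.mem_support_iff]
  split_ifs with h
  · rfl
  · exact (not_not.1 h).symm

/-- A map whose image involves only finitely many vertices is continuous as soon as its
barycentric coordinates are. -/
theorem Realization.continuous_of_support_subset {Z : Type*} [TopologicalSpace Z]
    {f : Z → Realization K} (F : Finset ι) (hF : ∀ z, (f z).bary.support ⊆ F)
    (hc : ∀ i, Continuous fun z => (f z).bary i) : Continuous f := by
  classical
  let T := {s : K.faces // s.1 ⊆ F}
  have : Finite T := by
    refine Finite.of_injective (β := {s : Finset ι // s ∈ F.powerset})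
      (fun s => ⟨s.1.1, Finset.mem_powerset.2 s.2⟩) ?_
    intro s t h
    exact Subtype.ext (Subtype.ext (congrArg (fun x => x.1) h))
  let A : T → Set Z := fun s => {z | (f z).bary.support ⊆ s.1.1}
  refine LocallyFinite.continuous (f := A) (locallyFinite_of_finite _) ?_ ?_ ?_
  · refine Set.eq_univ_of_forall fun z => Set.mem_iUnion.2 ?_
    exact ⟨⟨⟨_, (f z).support_mem⟩, hF z⟩, (subset_rfl : (f z).bary.support ⊆ (f z).bary.support)⟩
  · intro s
    have : A s = ⋂ i ∈ {i | i ∉ s.1.1}, {z | (f z).bary i = 0} := by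
      ext z
      simp only [A, Set.mem_ofPred_eq, Set.mem_iInter]
      constructor
      · intro h i hi
        exact Finsupp.notMem_support_iff.1 fun h' => hi (h h')
      · intro h i hi
        by_contra hi'
        exact Finsupp.mem_support_iff.1 hi (h i hi')
    rw [this]
    exact isClosed_biInter fun i _ => isClosed_eq (hc i) continuous_const
  · intro s
    rw [continuousOn_iff_continuous_domRestrict]
    let g : A s → stdSimplex ℝ ↥s.1.1 := fun z =>
      ⟨fun i => (f z).bary i, fun i => (f z).nonneg i, by
        rw [← (f z).sum_eq_one z.2]
        exact Finset.sum_coe_sort s.1.1 fun i => (f z).bary i⟩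
    have hg : Continuous g := continuous_induced_rng.2
      (continuous_pi fun i => (hc i).comp continuous_subtype_val)
    refine ((continuous_simplexIncl s.1).comp hg).congr fun z => Realization.ext fun i => ?_
    by_cases hi : i ∈ s.1.1
    · exact simplexIncl_apply_mem s.1 (g z) ⟨i, hi⟩
    · change (simplexIncl K s.1 (g z)).bary i = _
      rw [simplexIncl_apply_of_notMem s.1 _ hi]
      exact (Finsupp.notMem_support_iff.1 fun h => hi (z.2 h)).symm

/-- Continuous maps into a realization from their barycentric coordinates, if only finitely many
vertices are involved. -/
theorem exists_map {Z : Type*} [TopologicalSpace Z] (K : PreAbstractSimplicialComplex ι)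
    (F : Finset ι) (c : Z → ι → ℝ) (h0 : ∀ z i, 0 ≤ c z i) (h1 : ∀ z, ∑ i ∈ F, c z i = 1)
    (hF : ∀ z i, i ∉ F → c z i = 0) (hs : ∀ z, ∃ s ∈ K.faces, ∀ i, c z i ≠ 0 → i ∈ s)
    (hc : ∀ i, Continuous fun z => c z i) :
    ∃ f : C(Z, Realization K), ∀ z i, (f z).bary i = c z i := by
  classical
  have hFz : ∀ z i, c z i ≠ 0 → i ∈ F := fun z i h => by
    by_contra h'
    exact h (hF z i h')
  let p : Z → ι →₀ ℝ := fun z => Finsupp.onFinset F (c z) (hFz z)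
  have hsub : ∀ z, (p z).support ⊆ F := fun z => Finsupp.support_onFinset_subset
  have hsum : ∀ z, ((p z).sum fun _ a => a) = 1 := fun z => by
    rw [Finsupp.sum_of_support_subset _ (hsub z) _ (by simp)]
    exact h1 z
  have hface : ∀ z, (p z).support ∈ K.faces := fun z => by
    obtain ⟨s, hsK, hs⟩ := hs z
    refine (K.isRelLowerSet_faces hsK).2 (fun i hi => hs i (Finsupp.mem_support_iff.1 hi)) ?_
    rw [Finset.nonempty_iff_ne_empty]
    intro he
    have := hsum z
    rw [Finsupp.sum, he] at this
    simp at this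
  let f : Z → Realization K := fun z => ⟨p z, h0 z, hsum z, hface z⟩
  exact ⟨⟨f, Realization.continuous_of_support_subset F hsub hc⟩, fun _ _ => rfl⟩

/-- A compact subset of a realization involves only finitely many vertices. -/
theorem exists_finset_support_subset {Z : Type*} [TopologicalSpace Z] [CompactSpace Z]
    (f : C(Z, Realization K)) : ∃ F : Finset ι, ∀ z, (f z).bary.support ⊆ F := by
  classical
  by_contra hcon
  have hinf : (⋃ z, ((f z).bary.support : Set ι)).Infinite := by
    intro hfin
    refine hcon ⟨hfin.toFinset, fun z i hi => ?_⟩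
    rw [Set.Finite.mem_toFinset]
    exact Set.mem_iUnion.2 ⟨z, hi⟩
  let v := hinf.natEmbedding
  choose z hz using fun k => Set.mem_iUnion.1 (v k).2
  have hv : Function.Injective fun k => (v k : ι) := Subtype.val_injective.comp v.injective
  have hpos : ∀ k, 0 < (f (z k)).bary (v k) := fun k => ((f (z k)).pos_iff _).2 (hz k)
  -- a weight for which the `k`-th chosen point gets the value at least `k`
  let w : ι → ℝ := fun i =>
    if h : ∃ k, (v k : ι) = i then (h.choose : ℝ) / (f (z h.choose)).bary (v h.choose) else 0
  have hw : ∀ k, w (v k) = k / (f (z k)).bary (v k) := fun k => by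
    have h : ∃ j, (v j : ι) = v k := ⟨k, rfl⟩
    have hk : h.choose = k := hv h.choose_spec
    change (if h : ∃ j, (v j : ι) = v k then _ else _) = _
    rw [dif_pos h, hk]
  have hw0 : ∀ i, 0 ≤ w i := fun i => by
    by_cases h : ∃ k, (v k : ι) = i
    · obtain ⟨k, rfl⟩ := h
      rw [hw]
      exact div_nonneg k.cast_nonneg (hpos k).le
    · simp only [w, dif_neg h, le_refl]
  have hcont : Continuous fun y => (f y).bary.sum fun i a => w i * a :=
    (Realization.continuous_sum_mul w).comp f.continuous
  obtain ⟨b, hb⟩ := (isCompact_range hcont).bddAbove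
  obtain ⟨k, hk⟩ := exists_nat_gt b
  have h1 : (f (z k)).bary.sum (fun i a => w i * a) ≤ b := hb ⟨z k, rfl⟩
  have h2 : w (v k) * (f (z k)).bary (v k) ≤ (f (z k)).bary.sum (fun i a => w i * a) := by
    rw [Finsupp.sum]
    exact Finset.single_le_sum (f := fun i => w i * (f (z k)).bary i)
      (fun i _ => mul_nonneg (hw0 i) ((f (z k)).nonneg i)) (hz k)
  rw [hw, div_mul_cancel₀ _ (hpos k).ne'] at h2
  linarith

theorem HomotopicRel.mono_set {X Y : Type*} [TopologicalSpace X] [TopologicalSpace Y]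
    {f g : C(X, Y)} {S T : Set X} (h : f.HomotopicRel g T) (hST : S ⊆ T) : f.HomotopicRel g S := by
  obtain ⟨H⟩ := h
  exact ⟨⟨H.toHomotopy, fun t x hx => H.prop' t x (hST hx)⟩⟩

/-- Two maps such that `f z` and `g z` always lie in a common simplex are homotopic along straight
lines, relative to the set where they agree. The homotopy stays in the simplices spanned by the
vertices of `f z` and `g z`. -/
theorem exists_homotopyRel_of_common_face {Z : Type*} [TopologicalSpace Z] [CompactSpace Z]
    (f g : C(Z, Realization K))
    (h : ∀ z, ∃ s ∈ K.faces, (f z).bary.support ⊆ s ∧ (g z).bary.support ⊆ s) (S : Set Z)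
    (hS : ∀ z ∈ S, f z = g z) :
    ∃ H : f.HomotopyRel g S, ∀ (t : unitInterval) (z : Z) (i : ι), (f z).bary i = 0 →
      (g z).bary i = 0 → (H (t, z)).bary i = 0 := by
  classical
  obtain ⟨F, hF⟩ := exists_finset_support_subset f
  obtain ⟨G, hG⟩ := exists_finset_support_subset g
  let c : unitInterval × Z → ι → ℝ := fun p i => (1 - p.1) * (f p.2).bary i + p.1 * (g p.2).bary i
  have e0 : ∀ (z : Z) (i : ι), i ∉ F ∪ G → (f z).bary i = 0 ∧ (g z).bary i = 0 := fun z i hi => by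
    rw [Finset.notMem_union] at hi
    exact ⟨Finsupp.notMem_support_iff.1 fun h => hi.1 (hF z h),
      Finsupp.notMem_support_iff.1 fun h => hi.2 (hG z h)⟩
  obtain ⟨H, hH⟩ := exists_map K (F ∪ G) c
    (fun p i => add_nonneg (mul_nonneg (sub_nonneg.2 p.1.2.2) ((f p.2).nonneg i))
      (mul_nonneg p.1.2.1 ((g p.2).nonneg i)))
    (fun p => by
      rw [Finset.sum_add_distrib, ← Finset.mul_sum, ← Finset.mul_sum,
        (f p.2).sum_eq_one ((hF p.2).trans Finset.subset_union_left),
        (g p.2).sum_eq_one ((hG p.2).trans Finset.subset_union_right)]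
      ring)
    (fun p i hi => by simp only [c, (e0 p.2 i hi).1, (e0 p.2 i hi).2, mul_zero, add_zero])
    (fun p => by
      obtain ⟨s, hs, h1, h2⟩ := h p.2
      refine ⟨s, hs, fun i hi => ?_⟩
      by_contra his
      refine hi ?_
      simp only [c, Finsupp.notMem_support_iff.1 fun h => his (h1 h),
        Finsupp.notMem_support_iff.1 fun h => his (h2 h), mul_zero, add_zero])
    (fun i => by
      have hf : Continuous fun p : unitInterval × Z => (f p.2).bary i :=
        (Realization.continuous_coord i).comp (f.continuous.comp continuous_snd)
      have hg : Continuous fun p : unitInterval × Z => (g p.2).bary i :=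
        (Realization.continuous_coord i).comp (g.continuous.comp continuous_snd)
      have ht : Continuous fun p : unitInterval × Z => (p.1 : ℝ) :=
        continuous_subtype_val.comp continuous_fst
      exact ((continuous_const.sub ht).mul hf).add (ht.mul hg))
  refine ⟨⟨⟨H, fun z => ?_, fun z => ?_⟩, fun t z hz => ?_⟩, fun t z i h1 h2 => ?_⟩
  · refine Realization.ext fun i => ?_
    change (H (0, z)).bary i = _
    simp [hH, c]
  · refine Realization.ext fun i => ?_
    change (H (1, z)).bary i = _
    simp [hH, c]
  · refine Realization.ext fun i => ?_
    change (H (t, z)).bary i = (f z).bary i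
    rw [hH]
    simp only [c, ← hS z hz]
    ring
  · change (H (t, z)).bary i = 0
    simp [hH, c, h1, h2]

theorem homotopicRel_of_common_face {Z : Type*} [TopologicalSpace Z] [CompactSpace Z]
    (f g : C(Z, Realization K))
    (h : ∀ z, ∃ s ∈ K.faces, (f z).bary.support ⊆ s ∧ (g z).bary.support ⊆ s) (S : Set Z)
    (hS : ∀ z ∈ S, f z = g z) : f.HomotopicRel g S :=
  let ⟨H, _⟩ := exists_homotopyRel_of_common_face f g h S hS
  ⟨H⟩

/-- Lifting a map along an injection of vertex sets. -/
theorem exists_lift {Z : Type*} [TopologicalSpace Z] [CompactSpace Z] {e : κ → ι}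
    (he : Function.Injective e) (L : PreAbstractSimplicialComplex κ) (a : C(Z, Realization K))
    (h : ∀ z, ∃ t ∈ L.faces, ∀ i ∈ (a z).bary.support, ∃ j ∈ t, e j = i) :
    ∃ a' : C(Z, Realization L), ∀ z j, (a' z).bary j = (a z).bary (e j) := by
  classical
  obtain ⟨F, hF⟩ := exists_finset_support_subset a
  refine exists_map L (F.preimage e he.injOn) (fun z j => (a z).bary (e j))
    (fun z j => (a z).nonneg _) (fun z => ?_) (fun z j hj => ?_) (fun z => ?_)
    (fun j => (Realization.continuous_coord _).comp a.continuous)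
  · rw [← (a z).sum_eq_one (hF z), Finset.sum_preimage e F he.injOn (fun i => (a z).bary i)]
    intro i _ hi
    by_contra h0
    obtain ⟨t, -, ht⟩ := h z
    obtain ⟨j, -, hj⟩ := ht i (Finsupp.mem_support_iff.2 h0)
    exact hi ⟨j, hj⟩
  · rw [Finset.mem_preimage] at hj
    exact Finsupp.notMem_support_iff.1 fun h => hj (hF z h)
  · obtain ⟨t, htL, ht⟩ := h z
    refine ⟨t, htL, fun j hj => ?_⟩
    obtain ⟨j', hj', h⟩ := ht _ (Finsupp.mem_support_iff.2 hj)
    exact he h ▸ hj'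

/-- A map of vertices that sends simplices into simplices induces a map of realizations. -/
noncomputable def simplicialMap {L : PreAbstractSimplicialComplex κ} (e : κ → ι)
    (h : ∀ t ∈ L.faces, ∃ s ∈ K.faces, ∀ j ∈ t, e j ∈ s) : C(Realization L, Realization K) :=
  realizationMap L K e fun t ht => by
    classical
    obtain ⟨s, hs, hts⟩ := h t ht
    refine (K.isRelLowerSet_faces hs).2 (fun i hi => ?_) ?_
    · obtain ⟨j, hj, rfl⟩ := Finset.mem_image.1 hi
      exact hts j hj
    · exact (Finset.image_nonempty (f := e)).2 (L.isRelLowerSet_faces ht).1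

theorem simplicialMap_apply {L : PreAbstractSimplicialComplex κ} {e : κ → ι}
    (he : Function.Injective e) (h) (x : Realization L) (j : κ) :
    (simplicialMap (K := K) e h x).bary (e j) = x.bary j :=
  Finsupp.mapDomain_apply he _ _

theorem simplicialMap_apply_of_notMem_range {L : PreAbstractSimplicialComplex κ} {e : κ → ι}
    (h) (x : Realization L) {i : ι} (hi : i ∉ Set.range e) :
    (simplicialMap (K := K) e h x).bary i = 0 :=
  Finsupp.mapDomain_of_notMem_range _ _ hi

theorem exists_of_mem_support_simplicialMap {L : PreAbstractSimplicialComplex κ} {e : κ → ι}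
    (h) (x : Realization L) {i : ι} (hi : i ∈ (simplicialMap (K := K) e h x).bary.support) :
    ∃ j ∈ x.bary.support, e j = i := by
  classical
  exact Finset.mem_image.1 (Finsupp.mapDomain_support hi)

/-- The map of realizations induced by the inclusion of a subcomplex. -/
noncomputable def inclMap {L : PreAbstractSimplicialComplex ι} (h : L.faces ⊆ K.faces) :
    C(Realization L, Realization K) :=
  simplicialMap id fun s hs => ⟨s, h hs, fun _ hi => hi⟩

theorem inclMap_apply {L : PreAbstractSimplicialComplex ι} (h : L.faces ⊆ K.faces)
    (x : Realization L) (i : ι) : (inclMap h x).bary i = x.bary i :=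
  simplicialMap_apply Function.injective_id _ x i

theorem support_inclMap {L : PreAbstractSimplicialComplex ι} (h : L.faces ⊆ K.faces)
    (x : Realization L) : (inclMap h x).bary.support = x.bary.support := by
  ext i
  rw [Finsupp.mem_support_iff, Finsupp.mem_support_iff, inclMap_apply]

theorem exists_lift_incl {Z : Type*} [TopologicalSpace Z] [CompactSpace Z]
    (L : PreAbstractSimplicialComplex ι) (a : C(Z, Realization K))
    (h : ∀ z, (a z).bary.support ∈ L.faces) :
    ∃ a' : C(Z, Realization L), ∀ z i, (a' z).bary i = (a z).bary i :=
  exists_lift Function.injective_id L a fun z => ⟨_, h z, fun i hi => ⟨i, hi, rfl⟩⟩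

/-- Connectivity only depends on the isomorphism type of a complex. -/
theorem IsConn.of_injective {k : ℤ} {L : PreAbstractSimplicialComplex κ} {e : κ → ι}
    (he : Function.Injective e) (hLK : ∀ t ∈ L.faces, ∃ s ∈ K.faces, ∀ j ∈ t, e j ∈ s)
    (hKL : ∀ s ∈ K.faces, ∃ t ∈ L.faces, ∀ i ∈ s, ∃ j ∈ t, e j = i)
    (hL : IsConn k (Realization L)) : IsConn k (Realization K) := by
  intro d hd a
  obtain ⟨a', ha'⟩ := exists_lift he L a fun z => hKL _ (a z).support_mem
  obtain ⟨c, hc⟩ := hL d hd a'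
  refine ⟨(simplicialMap e hLK).comp c, fun s => Realization.ext fun i => ?_⟩
  rw [ContinuousMap.comp_apply, hc]
  by_cases hi : i ∈ Set.range e
  · obtain ⟨j, rfl⟩ := hi
    rw [simplicialMap_apply he, ha']
  · rw [simplicialMap_apply_of_notMem_range _ _ hi]
    refine (Finsupp.notMem_support_iff.1 fun h => hi ?_).symm
    obtain ⟨t, -, hst⟩ := hKL _ (a s).support_mem
    obtain ⟨j, -, hj⟩ := hst i h
    exact ⟨j, hj⟩

theorem IsConn.mono {k l : ℤ} {X : Type*} [TopologicalSpace X] (h : IsConn k X) (hl : l ≤ k) :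
    IsConn l X := fun d hd => h d (hd.trans hl)

end Basics

/-! ### Disks and spheres -/

section Disks

variable {d : ℕ}

theorem norm_bdry (s : Sphere d) : ‖(bdry s : Disk d).1‖ = 1 := mem_sphere_zero_iff_norm.1 s.2

theorem norm_disk_le (x : Disk d) : ‖x.1‖ ≤ 1 := mem_closedBall_zero_iff.1 x.2

theorem continuous_bdry : Continuous (bdry (d := d)) :=
  continuous_induced_rng.2 continuous_subtype_val

theorem exists_bdry_eq (x : Disk d) (hx : ‖x.1‖ = 1) : ∃ s : Sphere d, bdry s = x :=
  ⟨⟨x.1, mem_sphere_zero_iff_norm.2 hx⟩, rfl⟩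

/-- The self-map of the disk that expands the disk of radius `1/2` to the whole disk and collapses
the outer collar radially onto the boundary. -/
noncomputable def stretch (d : ℕ) : C(Disk d, Disk d) where
  toFun x := ⟨(max (1 / 2) ‖x.1‖)⁻¹ • x.1, by
    rw [mem_closedBall_zero_iff, norm_smul, norm_inv, Real.norm_of_nonneg (by positivity)]
    rw [inv_mul_le_iff₀ (by positivity), mul_one]
    exact le_max_right _ _⟩
  continuous_toFun := by
    have h : Continuous fun x : Disk d => (max (1 / 2) ‖x.1‖)⁻¹ :=
      Continuous.inv₀ (by fun_prop) fun x => by positivity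
    exact continuous_induced_rng.2 (h.smul continuous_subtype_val)

theorem norm_stretch {x : Disk d} (hx : 1 / 2 ≤ ‖x.1‖) : ‖(stretch d x).1‖ = 1 := by
  change ‖(max (1 / 2) ‖x.1‖)⁻¹ • x.1‖ = 1
  rw [max_eq_right hx, norm_smul, norm_inv, norm_norm, inv_mul_cancel₀]
  linarith

theorem stretch_bdry (s : Sphere d) : stretch d (bdry s) = bdry s := by
  apply Subtype.ext
  change (max (1 / 2) ‖(bdry s).1‖)⁻¹ • (bdry s).1 = (bdry s).1
  rw [norm_bdry]
  norm_num

theorem homotopicRel_comp_stretch {Y : Type*} [TopologicalSpace Y] (b : C(Disk d, Y)) :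
    (b.comp (stretch d)).HomotopicRel b (Set.range (bdry (d := d))) := by
  let H : C(unitInterval × Disk d, Disk d) := ⟨fun p =>
    ⟨(1 - p.1 : ℝ) • (stretch d p.2).1 + (p.1 : ℝ) • p.2.1,
      (convex_closedBall _ _) (stretch d p.2).2 p.2.2 (sub_nonneg.2 p.1.2.2) p.1.2.1 (by ring)⟩,
    continuous_induced_rng.2 (by
      have h : Continuous fun p : unitInterval × Disk d => (stretch d p.2).1 :=
        continuous_subtype_val.comp ((stretch d).continuous.comp continuous_snd)
      exact ((continuous_const.sub (continuous_subtype_val.comp continuous_fst)).smul h).add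
        ((continuous_subtype_val.comp continuous_fst).smul
          (continuous_subtype_val.comp continuous_snd)))⟩
  refine ⟨⟨⟨b.comp H, fun x => ?_, fun x => ?_⟩, ?_⟩⟩
  · exact congrArg b (Subtype.ext (by simp [H]))
  · exact congrArg b (Subtype.ext (by simp [H]))
  · rintro t _ ⟨s, rfl⟩
    refine congrArg b (Subtype.ext ?_)
    simp only [H, ContinuousMap.coe_mk, stretch_bdry, ← add_smul, sub_add_cancel, one_smul]

/-- Gluing a map on a disk to a homotopy on its boundary, which is put on an outer collar. -/
theorem exists_collar {Y : Type*} [TopologicalSpace Y] (b : C(Disk d, Y))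
    (H : C(unitInterval × Sphere d, Y)) (h0 : ∀ s, H (0, s) = b (bdry s)) :
    ∃ G : C(Disk d, Y), (∀ s, G (bdry s) = H (1, s)) ∧
      ∀ x, G x = b (stretch d x) ∨ ∃ t s, bdry s = stretch d x ∧ G x = H (t, s) := by
  classical
  by_cases hS : Nonempty (Sphere d)
  swap
  · exact ⟨b.comp (stretch d), fun s => (hS ⟨s⟩).elim, fun x => Or.inl rfl⟩
  obtain ⟨s₀⟩ := hS
  let N : Disk d → Sphere d := fun x => if h : 1 / 2 ≤ ‖x.1‖ then
    ⟨(stretch d x).1, mem_sphere_zero_iff_norm.2 (norm_stretch h)⟩ else s₀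
  have hN : ∀ x : Disk d, 1 / 2 ≤ ‖x.1‖ → bdry (N x) = stretch d x := fun x h => by
    simp only [N, dif_pos h]
    rfl
  let τ : Disk d → unitInterval := fun x => ⟨max 0 (2 * ‖x.1‖ - 1), le_max_left _ _,
    max_le zero_le_one (by linarith [norm_disk_le x])⟩
  have hτ : Continuous τ := continuous_induced_rng.2 (by
    change Continuous fun x : Disk d => max 0 (2 * ‖x.1‖ - 1)
    fun_prop)
  have hNc : ContinuousOn N {x | 1 / 2 ≤ ‖x.1‖} := by
    rw [continuousOn_iff_continuous_domRestrict]
    refine continuous_induced_rng.2 ?_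
    have : Continuous fun x : {x : Disk d | 1 / 2 ≤ ‖x.1‖} => (stretch d x.1).1 :=
      continuous_subtype_val.comp ((stretch d).continuous.comp continuous_subtype_val)
    refine this.congr fun x => ?_
    exact (congrArg Subtype.val (hN x.1 x.2)).symm
  have hG : Continuous fun x : Disk d =>
      if ‖x.1‖ ≤ 1 / 2 then b (stretch d x) else H (τ x, N x) := by
    refine continuous_if_le (by fun_prop) (by fun_prop) (by fun_prop) ?_ fun x hx => ?_
    · exact H.continuous.comp_continuousOn (hτ.continuousOn.prodMk hNc)
    · have : τ x = 0 := Subtype.ext (by simp [τ, hx])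
      rw [this, h0, hN x hx.ge]
  refine ⟨⟨_, hG⟩, fun s => ?_, fun x => ?_⟩
  · have h1 : ¬ ‖(bdry s : Disk d).1‖ ≤ 1 / 2 := by rw [norm_bdry]; norm_num
    have h2 : τ (bdry s) = 1 := Subtype.ext (by simp [τ, norm_bdry]; norm_num)
    have h3 : N (bdry s) = s := by
      have := hN (bdry s) (not_le.1 h1).le
      rw [stretch_bdry] at this
      exact Subtype.ext (congrArg (fun y : Disk d => y.1) this)
    simp only [ContinuousMap.coe_mk, if_neg h1, h2, h3]
  · by_cases h : ‖x.1‖ ≤ 1 / 2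
    · left
      simp only [ContinuousMap.coe_mk, if_pos h]
    · right
      refine ⟨τ x, N x, hN x (not_le.1 h).le, ?_⟩
      simp only [ContinuousMap.coe_mk, if_neg h]

/-- Whether a map on a sphere extends over the disk depends only on its homotopy class. -/
theorem exists_extension_of_homotopic {Y : Type*} [TopologicalSpace Y] {a a' : C(Sphere d, Y)}
    (h : a.Homotopic a') (c : C(Disk d, Y)) (hc : ∀ s, c (bdry s) = a' s) :
    ∃ c : C(Disk d, Y), ∀ s, c (bdry s) = a s := by
  obtain ⟨H⟩ := h.symm
  obtain ⟨G, hG, -⟩ := exists_collar c H.toContinuousMap fun s => by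
    rw [hc]
    exact H.apply_zero s
  exact ⟨G, fun s => (hG s).trans (H.apply_one s)⟩

variable {ι : Type*}

/-- A map from a sphere into a cone extends over the disk, inside the cone. -/
theorem exists_cone_extension (K : PreAbstractSimplicialComplex ι) (v : ι)
    (hv : {v} ∈ K.faces) (a : C(Sphere d, Realization K))
    (h : ∀ s, ∃ t ∈ K.faces, v ∈ t ∧ (a s).bary.support ⊆ t) :
    ∃ c : C(Disk d, Realization K), (∀ s, c (bdry s) = a s) ∧
      ∀ x, (∀ i ∈ (c x).bary.support, i = v) ∨
        ∃ s, ∀ i ∈ (c x).bary.support, i = v ∨ i ∈ (a s).bary.support := by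
  classical
  obtain ⟨p, hp⟩ := exists_map (Z := PUnit.{1}) K {v} (fun _ i => if i = v then 1 else 0)
    (fun _ i => by split_ifs <;> simp) (fun _ => by simp)
    (fun _ i hi => if_neg fun h => hi (Finset.mem_singleton.2 h))
    (fun _ => ⟨{v}, hv, fun i hi => by simpa using hi⟩) (fun i => continuous_const)
  have hp' : (p ⟨⟩).bary.support ⊆ {v} := fun i hi => by
    rw [Finsupp.mem_support_iff, hp] at hi
    simpa using hi
  obtain ⟨H, hH⟩ := exists_homotopyRel_of_common_face (ContinuousMap.const (Sphere d) (p ⟨⟩)) a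
    (fun s => by
      obtain ⟨t, ht, hvt, hst⟩ := h s
      exact ⟨t, ht, hp'.trans (Finset.singleton_subset_iff.2 hvt), hst⟩) ∅ (by simp)
  obtain ⟨c, hc, hc'⟩ := exists_collar (ContinuousMap.const (Disk d) (p ⟨⟩)) H.toContinuousMap
    fun s => H.apply_zero s
  refine ⟨c, fun s => (hc s).trans (H.apply_one s), fun x => ?_⟩
  rcases hc' x with h | ⟨t, s, -, h⟩
  · left
    rw [h]
    exact fun i hi => Finset.mem_singleton.1 (hp' hi)
  · right
    refine ⟨s, fun i hi => ?_⟩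
    by_contra hi'
    rw [not_or] at hi'
    rw [h] at hi
    refine Finsupp.mem_support_iff.1 hi (hH t s i ?_ (Finsupp.notMem_support_iff.1 hi'.2))
    exact Finsupp.notMem_support_iff.1 fun h => hi'.1 (Finset.mem_singleton.1 (hp' h))

/-- A simplex with `d + 1` vertices is homeomorphic to the disk `D^d`, with its boundary
corresponding to the sphere. -/
theorem exists_stdSimplex_homeomorph_disk (σ : Type*) [Fintype σ] (hσ : Fintype.card σ = d + 1) :
    ∃ h : stdSimplex ℝ σ ≃ₜ Disk d, ∀ y, ‖(h y).1‖ = 1 ↔ ∃ i, y.1 i = 0 := by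
  let E := EuclideanSpace ℝ (Fin d)
  obtain ⟨b⟩ : Nonempty (AffineBasis σ ℝ E) :=
    AffineBasis.exists_affineBasis_of_finiteDimensional (by simp [E, hσ])
  let s : Set E := convexHull ℝ (Set.range b)
  have hs : s = {x | ∀ i, 0 ≤ b.coord i x} := b.convexHull_eq_nonneg_coord
  have hint : interior s = {x | ∀ i, 0 < b.coord i x} := b.interior_convexHull
  have hcl : IsClosed s := (Set.finite_range b).isClosed_convexHull ℝ
  obtain ⟨g, hg1, hg2, hg3⟩ := exists_homeomorph_image_interior_closure_frontier_eq_unitBall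
    (convex_convexHull ℝ (Set.range b)) ⟨_, b.centroid_mem_interior_convexHull⟩
    (isBounded_convexHull.2 (Set.finite_range b).isBounded)
  have hcoord : ∀ (y : stdSimplex ℝ σ) i,
      b.coord i (Finset.univ.affineCombination ℝ b y.1) = y.1 i := fun y i =>
    b.coord_apply_combination_of_mem (Finset.mem_univ i) y.2.2
  have hmem : ∀ y : stdSimplex ℝ σ, Finset.univ.affineCombination ℝ b y.1 ∈ s := fun y => by
    rw [hs]
    intro i
    rw [hcoord]
    exact y.2.1 i
  have hgs : g '' s = Metric.closedBall 0 1 := by rw [← hg2]; exact congrArg _ hcl.closure_eq.symm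
  let f : stdSimplex ℝ σ ≃ Disk d :=
    { toFun := fun y => ⟨g (Finset.univ.affineCombination ℝ b y.1), by
        rw [← hgs]
        exact Set.mem_image_of_mem _ (hmem y)⟩
      invFun := fun x => ⟨fun i => b.coord i (g.symm x.1), by
        obtain ⟨z, hz, hzx⟩ : x.1 ∈ g '' s := by rw [hgs]; exact x.2
        rw [← hzx, g.symm_apply_apply]
        rw [hs] at hz
        exact ⟨hz, b.sum_coord_apply_eq_one z⟩⟩
      left_inv := fun y => Subtype.ext <| funext fun i => by
        simp only [g.symm_apply_apply, hcoord]
      right_inv := fun x => Subtype.ext <| by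
        change g (Finset.univ.affineCombination ℝ b fun i => b.coord i (g.symm x.1)) = x.1
        rw [b.affineCombination_coord_eq_self, g.apply_symm_apply] }
  have hf : Continuous f := by
    refine continuous_induced_rng.2 (g.continuous.comp ?_)
    have : Continuous fun y : stdSimplex ℝ σ => ∑ i, y.1 i • b i :=
      continuous_finsetSum _ fun i _ =>
        ((continuous_apply i).comp continuous_subtype_val).smul continuous_const
    refine this.congr fun y => ?_
    rw [Finset.affineCombination_eq_linear_combination _ _ _ y.2.2]
  refine ⟨hf.homeoOfEquivCompactToT2, fun y => ?_⟩
  change ‖g (Finset.univ.affineCombination ℝ b y.1)‖ = 1 ↔ _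
  rw [← mem_sphere_zero_iff_norm, ← hg3, g.injective.mem_set_image, hcl.frontier_eq]
  rw [hint, Set.mem_sdiff]
  simp only [hmem y, true_and, Set.mem_ofPred_eq, not_forall, not_lt, hcoord]
  exact exists_congr fun i => ⟨fun h => le_antisymm h (y.2.1 i), fun h => h.le⟩

end Disks

/-! ### Extending maps over simplicial complexes -/

section Extension

variable {ι : Type*} {Y : Type*} [TopologicalSpace Y]

/-- Reinterpreting a point of a realization in another complex containing its support. -/
def Realization.cast {K : PreAbstractSimplicialComplex ι} (L : PreAbstractSimplicialComplex ι)
    (x : Realization K) (h : x.bary.support ∈ L.faces) : Realization L :=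
  ⟨x.1, x.2.1, x.2.2.1, h⟩

/-- The set `C` has the extension property for maps from the sphere `S^(d-1)`. -/
def ExtendsIn (d : ℕ) (C : Set Y) : Prop :=
  ∀ a : C(Sphere d, Y), (∀ s, a s ∈ C) →
    ∃ c : C(Disk d, Y), (∀ s, c (bdry s) = a s) ∧ ∀ x, c x ∈ C

/-- Extension over a single simplex, whose boundary lies in `W`. -/
theorem exists_extension_simplex (W : PreAbstractSimplicialComplex ι) (s : Finset ι) (d : ℕ)
    (hd : s.card = d + 1) (hW : ∀ t, t ⊂ s → t.Nonempty → t ∈ W.faces) (C : Set Y)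
    (hC : ExtendsIn d C) (φ : C(Realization W, Y))
    (hφ : ∀ x, x.bary.support ⊆ s → φ x ∈ C) :
    ∃ e : C(stdSimplex ℝ ↥s, Y), (∀ y, e y ∈ C) ∧ ∀ y, (∃ i, y.1 i = 0) →
      ∀ z : Realization W, z.bary.support ⊆ s → (∀ i : ↥s, z.bary i = y.1 i) → e y = φ z := by
  classical
  obtain ⟨h, hh⟩ := exists_stdSimplex_homeomorph_disk ↥s (d := d) (by simpa using hd)
  let c : Sphere d → ι → ℝ := fun x i => if hi : i ∈ s then (h.symm (bdry x)).1 ⟨i, hi⟩ else 0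
  have hc1 : ∀ x, ∑ i ∈ s, c x i = 1 := fun x => by
    rw [← (h.symm (bdry x)).2.2, ← Finset.sum_coe_sort]
    exact Finset.sum_congr rfl fun i _ => dif_pos i.2
  have hcs : ∀ x i, c x i ≠ 0 → i ∈ s := fun x i hi => by
    by_contra h'
    exact hi (dif_neg h')
  obtain ⟨p, hp⟩ := exists_map W s c
    (fun x i => by
      by_cases hi : i ∈ s
      · simp only [c, dif_pos hi]
        exact (h.symm (bdry x)).2.1 _
      · simp only [c, dif_neg hi, le_refl])
    hc1 (fun x i hi => dif_neg hi)
    (fun x => by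
      refine ⟨s.filter (c x · ≠ 0), hW _ ?_ ?_, fun i hi => Finset.mem_filter.2 ⟨hcs x i hi, hi⟩⟩
      · obtain ⟨i, hi⟩ := (hh (h.symm (bdry x))).1 (by rw [h.apply_symm_apply, norm_bdry])
        refine Finset.filter_ssubset.2 ⟨i, i.2, ?_⟩
        simp only [c, dif_pos i.2, not_not]
        exact hi
      · obtain ⟨i, hi, h0⟩ := Finset.exists_ne_zero_of_sum_ne_zero
          (f := c x) (by rw [hc1 x]; exact one_ne_zero)
        exact ⟨i, Finset.mem_filter.2 ⟨hi, h0⟩⟩)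
    (fun i => by
      by_cases hi : i ∈ s
      · simp only [c, dif_pos hi]
        exact (continuous_apply _).comp
          (continuous_subtype_val.comp (h.symm.continuous.comp continuous_bdry))
      · simp only [c, dif_neg hi]
        exact continuous_const)
  obtain ⟨e, he, heC⟩ := hC (φ.comp p) fun x => hφ _ fun i hi => by
    rw [Finsupp.mem_support_iff, hp] at hi
    exact hcs x i hi
  refine ⟨e.comp ⟨h, h.continuous⟩, fun y => heC _, fun y hy z hz hzy => ?_⟩
  obtain ⟨x, hx⟩ := exists_bdry_eq (h y) ((hh y).2 hy)
  change e (h y) = _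
  rw [← hx, he]
  refine congrArg φ (Realization.ext fun i => ?_)
  rw [hp]
  by_cases hi : i ∈ s
  · simp only [c, dif_pos hi, hx, h.symm_apply_apply]
    exact (hzy ⟨i, hi⟩).symm
  · simp only [c, dif_neg hi]
    exact (Finsupp.notMem_support_iff.1 fun h => hi (hz h)).symm

/-- Extension over simplices whose boundaries lie in `W`, all at once. -/
theorem exists_extension_level (Z W : PreAbstractSimplicialComplex ι) (C : Finset ι → Set Y)
    (hC : Monotone C)
    (hW : ∀ s ∈ Z.faces, s ∉ W.faces → ∀ t, t ⊂ s → t.Nonempty → t ∈ W.faces)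
    (hext : ∀ s ∈ Z.faces, s ∉ W.faces → ExtendsIn (s.card - 1) (C s))
    (φ : C(Realization W, Y)) (hφ : ∀ x, φ x ∈ C x.bary.support) :
    ∃ ψ : C(Realization Z, Y), (∀ x h, ψ x = φ (x.cast W h)) ∧ ∀ x, ψ x ∈ C x.bary.support := by
  classical
  -- one extension for each new simplex; they agree with `φ` on the boundary, so they fit together
  choose e heC he using fun s (hs : s ∈ Z.faces) (hs' : s ∉ W.faces) =>
    exists_extension_simplex W s (s.card - 1)
      (Nat.sub_add_cancel (Finset.card_pos.2 (Z.isRelLowerSet_faces hs).1)).symm (hW s hs hs')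
      (C s) (hext s hs hs') φ fun x hx => hC hx (hφ x)
  have hpt : ∀ (x : Realization Z) (s : Finset ι), x.bary.support ⊆ s →
      (fun i : ↥s => x.bary i) ∈ stdSimplex ℝ ↥s := fun x s hs =>
    ⟨fun i => x.nonneg i, by
      refine Eq.trans ?_ (x.sum_eq_one hs)
      exact Finset.sum_coe_sort s fun i => x.bary i⟩
  let ψ : Realization Z → Y := fun x => if h : x.bary.support ∈ W.faces then φ (x.cast W h)
    else e _ x.support_mem h ⟨_, hpt x _ subset_rfl⟩
  have hψW : ∀ x h, ψ x = φ (x.cast W h) := fun x h => dif_pos h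
  have key : ∀ x (t : Finset ι) (ht : t ∈ Z.faces) (ht' : t ∉ W.faces)
      (hxt : x.bary.support = t), ψ x = e t ht ht' ⟨_, hpt x t hxt.le⟩ := by
    rintro x _ ht ht' rfl
    exact dif_neg ht'
  have hψ : Continuous ψ := by
    refine Realization.continuous_dom fun s => ?_
    by_cases hs : s.1 ∈ W.faces
    · refine (φ.continuous.comp (continuous_simplexIncl ⟨s.1, hs⟩)).congr fun y => ?_
      have hface : (simplexIncl Z s y).bary.support ∈ W.faces :=
        (W.isRelLowerSet_faces hs).2 (support_simplexIncl_subset s y)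
          (Z.isRelLowerSet_faces (simplexIncl Z s y).support_mem).1
      exact (hψW _ hface).symm
    · refine (e s.1 s.2 hs).continuous.congr fun y => ?_
      by_cases hy : ∃ i, y.1 i = 0
      · have hsub : (simplexIncl Z s y).bary.support ⊂ s.1 := by
          obtain ⟨i, hi⟩ := hy
          refine Finset.ssubset_iff_subset_ne.2 ⟨support_simplexIncl_subset s y, fun h => ?_⟩
          have : (i : ι) ∈ (simplexIncl Z s y).bary.support := by rw [h]; exact i.2
          rw [Finsupp.mem_support_iff, simplexIncl_apply_mem] at this
          exact this hi
        have hface := hW s.1 s.2 hs _ hsub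
          (Z.isRelLowerSet_faces (simplexIncl Z s y).support_mem).1
        refine Eq.trans ?_ (hψW _ hface).symm
        exact he s.1 s.2 hs y hy _ hsub.subset fun i => simplexIncl_apply_mem s y i
      · have hsupp : (simplexIncl Z s y).bary.support = s.1 := by
          refine (support_simplexIncl_subset s y).antisymm fun i hi => ?_
          rw [Finsupp.mem_support_iff, simplexIncl_apply_mem s y ⟨i, hi⟩]
          exact fun h => hy ⟨_, h⟩
        refine Eq.trans ?_ (key _ s.1 s.2 hs hsupp).symm
        refine congrArg _ (Subtype.ext (funext fun i => ?_))
        exact (simplexIncl_apply_mem s y i).symm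
  refine ⟨⟨ψ, hψ⟩, hψW, fun x => ?_⟩
  change ψ x ∈ _
  by_cases h : x.bary.support ∈ W.faces
  · rw [hψW x h]
    exact hφ (x.cast W h)
  · rw [key x _ x.support_mem h rfl]
    exact heC _ _ _ _

/-- A map on a subcomplex `W` of `Z` extends over `Z`, respecting a monotone family of carriers `C`,
if the simplices of `Z` outside of `W` have bounded dimension and their carriers have the extension
property for the boundary spheres of these simplices. -/
theorem exists_extension (Z W : PreAbstractSimplicialComplex ι)
    (hWZ : W.faces ⊆ Z.faces) (C : Finset ι → Set Y) (hC : Monotone C) (N : ℕ)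
    (hN : ∀ s ∈ Z.faces, s ∉ W.faces → s.card ≤ N)
    (hext : ∀ s ∈ Z.faces, s ∉ W.faces → ExtendsIn (s.card - 1) (C s))
    (φ : C(Realization W, Y)) (hφ : ∀ x, φ x ∈ C x.bary.support) :
    ∃ ψ : C(Realization Z, Y), (∀ x h, ψ x = φ (x.cast W h)) ∧ ∀ x, ψ x ∈ C x.bary.support := by
  induction N generalizing Z with
  | zero =>
    refine exists_extension_level Z W C hC (fun s hs hs' => ?_) hext φ hφ
    have := hN s hs hs'
    rw [Nat.le_zero, Finset.card_eq_zero] at this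
    exact absurd this (Z.isRelLowerSet_faces hs).1.ne_empty
  | succ N ih =>
    -- the union of `W` and the simplices with at most `N` vertices
    let Z' : PreAbstractSimplicialComplex ι :=
      { faces := {s | s ∈ Z.faces ∧ (s ∈ W.faces ∨ s.card ≤ N)}
        isRelLowerSet_faces := by
          rintro s ⟨hs, hs'⟩
          refine ⟨(Z.isRelLowerSet_faces hs).1, fun t ht hne =>
            ⟨(Z.isRelLowerSet_faces hs).2 ht hne, ?_⟩⟩
          exact hs'.imp (fun h => (W.isRelLowerSet_faces h).2 ht hne)
            fun h => (Finset.card_le_card ht).trans h }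
    obtain ⟨ψ', h1, h2⟩ := ih Z' (fun s hs => ⟨hWZ hs, Or.inl hs⟩)
      (fun s hs hs' => hs.2.resolve_left hs') (fun s hs hs' => hext s hs.1 hs')
    obtain ⟨ψ, h3, h4⟩ := exists_extension_level Z Z' C hC
      (fun s hs hs' t ht hne => by
        have h5 := hN s hs fun h => hs' ⟨hs, Or.inl h⟩
        have := Finset.card_lt_card ht
        exact ⟨(Z.isRelLowerSet_faces hs).2 ht.subset hne, Or.inr (by omega)⟩)
      (fun s hs hs' => hext s hs fun h => hs' ⟨hs, Or.inl h⟩) ψ' h2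
    exact ⟨ψ, fun x h => (h3 x ⟨hWZ h, Or.inl h⟩).trans (h1 (x.cast Z' _) h), h4⟩

end Extension

/-! ### General position -/

section GeneralPosition

open Manifold in
theorem exists_contDiff_near {d N : ℕ} (h : C(EuclideanSpace ℝ (Fin d), Fin N → ℝ)) {ε : ℝ}
    (hε : 0 < ε) : ∃ P : EuclideanSpace ℝ (Fin d) → Fin N → ℝ, ContDiff ℝ 1 P ∧
      ∀ x i, |P x i - h x i| < ε := by
  obtain ⟨P, hP⟩ := exists_contMDiffMap_forall_mem_convex_of_local_const (n := 1)
    (I := 𝓘(ℝ, EuclideanSpace ℝ (Fin d))) (F := Fin N → ℝ)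
    (t := fun x => Metric.ball (h x) ε) (fun x => convex_ball _ _) (fun x => by
      refine ⟨h x, ?_⟩
      have : Filter.Tendsto (fun y => dist (h x) (h y)) (nhds x) (nhds 0) := by
        have hc : Continuous fun y => dist (h x) (h y) := by fun_prop
        simpa using hc.tendsto x
      filter_upwards [this.eventually (gt_mem_nhds hε)] with y hy
      exact hy)
  refine ⟨P, P.contMDiff.contDiff, fun x i => ?_⟩
  have h1 := hP x
  rw [mem_ball_iff_norm] at h1
  exact (norm_le_pi_norm (P x - h x) i).trans_lt h1

/-- The space `Z` has dimension at most `k` for the purposes of general position: a map from `Z` to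
`ℝ^N` with `N ≥ k + 2` can be perturbed such that the cone over its image misses a point close to
`(1, …, 1)`. -/
def SmallDim (k : ℤ) (Z : Type*) [TopologicalSpace Z] : Prop :=
  ∀ N : ℕ, k + 2 ≤ N → ∀ (h : C(Z, Fin N → ℝ)) (ε : ℝ), 0 < ε →
    ∃ (p : C(Z, Fin N → ℝ)) (q : Fin N → ℝ), (∀ z i, |p z i - h z i| < ε) ∧
      (∀ i, |q i - 1| < ε) ∧ ∀ (z : Z) (t : ℝ), 0 < t → t • p z ≠ q

theorem exists_near_one_of_dense_compl {N : ℕ} {A : Set (Fin N → ℝ)} (hA : Dense Aᶜ) {ε : ℝ}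
    (hε : 0 < ε) : ∃ q ∉ A, ∀ i, |q i - 1| < ε := by
  obtain ⟨q, hq, h⟩ := Metric.dense_iff.1 hA 1 ε hε
  refine ⟨q, h, fun i => ?_⟩
  rw [mem_ball_iff_norm] at hq
  exact (norm_le_pi_norm (q - 1) i).trans_lt hq

/-- After a smooth approximation the cone over the image is the image of a `C^1` map from
`ℝ^(d+1)`, which has dense complement in `ℝ^N` since `d + 1 < N`. -/
theorem smallDim_disk (d : ℕ) : SmallDim d (Disk d) := by
  intro N hN h ε hε
  obtain ⟨g, hg⟩ := ContinuousMap.exists_extension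
    (Metric.isClosed_closedBall (x := (0 : EuclideanSpace ℝ (Fin d)))
      (ε := 1)).isClosedEmbedding_subtypeVal h
  obtain ⟨P, hP, hPg⟩ := exists_contDiff_near g hε
  have hQ : ContDiff ℝ 1 fun x : EuclideanSpace ℝ (Fin d) × ℝ => x.2 • P x.1 :=
    contDiff_snd.smul (hP.comp contDiff_fst)
  obtain ⟨q, hqA, hq⟩ := exists_near_one_of_dense_compl
    (hQ.dense_compl_range_of_finrank_lt_finrank (by
      simp only [Module.finrank_prod, finrank_euclideanSpace, Fintype.card_fin,
        Module.finrank_self, Module.finrank_fintype_fun_eq_card]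
      omega)) hε
  refine ⟨⟨fun z => P z.1, hP.continuous.comp continuous_subtype_val⟩, q, fun z i => ?_, hq,
    fun z t _ h => hqA ⟨(z.1, t), h⟩⟩
  rw [← hg]
  exact hPg z.1 i

/-- A sphere has dimension one less than the ambient space, so here the dimension of the cone over
the image is at most `d`. -/
theorem smallDim_sphere (d : ℕ) : SmallDim ((d : ℤ) - 1) (Sphere d) := by
  intro N hN h ε hε
  obtain ⟨g, hg⟩ := ContinuousMap.exists_extension
    (Metric.isClosed_sphere (x := (0 : EuclideanSpace ℝ (Fin d)))
      (ε := 1)).isClosedEmbedding_subtypeVal h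
  obtain ⟨P, hP, hPg⟩ := exists_contDiff_near g hε
  -- the cone over `P '' S^(d-1)` is a locally Lipschitz image of `ℝ^d` without the origin
  let Q : EuclideanSpace ℝ (Fin d) → Fin N → ℝ := fun y => ‖y‖ • P (‖y‖⁻¹ • y)
  have hQ : ∀ y ≠ 0, ContDiffAt ℝ 1 Q y := fun y hy =>
    (contDiffAt_norm ℝ hy).smul (hP.contDiffAt.comp y
      (((contDiffAt_norm ℝ hy).inv (norm_ne_zero_iff.2 hy)).smul contDiffAt_id))
  have hdim : dimH (Q '' {0}ᶜ) ≤ d := by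
    refine (dimH_image_le_of_locally_lipschitzOn fun y hy => ?_).trans
      ((dimH_mono (Set.subset_univ _)).trans ?_)
    · obtain ⟨C, t, ht, hC⟩ := (hQ y hy).exists_lipschitzOnWith
      exact ⟨C, t, mem_nhdsWithin_of_mem_nhds ht, hC⟩
    · rw [Real.dimH_univ_eq_finrank, finrank_euclideanSpace, Fintype.card_fin]
  obtain ⟨q, hqA, hq⟩ := exists_near_one_of_dense_compl
    (dense_compl_of_dimH_lt_finrank (hdim.trans_lt (by
      rw [Module.finrank_fintype_fun_eq_card, Fintype.card_fin]
      exact_mod_cast (by omega : d < N)))) hε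
  refine ⟨⟨fun z => P z.1, hP.continuous.comp continuous_subtype_val⟩, q, fun z i => ?_, hq,
    fun z t ht h => hqA ⟨t • z.1, ?_, ?_⟩⟩
  · rw [← hg]
    exact hPg z.1 i
  · have hz : z.1 ≠ 0 := fun h0 => by
      have := norm_bdry z
      change ‖z.1‖ = 1 at this
      rw [h0, norm_zero] at this
      exact zero_ne_one this
    exact smul_ne_zero ht.ne' hz
  · have hz : ‖z.1‖ = 1 := norm_bdry z
    change ‖t • z.1‖ • P (‖t • z.1‖⁻¹ • t • z.1) = q
    rw [norm_smul, hz, mul_one, Real.norm_of_nonneg ht.le, inv_smul_smul₀ ht.ne']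
    exact h

end GeneralPosition

/-! ### Cellular approximation -/

section Push

variable {σ : Type*} [Fintype σ] [Nonempty σ]

/-- A cutoff function which is positive only where all coordinates exceed `ε`, and is `1` where they
exceed `2ε`. -/
noncomputable def pushCutoff (ε : ℝ) (g : σ → ℝ) : ℝ :=
  max 0 (min 1 ((Finset.univ.inf' Finset.univ_nonempty g - ε) / ε))

/-- The point `g` of the open cone over a simplex, replaced by `p` away from the boundary. -/
noncomputable def pushMix (ε : ℝ) (g p : σ → ℝ) (i : σ) : ℝ :=
  (1 - pushCutoff ε g) * g i + pushCutoff ε g * p i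

/-- The result of pushing `pushMix ε g p` to the boundary of the cone along the direction `q`. -/
noncomputable def pushOff (ε : ℝ) (g p q : σ → ℝ) (i : σ) : ℝ :=
  pushMix ε g p i - Finset.univ.inf' Finset.univ_nonempty (fun j => pushMix ε g p j / q j) * q i

theorem continuous_pushMix {Z : Type*} [TopologicalSpace Z] (ε : ℝ) {g p : Z → σ → ℝ}
    (hg : ∀ i, Continuous fun z => g z i) (hp : ∀ i, Continuous fun z => p z i) (i : σ) :
    Continuous fun z => pushMix ε (g z) (p z) i := by
  have h : Continuous fun z => pushCutoff ε (g z) := by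
    refine continuous_const.max (continuous_const.min (Continuous.div_const (Continuous.sub ?_
      continuous_const) _))
    exact Continuous.finset_inf'_apply _ fun i _ => hg i
  exact ((continuous_const.sub h).mul (hg i)).add (h.mul (hp i))

theorem continuous_pushOff {Z : Type*} [TopologicalSpace Z] (ε : ℝ) {g p : Z → σ → ℝ}
    (q : σ → ℝ) (hg : ∀ i, Continuous fun z => g z i) (hp : ∀ i, Continuous fun z => p z i)
    (i : σ) : Continuous fun z => pushOff ε (g z) (p z) q i := by
  refine (continuous_pushMix ε hg hp i).sub (Continuous.mul ?_ continuous_const)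
  exact Continuous.finset_inf'_apply _ fun j _ => (continuous_pushMix ε hg hp j).div_const _

theorem pushCutoff_mem (ε : ℝ) (g : σ → ℝ) : 0 ≤ pushCutoff ε g ∧ pushCutoff ε g ≤ 1 :=
  ⟨le_max_left _ _, max_le zero_le_one (min_le_left _ _)⟩

theorem lt_of_pushCutoff_pos {ε : ℝ} (hε : 0 < ε) {g : σ → ℝ} (h : 0 < pushCutoff ε g) (i : σ) :
    ε < g i := by
  have h1 : 0 < (Finset.univ.inf' Finset.univ_nonempty g - ε) / ε := by
    rcases lt_max_iff.1 h with h | h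
    · exact absurd h (lt_irrefl _)
    · exact (lt_min_iff.1 h).2
  have h2 : 0 < Finset.univ.inf' Finset.univ_nonempty g - ε := by
    rwa [div_pos_iff_of_pos_right hε] at h1
  have h3 := Finset.inf'_le g (Finset.mem_univ i)
  linarith

theorem exists_lt_of_pushCutoff_lt_one {ε : ℝ} (hε : 0 < ε) {g : σ → ℝ}
    (h : pushCutoff ε g < 1) : ∃ i, g i < 2 * ε := by
  obtain ⟨i, -, hi⟩ := Finset.exists_mem_eq_inf' Finset.univ_nonempty g
  refine ⟨i, ?_⟩
  have h1 := (max_lt_iff.1 h).2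
  rcases min_lt_iff.1 h1 with h | h
  · exact absurd h (lt_irrefl _)
  · rw [hi, div_lt_one hε] at h
    linarith

theorem pushOff_nonneg (ε : ℝ) (g p : σ → ℝ) {q : σ → ℝ} (hq : ∀ i, 0 < q i) (i : σ) :
    0 ≤ pushOff ε g p q i := by
  have := Finset.inf'_le (fun j => pushMix ε g p j / q j) (Finset.mem_univ i)
  rw [le_div_iff₀ (hq i)] at this
  exact sub_nonneg.2 this

theorem exists_pushOff_eq_zero (ε : ℝ) (g p : σ → ℝ) {q : σ → ℝ} (hq : ∀ i, 0 < q i) :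
    ∃ i, pushOff ε g p q i = 0 := by
  obtain ⟨i, -, hi⟩ := Finset.exists_mem_eq_inf' Finset.univ_nonempty
    (fun j => pushMix ε g p j / q j)
  refine ⟨i, ?_⟩
  rw [pushOff, hi, div_mul_cancel₀ _ (hq i).ne', sub_self]

/-- Nothing is moved on the boundary. -/
theorem pushOff_eq_self {ε : ℝ} (hε : 0 < ε) {g p q : σ → ℝ} (hq : ∀ i, 0 < q i)
    (hg : ∀ i, 0 ≤ g i) (h : ∃ i, g i = 0) : pushOff ε g p q = g := by
  obtain ⟨i, hi⟩ := h
  have h0 : pushCutoff ε g = 0 := by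
    by_contra hne
    have := lt_of_pushCutoff_pos hε (lt_of_le_of_ne (pushCutoff_mem ε g).1 (Ne.symm hne)) i
    linarith
  have hw : pushMix ε g p = g := by
    funext j
    simp [pushMix, h0]
  have hl : Finset.univ.inf' Finset.univ_nonempty (fun j => pushMix ε g p j / q j) = 0 := by
    apply le_antisymm
    · refine (Finset.inf'_le _ (Finset.mem_univ i)).trans ?_
      simp [hw, hi]
    · rw [Finset.le_inf'_iff]
      intro j _
      rw [hw]
      exact div_nonneg (hg j) (hq j).le
  funext j
  rw [pushOff, hl, hw, zero_mul, sub_zero]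

/-- If `ε` is small and `q` is close to `(1, …, 1)` and not in the cone over `p`, then no point is
pushed to the apex of the cone. -/
theorem sum_pushOff_pos {ε : ℝ} (hε : ε = 1 / (10 * Fintype.card σ)) {g p q : σ → ℝ}
    (hg1 : ∑ i, g i = 1) (hp : ∀ i, |p i - g i| < ε) (hq : ∀ i, |q i - 1| < ε)
    (hpq : ∀ t : ℝ, 0 < t → t • p ≠ q) : 0 < ∑ i, pushOff ε g p q i := by
  have hn : (1 : ℝ) ≤ Fintype.card σ := by exact_mod_cast Fintype.card_pos
  have hε0 : 0 < ε := by rw [hε]; positivity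
  have hεn : ε * Fintype.card σ = 1 / 10 := by rw [hε]; field_simp
  have hε1 : ε ≤ 1 / 10 := by nlinarith
  have hq0 : ∀ i, 0 < q i := fun i => by linarith [(abs_lt.1 (hq i)).1]
  refine lt_of_le_of_ne (Finset.sum_nonneg fun i _ => pushOff_nonneg ε g p hq0 i) fun h => ?_
  have hu : ∀ i, pushOff ε g p q i = 0 := fun i =>
    (Finset.sum_eq_zero_iff_of_nonneg fun i _ => pushOff_nonneg ε g p hq0 i).1 h.symm i
      (Finset.mem_univ i)
  set l := Finset.univ.inf' Finset.univ_nonempty (fun j => pushMix ε g p j / q j) with hl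
  have hw : ∀ i, pushMix ε g p i = l * q i := fun i => sub_eq_zero.1 (hu i)
  obtain ⟨h0, h1⟩ := pushCutoff_mem ε g
  have hwg : ∀ i, |pushMix ε g p i - g i| ≤ ε := fun i => by
    have : pushMix ε g p i - g i = pushCutoff ε g * (p i - g i) := by rw [pushMix]; ring
    rw [this, abs_mul, abs_of_nonneg h0]
    nlinarith [hp i, abs_nonneg (p i - g i)]
  have hsum : 9 / 10 ≤ ∑ i, pushMix ε g p i := by
    have : ∑ i, g i - ∑ _i : σ, ε ≤ ∑ i, pushMix ε g p i := by
      rw [← Finset.sum_sub_distrib]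
      exact Finset.sum_le_sum fun i _ => by linarith [(abs_le.1 (hwg i)).1]
    rw [hg1, Finset.sum_const, nsmul_eq_mul, Finset.card_univ] at this
    linarith
  have hsumq : ∑ i, q i ≤ 11 / 10 * Fintype.card σ := by
    have : ∑ i, q i ≤ ∑ _i : σ, (11 / 10 : ℝ) :=
      Finset.sum_le_sum fun i _ => by linarith [(abs_lt.1 (hq i)).2]
    rw [Finset.sum_const, nsmul_eq_mul, Finset.card_univ] at this
    linarith
  have hlq : 9 / 10 ≤ l * ∑ i, q i := by
    rw [Finset.mul_sum]
    simpa only [hw] using hsum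
  have hq1 : 0 < ∑ i, q i := Finset.sum_pos (fun i _ => hq0 i) Finset.univ_nonempty
  have hl0 : 0 < l := by
    by_contra hneg
    have := mul_nonpos_of_nonpos_of_nonneg (not_lt.1 hneg) hq1.le
    linarith
  rcases h1.eq_or_lt with h | h
  · refine hpq l⁻¹ (inv_pos.2 hl0) (funext fun i => ?_)
    have := hw i
    simp only [pushMix, h, sub_self, zero_mul, one_mul, zero_add] at this
    rw [Pi.smul_apply, smul_eq_mul, this, inv_mul_cancel_left₀ hl0.ne']
  · obtain ⟨i, hi⟩ := exists_lt_of_pushCutoff_lt_one hε0 h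
    have h3 : l * q i < 3 * ε := by
      rw [← hw]
      linarith [(abs_le.1 (hwg i)).2]
    have h5 : 9 / 10 ≤ l * (11 / 10 * Fintype.card σ) :=
      hlq.trans (mul_le_mul_of_nonneg_left hsumq hl0.le)
    have h6 : l * (9 / 10) ≤ l * q i :=
      mul_le_mul_of_nonneg_left (by linarith [(abs_lt.1 (hq i)).1]) hl0.le
    have h7 := mul_le_mul_of_nonneg_right (h6.trans h3.le) (zero_le_one.trans hn)
    linarith

end Push

section Cellular

variable {ι : Type*} {K : PreAbstractSimplicialComplex ι} {Z : Type*} [TopologicalSpace Z]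
  [CompactSpace Z] {k : ℤ}

/-- A map from a space of dimension at most `k` can be pushed off a simplex of dimension greater
than `k`. The push inside the simplex `σ` is away from a point that general position provides. -/
theorem exists_homotopic_push (hZ : SmallDim k Z) {σ : Finset ι} (hσ : σ ∈ K.faces)
    (hcard : k + 2 ≤ σ.card) (g : C(Z, Realization K))
    (hmax : ∀ z, σ ⊆ (g z).bary.support → (g z).bary.support = σ) :
    ∃ g' : C(Z, Realization K), g.HomotopicRel g' {z | (g z).bary.support ≠ σ} ∧
      ∀ z, (g' z).bary.support ⊆ (g z).bary.support ∧ (g' z).bary.support ≠ σ := by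
  classical
  obtain ⟨F, hF⟩ := exists_finset_support_subset g
  have : Nonempty ↥σ := (K.isRelLowerSet_faces hσ).1.to_subtype
  let e := σ.equivFin
  have hcoord : ∀ i, Continuous fun z => (g z).bary i := fun i =>
    (Realization.continuous_coord i).comp g.continuous
  -- small enough that the perturbed coordinates in `σ` still have a sum close to `1`
  set ε : ℝ := 1 / (10 * Fintype.card ↥σ) with hεdef
  have hn : (1 : ℝ) ≤ Fintype.card ↥σ := by exact_mod_cast Fintype.card_pos
  have hε : 0 < ε := by positivity
  have hε1 : ε < 1 := by
    rw [hεdef, div_lt_one (by positivity)]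
    linarith
  obtain ⟨p, q, hp, hq, hpq⟩ := hZ σ.card hcard
    ⟨fun z j => (g z).bary (e.symm j), continuous_pi fun j => hcoord _⟩ ε hε
  let gσ : Z → ↥σ → ℝ := fun z i => (g z).bary i
  let p' : Z → ↥σ → ℝ := fun z i => p z (e i)
  let q' : ↥σ → ℝ := fun i => q (e i)
  have hp' : ∀ z i, |p' z i - gσ z i| < ε := fun z i => by
    have := hp z (e i)
    simpa only [ContinuousMap.coe_mk, e.symm_apply_apply] using this
  have hq' : ∀ i, |q' i - 1| < ε := fun i => hq (e i)
  have hq0 : ∀ i, 0 < q' i := fun i => by linarith [(abs_lt.1 (hq' i)).1]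
  have hpq' : ∀ z (t : ℝ), 0 < t → t • p' z ≠ q' := fun z t ht h =>
    hpq z t ht (funext fun j => by
      have := congrFun h (e.symm j)
      simpa only [p', q', Pi.smul_apply, e.apply_symm_apply] using this)
  let u : Z → ↥σ → ℝ := fun z => pushOff ε (gσ z) (p' z) q'
  have hu0 : ∀ z i, 0 ≤ u z i := fun z i => pushOff_nonneg ε _ _ hq0 i
  have hg0 : ∀ z i, 0 ≤ gσ z i := fun z i => (g z).nonneg i
  -- the normalizing factor: the sum of the new coordinates if the support of `g z` is `σ`, and `1`
  -- otherwise
  let D : Z → ℝ := fun z => ∑ i, u z i + 1 - ∑ i, gσ z i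
  have hne : ∀ z, (g z).bary.support ≠ σ → u z = gσ z := fun z hz => by
    refine pushOff_eq_self hε hq0 (hg0 z) ?_
    by_contra h
    push Not at h
    exact hz (hmax z fun i hi => Finsupp.mem_support_iff.2 (h ⟨i, hi⟩))
  have hg1 : ∀ z, (g z).bary.support = σ → ∑ i, gσ z i = 1 := fun z hz =>
    (Finset.sum_coe_sort σ fun i => (g z).bary i).trans ((g z).sum_eq_one hz.le)
  have hD1 : ∀ z, (g z).bary.support ≠ σ → D z = 1 := fun z hz => by
    simp only [D, hne z hz]
    ring
  have hD2 : ∀ z, (g z).bary.support = σ → D z = ∑ i, u z i := fun z hz => by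
    simp only [D, hg1 z hz]
    ring
  have hD : ∀ z, 0 < D z := fun z => by
    by_cases hz : (g z).bary.support = σ
    · rw [hD2 z hz]
      exact sum_pushOff_pos hεdef (hg1 z hz) (hp' z) hq' (hpq' z)
    · rw [hD1 z hz]
      exact one_pos
  let c : Z → ι → ℝ := fun z i => if hi : i ∈ σ then u z ⟨i, hi⟩ / D z else (g z).bary i
  have hc1 : ∀ z, (g z).bary.support ≠ σ → ∀ i, c z i = (g z).bary i := fun z hz i => by
    by_cases hi : i ∈ σ
    · simp only [c, dif_pos hi, hD1 z hz, hne z hz, div_one, gσ]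
    · simp only [c, dif_neg hi]
  have hcσ : ∀ z, (g z).bary.support = σ → ∀ i, i ∉ σ → c z i = 0 := fun z hz i hi => by
    simp only [c, dif_neg hi]
    rw [← hz] at hi
    exact Finsupp.notMem_support_iff.1 hi
  have hsub : ∀ z i, c z i ≠ 0 → i ∈ (g z).bary.support := fun z i hi => by
    by_cases hz : (g z).bary.support = σ
    · rw [hz]
      by_contra h
      exact hi (hcσ z hz i h)
    · rwa [hc1 z hz, ← Finsupp.mem_support_iff] at hi
  have huc : ∀ i, Continuous fun z => u z i := continuous_pushOff ε q' (fun i => hcoord i)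
    fun i => (continuous_apply _).comp p.continuous
  obtain ⟨g', hg'⟩ := exists_map K F c
    (fun z i => by
      by_cases hi : i ∈ σ
      · simp only [c, dif_pos hi]
        exact div_nonneg (hu0 z _) (hD z).le
      · simp only [c, dif_neg hi]
        exact (g z).nonneg i)
    (fun z => by
      by_cases hz : (g z).bary.support = σ
      · rw [← Finset.sum_subset (hz.symm.le.trans (hF z)) fun i _ hi => hcσ z hz i hi,
          ← Finset.sum_coe_sort]
        have : ∀ i : ↥σ, c z i = u z i / D z := fun i => dif_pos i.2
        rw [Finset.sum_congr rfl fun i _ => this i, ← Finset.sum_div, hD2 z hz, div_self]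
        rw [← hD2 z hz]
        exact (hD z).ne'
      · rw [Finset.sum_congr rfl fun i _ => hc1 z hz i, (g z).sum_eq_one (hF z)])
    (fun z i hi => by
      by_contra h
      exact hi (hF z (hsub z i h)))
    (fun z => ⟨_, (g z).support_mem, hsub z⟩)
    (fun i => by
      by_cases hi : i ∈ σ
      · simp only [c, dif_pos hi]
        refine (huc _).div ?_ fun z => (hD z).ne'
        exact ((continuous_finsetSum _ fun i _ => huc i).add continuous_const).sub
          (continuous_finsetSum _ fun i _ => hcoord i)
      · simp only [c, dif_neg hi]
        exact hcoord i)
  have hsub' : ∀ z, (g' z).bary.support ⊆ (g z).bary.support := fun z i hi => by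
    rw [Finsupp.mem_support_iff, hg'] at hi
    exact hsub z i hi
  refine ⟨g', homotopicRel_of_common_face g g'
    (fun z => ⟨_, (g z).support_mem, subset_rfl, hsub' z⟩) _ fun z hz =>
      Realization.ext fun i => by rw [hg', hc1 z hz], fun z => ⟨hsub' z, fun h => ?_⟩⟩
  by_cases hz : (g z).bary.support = σ
  · obtain ⟨i, hi⟩ := exists_pushOff_eq_zero ε (gσ z) (p' z) hq0
    have hi' : (i : ι) ∈ (g' z).bary.support := by
      rw [h]
      exact i.2
    rw [Finsupp.mem_support_iff, hg'] at hi'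
    refine hi' ?_
    simp only [c, dif_pos i.2]
    change pushOff ε (gσ z) (p' z) q' i / D z = 0
    rw [hi, zero_div]
  · have : g' z = g z := Realization.ext fun i => by rw [hg', hc1 z hz]
    rw [this] at h
    exact hz h

/-- Cellular approximation: if the subcomplex `L` contains the `k`-skeleton of `K`, then maps from
spaces of dimension at most `k` to `K` can be deformed into `L`. -/
theorem exists_homotopic_cellular (hZ : SmallDim k Z) (L : PreAbstractSimplicialComplex ι)
    (hL : ∀ s ∈ K.faces, (s.card : ℤ) ≤ k + 1 → s ∈ L.faces) (g : C(Z, Realization K)) :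
    ∃ g' : C(Z, Realization K), g.HomotopicRel g' {z | (g z).bary.support ∈ L.faces} ∧
      ∀ z, (g' z).bary.support ∈ L.faces ∧ (g' z).bary.support ⊆ (g z).bary.support := by
  classical
  obtain ⟨F, hF⟩ := exists_finset_support_subset g
  -- `A` contains the simplices met by `g` that may lie outside of `L`; they are removed one at a
  -- time, beginning with a maximal one
  suffices h : ∀ (N : ℕ) (A : Finset (Finset ι)) (_ : A.card = N) (_ : ∀ s ∈ A, s ∈ K.faces ∧
      ∀ t, t ⊆ s → t.Nonempty → t ∈ A ∨ t ∈ L.faces) (g : C(Z, Realization K))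
      (_ : ∀ z, (g z).bary.support ∈ A ∨ (g z).bary.support ∈ L.faces),
      ∃ g' : C(Z, Realization K), g.HomotopicRel g' {z | (g z).bary.support ∈ L.faces} ∧
        ∀ z, (g' z).bary.support ∈ L.faces ∧ (g' z).bary.support ⊆ (g z).bary.support by
    refine h _ (F.powerset.filter (· ∈ K.faces)) rfl (fun s hs => ?_) g fun z => Or.inl ?_
    · rw [Finset.mem_filter, Finset.mem_powerset] at hs
      refine ⟨hs.2, fun t ht hne => Or.inl ?_⟩
      rw [Finset.mem_filter, Finset.mem_powerset]
      exact ⟨ht.trans hs.1, (K.isRelLowerSet_faces hs.2).2 ht hne⟩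
    · rw [Finset.mem_filter, Finset.mem_powerset]
      exact ⟨hF z, (g z).support_mem⟩
  intro N
  induction N with
  | zero =>
    intro A hA _ g hg
    rw [Finset.card_eq_zero] at hA
    subst hA
    exact ⟨g, .refl _, fun z => ⟨(hg z).resolve_left (Finset.notMem_empty _), subset_rfl⟩⟩
  | succ N ih =>
    intro A hA hAK g hg
    obtain ⟨σ, hσ, hmax⟩ := A.exists_max_image Finset.card
      (Finset.card_pos.1 (by rw [hA]; exact N.succ_pos))
    have hA' : (A.erase σ).card = N := by rw [Finset.card_erase_of_mem hσ, hA]; rfl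
    have hAK' : ∀ s ∈ A.erase σ, s ∈ K.faces ∧
        ∀ t, t ⊆ s → t.Nonempty → t ∈ A.erase σ ∨ t ∈ L.faces := fun s hs => by
      obtain ⟨hne, hsA⟩ := Finset.mem_erase.1 hs
      refine ⟨(hAK s hsA).1, fun t ht htn => ?_⟩
      refine ((hAK s hsA).2 t ht htn).imp (fun h => Finset.mem_erase.2 ⟨?_, h⟩) id
      rintro rfl
      exact hne (Finset.eq_of_subset_of_card_le ht (hmax s hsA)).symm
    by_cases hσL : σ ∈ L.faces
    · refine ih (A.erase σ) hA' hAK' g fun z => ?_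
      by_cases hz : (g z).bary.support = σ
      · right
        rwa [hz]
      · exact (hg z).imp (fun h => Finset.mem_erase.2 ⟨hz, h⟩) id
    · obtain ⟨g₁, h1, h2⟩ := exists_homotopic_push (K := K) hZ (hAK σ hσ).1
        (by
          by_contra hlt
          exact hσL (hL σ (hAK σ hσ).1 (by omega))) g
        (fun z hz => by
          rcases hg z with h | h
          · exact (Finset.eq_of_subset_of_card_le hz (hmax _ h)).symm
          · exact absurd ((L.isRelLowerSet_faces h).2 hz
              (K.isRelLowerSet_faces (hAK σ hσ).1).1) hσL)
      have hg₁ : ∀ z, (g z).bary.support ∈ L.faces → g z = g₁ z := fun z hz =>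
        h1.fst_eq_snd fun h => hσL (h ▸ hz)
      obtain ⟨g₂, h3, h4⟩ := ih (A.erase σ) hA' hAK' g₁ fun z => by
        have hne := (K.isRelLowerSet_faces (g₁ z).support_mem).1
        rcases hg z with h | h
        · exact ((hAK _ h).2 _ (h2 z).1 hne).imp
            (fun h => Finset.mem_erase.2 ⟨(h2 z).2, h⟩) id
        · exact Or.inr ((L.isRelLowerSet_faces h).2 (h2 z).1 hne)
      refine ⟨g₂, (HomotopicRel.mono_set h1 ?_).trans (HomotopicRel.mono_set h3 ?_), fun z =>
        ⟨(h4 z).1, (h4 z).2.trans (h2 z).1⟩⟩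
      · rintro z hz rfl
        exact hσL hz
      · intro z hz
        change (g₁ z).bary.support ∈ L.faces
        rw [← hg₁ z hz]
        exact hz

end Cellular

/-! ### Removing vertices with highly connected links -/

section Vertex

theorem exists_glue {Z Y : Type*} [TopologicalSpace Z] [TopologicalSpace Y] {m : Z → ℝ}
    (hm : Continuous m) (r : ℝ) (A : C({z // m z ≤ r}, Y)) (B : C({z // r ≤ m z}, Y))
    (hAB : ∀ z h h', A ⟨z, h⟩ = B ⟨z, h'⟩) :
    ∃ g : C(Z, Y), (∀ z h, g z = A ⟨z, h⟩) ∧ ∀ z h, g z = B ⟨z, h⟩ := by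
  classical
  let g : Z → Y := fun z => if h : m z ≤ r then A ⟨z, h⟩ else B ⟨z, (not_le.1 h).le⟩
  have hgA : ∀ z h, g z = A ⟨z, h⟩ := fun z h => dif_pos h
  have hgB : ∀ z h, g z = B ⟨z, h⟩ := fun z h => by
    by_cases h' : m z ≤ r
    · rw [hgA z h', hAB z h' h]
    · exact dif_neg h'
  have h1 : ContinuousOn g {z | m z ≤ r} := by
    rw [continuousOn_iff_continuous_domRestrict]
    exact A.continuous.congr fun z => (hgA z.1 z.2).symm
  have h2 : ContinuousOn g {z | r ≤ m z} := by
    rw [continuousOn_iff_continuous_domRestrict]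
    exact B.continuous.congr fun z => (hgB z.1 z.2).symm
  have h3 := h1.union_of_isClosed h2 (isClosed_le hm continuous_const)
    (isClosed_le continuous_const hm)
  have h4 : {z | m z ≤ r} ∪ {z | r ≤ m z} = Set.univ :=
    Set.eq_univ_of_forall fun z => le_total (m z) r
  rw [h4] at h3
  exact ⟨⟨g, continuousOn_univ.1 h3⟩, hgA, hgB⟩

variable {ι : Type*} {K : PreAbstractSimplicialComplex ι} {Z : Type*} [TopologicalSpace Z]
  [CompactSpace Z] {k n : ℤ}

theorem link_singleton_faces {v : ι} {s : Finset ι} [DecidableEq ι] :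
    s ∈ (link K {v}).faces ↔ s.Nonempty ∧ v ∉ s ∧ insert v s ∈ K.faces := by
  have : (s ∪ {v} : Finset ι) = insert v s := by
    rw [Finset.union_comm]
    rfl
  simp only [link, Finset.disjoint_singleton_right]
  change (_ ∧ _ ∧ _) ↔ _
  rw [← this]
  convert Iff.rfl

/-- If the link of `v` is `(n-1)`-connected, then the skeleton of dimension `k ≤ n` of the star of
`v` can be mapped to the link, by the identity on the link. -/
theorem exists_star_retraction (hk : k ≤ n) (v : ι) [DecidableEq ι]
    (hlk : IsConn (n - 1) (Realization (link K {v}))) :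
    ∃ (S : PreAbstractSimplicialComplex ι) (R : C(Realization S, Realization (link K {v}))),
      (∀ s, s ∈ S.faces ↔ s.Nonempty ∧ insert v s ∈ K.faces ∧ ((s.erase v).card : ℤ) ≤ k) ∧
        ∀ x : Realization S, v ∉ x.bary.support → (R x).bary = x.bary := by
  let S : PreAbstractSimplicialComplex ι :=
    { faces := {s | s.Nonempty ∧ insert v s ∈ K.faces ∧ ((s.erase v).card : ℤ) ≤ k}
      isRelLowerSet_faces := by
        rintro s ⟨h1, h2, h3⟩
        refine ⟨h1, fun t ht hne => ⟨hne, (K.isRelLowerSet_faces h2).2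
          (Finset.insert_subset_insert v ht) (Finset.insert_nonempty _ _), ?_⟩⟩
        have := Finset.card_le_card (Finset.erase_subset_erase v ht)
        omega }
  let W : PreAbstractSimplicialComplex ι :=
    { faces := {s | s ∈ S.faces ∧ v ∉ s}
      isRelLowerSet_faces := by
        rintro s ⟨h1, h2⟩
        exact ⟨h1.1, fun t ht hne => ⟨(S.isRelLowerSet_faces h1).2 ht hne, fun h => h2 (ht h)⟩⟩ }
  have hW : W.faces ⊆ (link K {v}).faces := fun s hs =>
    link_singleton_faces.2 ⟨hs.1.1, hs.2, hs.1.2.1⟩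
  have hcard : ∀ s ∈ S.faces, s ∉ W.faces → (s.card : ℤ) ≤ k + 1 := fun s hs hs' => by
    have hv : v ∈ s := by
      by_contra h
      exact hs' ⟨hs, h⟩
    have h1 := Finset.card_erase_add_one hv
    have h2 := hs.2.2
    omega
  obtain ⟨R, hR, -⟩ := exists_extension S W (fun s hs => hs.1) (fun _ => Set.univ)
    (fun _ _ _ => le_rfl) (k + 1).toNat
    (fun s hs hs' => by
      have := hcard s hs hs'
      omega)
    (fun s hs hs' a _ => by
      have h1 := hcard s hs hs'
      have h2 := Finset.card_pos.2 hs.1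
      obtain ⟨c, hc⟩ := hlk (s.card - 1) (by omega) a
      exact ⟨c, hc, fun _ => Set.mem_univ _⟩)
    (inclMap hW) (fun _ => Set.mem_univ _)
  refine ⟨S, R, fun s => Iff.rfl, fun x hx => ?_⟩
  rw [hR x ⟨x.support_mem, hx⟩]
  exact Finsupp.ext fun i => inclMap_apply hW _ i

/-- If the link of a vertex `v` is `(n-1)`-connected, then maps from spaces of dimension at most `n`
can be deformed such that they avoid `v`.

By cellular approximation the map may be assumed to meet only the `k`-skeleton of the star of `v`,
which is mapped to the link by `exists_star_retraction`. Since this map is the identity only on the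
link, the star is cut at the points where `v` has weight `1/2`: the outer part is pushed radially to
the link, and the inner part is stretched over the whole star. The resulting map `g₂` is related to
the given one through a map `T` that collapses the inner part to `v`: straight-line homotopies lead
from `g₁` to `T` and from `T` to `g₂`. -/
theorem exists_homotopic_avoid_vertex (hZ : SmallDim k Z) (hk : k ≤ n) (v : ι)
    (hlk : IsConn (n - 1) (Realization (link K {v}))) (g : C(Z, Realization K)) :
    ∃ g' : C(Z, Realization K), g.HomotopicRel g' {z | (g z).bary v = 0} ∧
      ∀ z, (g' z).bary v = 0 := by
  classical
  -- the simplices without `v`, together with the `k`-skeleton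
  let L : PreAbstractSimplicialComplex ι :=
    { faces := {s | s ∈ K.faces ∧ (v ∉ s ∨ (s.card : ℤ) ≤ k + 1)}
      isRelLowerSet_faces := by
        rintro s ⟨h1, h2⟩
        refine ⟨(K.isRelLowerSet_faces h1).1, fun t ht hne =>
          ⟨(K.isRelLowerSet_faces h1).2 ht hne, h2.imp (fun h h' => h (ht h')) fun h => ?_⟩⟩
        have := Finset.card_le_card ht
        omega }
  obtain ⟨g₁, h1, h2⟩ := exists_homotopic_cellular hZ L (fun s hs h => ⟨hs, Or.inr h⟩) g
  have h1' : g.HomotopicRel g₁ {z | (g z).bary v = 0} :=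
    HomotopicRel.mono_set h1 fun z hz =>
      ⟨(g z).support_mem, Or.inl (Finsupp.notMem_support_iff.2 hz)⟩
  obtain ⟨S, R, hS, hR⟩ := exists_star_retraction (K := K) hk v hlk
  obtain ⟨F, hF⟩ := exists_finset_support_subset g₁
  have hlinkK : (link K {v}).faces ⊆ K.faces := fun s hs => by
    rw [link_singleton_faces] at hs
    exact (K.isRelLowerSet_faces hs.2.2).2 (Finset.subset_insert _ _) hs.1
  -- the weight of `v`
  let m : Z → ℝ := fun z => (g₁ z).bary v
  have hcoord : ∀ i, Continuous fun z => (g₁ z).bary i := fun i =>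
    (Realization.continuous_coord i).comp g₁.continuous
  have hm : Continuous m := hcoord v
  have hm0 : ∀ z, 0 ≤ m z := fun z => (g₁ z).nonneg v
  have hm1 : ∀ z, m z ≤ 1 := fun z => (g₁ z).le_one v
  have hmv : ∀ z, m z ≠ 0 → v ∈ (g₁ z).bary.support := fun z hz => Finsupp.mem_support_iff.2 hz
  have hsum : ∀ z, ∑ i ∈ F.erase v, (g₁ z).bary i = 1 - m z := fun z => by
    by_cases hv : v ∈ F
    · have h3 := Finset.sum_erase_add F (fun i => (g₁ z).bary i) hv
      rw [(g₁ z).sum_eq_one (hF z)] at h3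
      linarith
    · have : m z = 0 := Finsupp.notMem_support_iff.1 fun h => hv (hF z h)
      rw [Finset.erase_eq_of_notMem hv, (g₁ z).sum_eq_one (hF z), this, sub_zero]
  have hFi : ∀ z i, i ∉ insert v F → (g₁ z).bary i = 0 := fun z i hi =>
    Finsupp.notMem_support_iff.1 fun h => hi (Finset.mem_insert_of_mem (hF z h))
  have hsplit : ∀ c : ι → ℝ, ∑ i ∈ insert v F, c i = c v + ∑ i ∈ F.erase v, c i := fun c => by
    rw [← Finset.add_sum_erase _ _ (Finset.mem_insert_self v F), Finset.erase_insert_eq_erase]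
  -- stretch the star of `v` such that the part with `m ≥ 1 / 2` collapses to `v`
  let cT : Z → ι → ℝ := fun z i => if i = v then min 1 (2 * m z) else
    (g₁ z).bary i * (max 0 (1 - 2 * m z) / max (1 - m z) (1 / 2))
  have hcT : ∀ z i, cT z i ≠ 0 → i ∈ (g₁ z).bary.support := fun z i hi => by
    by_cases hiv : i = v
    · subst hiv
      refine hmv z fun h => hi ?_
      simp [cT, h]
    · rw [Finsupp.mem_support_iff]
      intro h
      exact hi (by simp [cT, hiv, h])
  obtain ⟨T, hT⟩ := exists_map K (insert v F) cT
    (fun z i => by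
      simp only [cT]
      split_ifs
      · exact le_min zero_le_one (by linarith [hm0 z])
      · exact mul_nonneg ((g₁ z).nonneg i) (by positivity))
    (fun z => by
      rw [hsplit]
      have : ∀ i ∈ F.erase v, cT z i =
          (g₁ z).bary i * (max 0 (1 - 2 * m z) / max (1 - m z) (1 / 2)) := fun i hi =>
        if_neg (Finset.ne_of_mem_erase hi)
      rw [Finset.sum_congr rfl this, ← Finset.sum_mul, hsum]
      simp only [cT, if_true]
      rcases le_total (m z) (1 / 2) with h | h
      · rw [min_eq_right (by linarith), max_eq_right (by linarith), max_eq_left (by linarith),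
          mul_div_cancel₀ _ (by linarith)]
        ring
      · rw [min_eq_left (by linarith), max_eq_left (by linarith)]
        simp)
    (fun z i hi => by
      by_contra h
      exact hi (Finset.mem_insert_of_mem (hF z (hcT z i h))))
    (fun z => ⟨_, (g₁ z).support_mem, hcT z⟩)
    (fun i => by
      by_cases hiv : i = v
      · simp only [cT, if_pos hiv]
        fun_prop
      · simp only [cT, if_neg hiv]
        refine (hcoord i).mul (Continuous.div (by fun_prop) (by fun_prop) fun z => ?_)
        positivity)
  -- the outer part is projected radially to the link
  let cA : {z // m z ≤ 1 / 2} → ι → ℝ := fun z i => if i = v then 0 else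
    (g₁ z).bary i / (1 - m z)
  have hcA : ∀ z i, cA z i ≠ 0 → i ∈ (g₁ z).bary.support := fun z i hi => by
    rw [Finsupp.mem_support_iff]
    intro h
    exact hi (by simp [cA, h])
  obtain ⟨A, hA⟩ := exists_map K (insert v F) cA
    (fun z i => by
      simp only [cA]
      split_ifs
      · exact le_rfl
      · exact div_nonneg ((g₁ z).nonneg i) (by linarith [hm1 z]))
    (fun z => by
      rw [hsplit]
      have : ∀ i ∈ F.erase v, cA z i = (g₁ z).bary i / (1 - m z) := fun i hi =>
        if_neg (Finset.ne_of_mem_erase hi)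
      rw [Finset.sum_congr rfl this, ← Finset.sum_div, hsum, div_self (by linarith [z.2])]
      simp [cA])
    (fun z i hi => by
      by_contra h
      exact hi (Finset.mem_insert_of_mem (hF z (hcA z i h))))
    (fun z => ⟨_, (g₁ z).support_mem, hcA z⟩)
    (fun i => by
      by_cases hiv : i = v
      · simp only [cA, if_pos hiv]
        exact continuous_const
      · simp only [cA, if_neg hiv]
        exact ((hcoord i).comp continuous_subtype_val).div
          (continuous_const.sub (hm.comp continuous_subtype_val)) fun z => by linarith [z.2])
  -- the inner part is stretched over the star of `v` and then mapped to the link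
  let cB : {z // 1 / 2 ≤ m z} → ι → ℝ := fun z i => if i = v then 2 * m z - 1 else
    2 * (g₁ z).bary i
  have hcB : ∀ z i, cB z i ≠ 0 → i ∈ (g₁ z).bary.support := fun z i hi => by
    by_cases hiv : i = v
    · subst hiv
      exact hmv z (by linarith [z.2])
    · rw [Finsupp.mem_support_iff]
      intro h
      exact hi (by simp [cB, hiv, h])
  obtain ⟨B, hB⟩ := exists_map S (insert v F) cB
    (fun z i => by
      simp only [cB]
      split_ifs
      · linarith [z.2]
      · exact mul_nonneg zero_le_two ((g₁ z).nonneg i))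
    (fun z => by
      rw [hsplit]
      have : ∀ i ∈ F.erase v, cB z i = 2 * (g₁ z).bary i := fun i hi =>
        if_neg (Finset.ne_of_mem_erase hi)
      rw [Finset.sum_congr rfl this, ← Finset.mul_sum, hsum]
      simp only [cB, if_true]
      ring)
    (fun z i hi => by
      by_contra h
      exact hi (Finset.mem_insert_of_mem (hF z (hcB z i h))))
    (fun z => by
      have hv : v ∈ (g₁ z).bary.support := hmv z (by linarith [z.2])
      refine ⟨_, (hS _).2 ⟨⟨v, hv⟩, ?_, ?_⟩, hcB z⟩
      · rw [Finset.insert_eq_of_mem hv]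
        exact (g₁ z).support_mem
      · have h3 := (h2 z).1.2.resolve_left (not_not.2 hv)
        have h4 := Finset.card_erase_add_one hv
        omega)
    (fun i => by
      by_cases hiv : i = v
      · simp only [cB, if_pos hiv]
        exact (continuous_const.mul (hm.comp continuous_subtype_val)).sub continuous_const
      · simp only [cB, if_neg hiv]
        exact continuous_const.mul ((hcoord i).comp continuous_subtype_val))
  obtain ⟨g₂, hgA, hgB⟩ := exists_glue hm (1 / 2) A ((inclMap hlinkK).comp (R.comp B))
    fun z h h' => by
      have hz : m z = 1 / 2 := le_antisymm h h'
      refine Realization.ext fun i => ?_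
      change _ = (inclMap hlinkK (R (B ⟨z, h'⟩))).bary i
      rw [inclMap_apply, hR, hA, hB]
      · simp only [cA, cB, hz]
        split_ifs
        · norm_num
        · ring
      · rw [Finsupp.notMem_support_iff, hB]
        simp [cB, hz]
  have hg₂A : ∀ z, m z ≤ 1 / 2 → (g₂ z).bary v = 0 ∧
      (g₂ z).bary.support ⊆ (g₁ z).bary.support := fun z h => by
    rw [hgA z h]
    refine ⟨by rw [hA]; simp [cA], fun i hi => ?_⟩
    rw [Finsupp.mem_support_iff, hA] at hi
    exact hcA ⟨z, h⟩ i hi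
  have hg₂B : ∀ z, 1 / 2 ≤ m z → (g₂ z).bary.support ∈ (link K {v}).faces := fun z h => by
    rw [hgB z h]
    change (inclMap hlinkK (R (B ⟨z, h⟩))).bary.support ∈ _
    rw [support_inclMap]
    exact Realization.support_mem _
  have hTsub : ∀ z, (T z).bary.support ⊆ (g₁ z).bary.support := fun z i hi => by
    rw [Finsupp.mem_support_iff, hT] at hi
    exact hcT z i hi
  have hTB : ∀ z, 1 / 2 ≤ m z → (T z).bary.support ⊆ {v} := fun z h i hi => by
    rw [Finsupp.mem_support_iff, hT] at hi
    rw [Finset.mem_singleton]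
    by_contra hiv
    refine hi ?_
    simp only [cT, if_neg hiv]
    rw [max_eq_left (by linarith)]
    simp
  have hmg : ∀ z, (g z).bary v = 0 → m z = 0 := fun z hz => by
    have := h1'.fst_eq_snd (x := z) hz
    simp only [m, ← this]
    exact hz
  have hT0 : ∀ z, m z = 0 → T z = g₁ z := fun z hz => Realization.ext fun i => by
    rw [hT]
    by_cases hiv : i = v
    · subst hiv
      change _ = m z
      simp [cT, hz]
    · simp only [cT, if_neg hiv, hz]
      norm_num
  have hg₂0 : ∀ z, m z = 0 → g₂ z = g₁ z := fun z hz => Realization.ext fun i => by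
    rw [hgA z (by rw [hz]; norm_num), hA]
    by_cases hiv : i = v
    · subst hiv
      change _ = m z
      simp [cA, hz]
    · simp [cA, hiv, hz]
  refine ⟨g₂, h1'.trans ((homotopicRel_of_common_face g₁ T (fun z =>
    ⟨_, (g₁ z).support_mem, subset_rfl, hTsub z⟩) _ fun z hz => (hT0 z (hmg z hz)).symm).trans
      (homotopicRel_of_common_face T g₂ (fun z => ?_) _ fun z hz => ?_)), fun z => ?_⟩
  · rcases le_total (m z) (1 / 2) with h | h
    · exact ⟨_, (g₁ z).support_mem, hTsub z, (hg₂A z h).2⟩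
    · refine ⟨_, (link_singleton_faces.1 (hg₂B z h)).2.2, (hTB z h).trans (by simp), ?_⟩
      exact Finset.subset_insert _ _
  · rw [hT0 z (hmg z hz), hg₂0 z (hmg z hz)]
  · rcases le_total (m z) (1 / 2) with h | h
    · exact (hg₂A z h).1
    · exact Finsupp.notMem_support_iff.1 (link_singleton_faces.1 (hg₂B z h)).2.1

end Vertex

/-! ### Connectivity of joins -/

section Join

variable {ι κ : Type*} {K : PreAbstractSimplicialComplex ι}

theorem exists_simplexIncl_eq (x : Realization K) (s : K.faces) (h : x.bary.support ⊆ s.1) :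
    ∃ y, simplexIncl K s y = x := by
  refine ⟨⟨fun i => x.bary i, fun i => x.nonneg i, ?_⟩, Realization.ext fun i => ?_⟩
  · refine Eq.trans ?_ (x.sum_eq_one h)
    exact Finset.sum_coe_sort s.1 fun i => x.bary i
  · by_cases hi : i ∈ s.1
    · exact simplexIncl_apply_mem s _ ⟨i, hi⟩
    · rw [simplexIncl_apply_of_notMem s _ hi]
      exact (Finsupp.notMem_support_iff.1 fun h' => hi (h h')).symm

/-- A map of realizations maps a finite subcomplex to a finite subcomplex. -/
theorem exists_finset_support_map_subset {L : PreAbstractSimplicialComplex κ}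
    (f : C(Realization K, Realization L)) (F : Finset ι) :
    ∃ G : Finset κ, ∀ x, x.bary.support ⊆ F → (f x).bary.support ⊆ G := by
  classical
  choose G hG using fun s : K.faces =>
    exists_finset_support_subset (f.comp ⟨simplexIncl K s, continuous_simplexIncl s⟩)
  refine ⟨F.powerset.biUnion fun s => if h : s ∈ K.faces then G ⟨s, h⟩ else ∅, fun x hx => ?_⟩
  obtain ⟨y, hy⟩ := exists_simplexIncl_eq x ⟨_, x.support_mem⟩ subset_rfl
  refine Finset.Subset.trans ?_ (Finset.subset_biUnion_of_mem _ (Finset.mem_powerset.2 hx))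
  simp only [x.support_mem, dif_pos]
  have := hG ⟨_, x.support_mem⟩ y
  change (f (simplexIncl K ⟨_, x.support_mem⟩ y)).bary.support ⊆ _ at this
  rwa [hy] at this

/-- A complex whose vertices lie in the image of an injection maps to any complex containing the
relabelled simplices. -/
theorem exists_relabel {e : κ → ι} (he : Function.Injective e) (L : PreAbstractSimplicialComplex κ)
    (h : ∀ s ∈ K.faces, ∃ t ∈ L.faces, ∀ i ∈ s, ∃ j ∈ t, e j = i) :
    ∃ f : C(Realization K, Realization L), ∀ x j, (f x).bary j = x.bary (e j) := by
  choose f hf using fun x : Realization K => exists_lift he L (ContinuousMap.const PUnit.{1} x)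
    fun _ => h _ x.support_mem
  refine ⟨⟨fun x => f x ⟨⟩, Realization.continuous_dom fun s => ?_⟩, fun x j => hf x ⟨⟩ j⟩
  obtain ⟨g, hg⟩ := exists_lift he L ⟨simplexIncl K s, continuous_simplexIncl s⟩ fun z =>
    h _ (simplexIncl K s z).support_mem
  refine g.continuous.congr fun y => Realization.ext fun j => ?_
  exact (hg y j).trans (hf _ ⟨⟩ j).symm

/-- A map `j` on `|K|` extends over disks on spheres of dimension at most `m`, if there are carriers
`C` such that the carrier of a simplex `s` allows to extend over the cone of `s`.

Indeed, `j` then extends over the cone on the `m`-skeleton of `K`, and a sphere of dimension at most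
`m` can be deformed into the skeleton and bounds a disk in that cone. -/
theorem exists_extension_of_carrier {Y : Type*} [TopologicalSpace Y] {m : ℤ}
    (j : C(Realization K, Y)) (C : Finset ι → Set Y) (hC : Monotone C)
    (hext : ∀ s : Finset ι, s = ∅ ∨ s ∈ K.faces → (s.card : ℤ) ≤ m + 1 → ExtendsIn s.card (C s))
    (hj : ∀ x, j x ∈ C x.bary.support) {d : ℕ} (hd : (d : ℤ) - 1 ≤ m)
    (a : C(Sphere d, Realization K)) : ∃ c : C(Disk d, Y), ∀ s, c (bdry s) = j (a s) := by
  classical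
  -- for the empty sphere, only a point of the carrier of the empty simplex is needed
  by_cases hS : IsEmpty (Sphere d)
  · have h0 : IsEmpty (Sphere 0) := ⟨fun s => by
      have h1 := norm_bdry s
      rw [Subsingleton.elim (bdry s).1 0, norm_zero] at h1
      exact zero_ne_one h1⟩
    obtain ⟨c, -⟩ := hext ∅ (Or.inl rfl) (by simp; omega)
      ⟨fun s => h0.elim s, continuous_of_const fun s => h0.elim s⟩ fun s => h0.elim s
    exact ⟨ContinuousMap.const _ (c ⟨0, Metric.mem_closedBall_self zero_le_one⟩),
      fun s => hS.elim s⟩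
  obtain ⟨a', ha, ha'⟩ := exists_homotopic_cellular (smallDim_sphere d) (skeleton K m)
    (fun s hs h => ⟨hs, by omega⟩) a
  -- the cone on the skeleton, with apex `none`
  let S : PreAbstractSimplicialComplex (Option ι) :=
    { faces := {s | s.Nonempty ∧ (s.eraseNone = ∅ ∨ s.eraseNone ∈ (skeleton K m).faces)}
      isRelLowerSet_faces := by
        rintro s ⟨h1, h2⟩
        refine ⟨h1, fun t ht hne => ⟨hne, ?_⟩⟩
        have hts : t.eraseNone ⊆ s.eraseNone := Finset.eraseNone.monotone ht
        rcases t.eraseNone.eq_empty_or_nonempty with h | h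
        · exact Or.inl h
        · refine Or.inr ?_
          rcases h2 with h2 | h2
          · rw [h2] at hts
            exact absurd h (Finset.not_nonempty_iff_eq_empty.2 (Finset.subset_empty.1 hts))
          · exact ((skeleton K m).isRelLowerSet_faces h2).2 hts h }
  -- its base
  let W : PreAbstractSimplicialComplex (Option ι) :=
    { faces := {s | s ∈ S.faces ∧ none ∉ s}
      isRelLowerSet_faces := by
        rintro s ⟨h1, h2⟩
        exact ⟨h1.1, fun t ht hne => ⟨(S.isRelLowerSet_faces h1).2 ht hne, fun h => h2 (ht h)⟩⟩ }
  have hWf : ∀ s ∈ W.faces, s.eraseNone ∈ (skeleton K m).faces := fun s hs => by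
    refine hs.1.2.resolve_left fun h => ?_
    obtain ⟨o, ho⟩ := hs.1.1
    cases o with
    | none => exact hs.2 ho
    | some i => exact Finset.notMem_empty i (h ▸ Finset.mem_eraseNone.2 ho)
  obtain ⟨f, hf⟩ := exists_relabel (K := W) (Option.some_injective ι) K fun s hs =>
    ⟨_, (hWf s hs).1, fun o ho => by
      cases o with
      | none => exact absurd ho hs.2
      | some i => exact ⟨i, Finset.mem_eraseNone.2 ho, rfl⟩⟩
  have hfs : ∀ x, (f x).bary.support = x.bary.support.eraseNone := fun x => by
    ext i
    rw [Finsupp.mem_support_iff, hf, Finset.mem_eraseNone, Finsupp.mem_support_iff]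
  have hcard : ∀ s ∈ S.faces, s ∉ W.faces → s.card - 1 = s.eraseNone.card ∧
      (s.eraseNone.card : ℤ) ≤ m + 1 := fun s hs hs' => by
    have hn : none ∈ s := by
      by_contra h
      exact hs' ⟨hs, h⟩
    refine ⟨?_, ?_⟩
    · rw [Finset.card_eraseNone_of_mem hn]
    · rcases hs.2 with h | h
      · rw [h, Finset.card_empty]
        push_cast
        omega
      · have := h.2
        omega
  obtain ⟨ψ, hψ, -⟩ := exists_extension S W (fun s hs => hs.1) (fun s => C s.eraseNone)
    (fun s t h => hC (Finset.eraseNone.monotone h)) ((m + 1).toNat + 1)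
    (fun s hs hs' => by
      obtain ⟨h1, h2⟩ := hcard s hs hs'
      omega)
    (fun s hs hs' => by
      obtain ⟨h1, h2⟩ := hcard s hs hs'
      rw [h1]
      exact hext _ (hs.2.imp id fun h => h.1) h2)
    (j.comp f) fun x => by
      rw [← hfs]
      exact hj _
  have hLS : ∀ s ∈ (skeleton K m).faces, Finset.insertNone s ∈ S.faces := fun s hs =>
    ⟨⟨none, by simp⟩, Or.inr (by rwa [Finset.eraseNone_insertNone])⟩
  obtain ⟨b, hb⟩ := exists_lift_incl (skeleton K m) a' fun z => (ha' z).1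
  have hLS' : ∀ s ∈ (skeleton K m).faces, ∃ t ∈ S.faces, ∀ i ∈ s, some i ∈ t := fun s hs =>
    ⟨_, hLS s hs, fun i hi => by simpa using hi⟩
  let b' : C(Sphere d, Realization S) := (simplicialMap some hLS').comp b
  obtain ⟨c, hc, -⟩ := exists_cone_extension S none
    ⟨Finset.singleton_nonempty _, Or.inl (by ext; simp)⟩ b' fun s =>
      ⟨_, hLS _ (b s).support_mem, by simp, fun o ho => by
        obtain ⟨i, hi, rfl⟩ := exists_of_mem_support_simplicialMap hLS' _ ho
        simpa using hi⟩
  refine exists_extension_of_homotopic (ContinuousMap.Homotopic.comp (.refl j)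
    ha.homotopic) (ψ.comp c) fun s => ?_
  rw [ContinuousMap.comp_apply, hc]
  have h1 : (b' s).bary.support ∈ W.faces := ⟨(b' s).support_mem, fun h => by
    obtain ⟨i, -, hi⟩ := exists_of_mem_support_simplicialMap hLS' _ h
    exact Option.some_ne_none i hi⟩
  rw [hψ _ h1]
  refine congrArg j (Realization.ext fun i => ?_)
  rw [hf]
  exact (simplicialMap_apply (Option.some_injective ι) hLS' (b s) i).trans (hb s i)

/-- The full subcomplex on a set of vertices. -/
def restrict (K : PreAbstractSimplicialComplex ι) (A : Set ι) : PreAbstractSimplicialComplex ι where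
  faces := {s | s ∈ K.faces ∧ ∀ i ∈ s, i ∈ A}
  isRelLowerSet_faces := by
    rintro s ⟨h1, h2⟩
    exact ⟨(K.isRelLowerSet_faces h1).1, fun t ht hne =>
      ⟨(K.isRelLowerSet_faces h1).2 ht hne, fun i hi => h2 i (ht hi)⟩⟩

/-- A product `s * f` of a nonnegative continuous function and a bounded one is continuous if `f` is
continuous where `s` is positive. -/
theorem continuous_mul_of_mem_Icc {Z : Type*} [TopologicalSpace Z] {s : Z → ℝ} (hs : Continuous s)
    (hs0 : ∀ z, 0 ≤ s z) {f : Z → ℝ} (hf : Continuous fun z : {z // 0 < s z} => f z)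
    (hf0 : ∀ z, 0 ≤ f z) (hf1 : ∀ z, f z ≤ 1) : Continuous fun z => s z * f z := by
  rw [continuous_iff_continuousAt]
  intro z
  rcases (hs0 z).eq_or_lt with h | h
  · rw [ContinuousAt, ← h, zero_mul]
    have := hs.tendsto z
    rw [← h] at this
    exact squeeze_zero (fun y => mul_nonneg (hs0 y) (hf0 y))
      (fun y => mul_le_of_le_one_right (hs0 y) (hf1 y)) this
  · have hU : {z | 0 < s z} ∈ nhds z := (isOpen_lt continuous_const hs).mem_nhds h
    have hc : ContinuousOn f {z | 0 < s z} := by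
      rw [continuousOn_iff_continuous_domRestrict]
      exact hf
    exact hs.continuousAt.mul (hc.continuousAt hU)

end Join

section Join

variable {ι : Type*}

/-- The complex `J`, regarded as the join of its full subcomplexes on `A` and on its complement `B`,
with an additional vertex `none` that is a cone point over the join of the `A`-part and the
`b`-skeleton of the `B`-part. -/
def partialCone (J : PreAbstractSimplicialComplex ι) (A : Set ι) (b : ℤ) :
    PreAbstractSimplicialComplex (Option ι) where
  faces := {s | s.Nonempty ∧ (s.eraseNone = ∅ ∨ s.eraseNone ∈ J.faces) ∧
    (none ∈ s → ∃ t : Finset ι, (∀ i, some i ∈ s → i ∉ A → i ∈ t) ∧ (t.card : ℤ) ≤ b + 1)}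
  isRelLowerSet_faces := by
    rintro s ⟨h1, h2, h3⟩
    refine ⟨h1, fun t ht hne => ⟨hne, ?_, fun hn => ?_⟩⟩
    · have hts : t.eraseNone ⊆ s.eraseNone := Finset.eraseNone.monotone ht
      rcases t.eraseNone.eq_empty_or_nonempty with h | h
      · exact Or.inl h
      · refine Or.inr ?_
        rcases h2 with h2 | h2
        · rw [h2] at hts
          exact absurd h (Finset.not_nonempty_iff_eq_empty.2 (Finset.subset_empty.1 hts))
        · exact (J.isRelLowerSet_faces h2).2 hts h
    · obtain ⟨u, hu, hu'⟩ := h3 (ht hn)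
      exact ⟨u, fun i hi => hu i (ht hi), hu'⟩

variable {J : PreAbstractSimplicialComplex ι} {A : Set ι} {b : ℤ}

/-- If the `B`-part of `J` is `b`-connected, then a cone on its `b`-skeleton retracts to it. -/
theorem exists_cone_retraction (hB : IsConn b (Realization (restrict J Aᶜ))) :
    ∃ Ψ : C(Realization (restrict (partialCone J A b) {o | ∀ i ∈ o, i ∉ A}),
      Realization (restrict J Aᶜ)), ∀ x, none ∉ x.bary.support →
        ∀ i, (Ψ x).bary i = x.bary (some i) := by
  set S := restrict (partialCone J A b) {o | ∀ i ∈ o, i ∉ A} with hS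
  let W : PreAbstractSimplicialComplex (Option ι) :=
    { faces := {s | s ∈ S.faces ∧ none ∉ s}
      isRelLowerSet_faces := by
        rintro s ⟨h1, h2⟩
        exact ⟨(S.isRelLowerSet_faces h1).1, fun t ht hne =>
          ⟨(S.isRelLowerSet_faces h1).2 ht hne, fun h => h2 (ht h)⟩⟩ }
  obtain ⟨φ, hφ⟩ := exists_relabel (K := W) (Option.some_injective ι) (restrict J Aᶜ)
    fun s hs => by
      refine ⟨s.eraseNone, ⟨hs.1.1.2.1.resolve_left fun h => ?_, fun i hi => ?_⟩, fun o ho => ?_⟩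
      · obtain ⟨o, ho⟩ := hs.1.1.1
        cases o with
        | none => exact hs.2 ho
        | some i => exact Finset.notMem_empty i (h ▸ Finset.mem_eraseNone.2 ho)
      · exact hs.1.2 _ (Finset.mem_eraseNone.1 hi) i rfl
      · cases o with
        | none => exact absurd ho hs.2
        | some i => exact ⟨i, Finset.mem_eraseNone.2 ho, rfl⟩
  have hcard : ∀ s ∈ S.faces, s ∉ W.faces → ((s.card - 1 : ℕ) : ℤ) ≤ b + 1 ∧ 0 < s.card :=
    fun s hs hs' => by
      have hn : none ∈ s := by
        by_contra h
        exact hs' ⟨hs, h⟩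
      obtain ⟨t, ht, htb⟩ := hs.1.2.2 hn
      have hst : s.eraseNone ⊆ t := fun i hi =>
        ht i (Finset.mem_eraseNone.1 hi) (hs.2 _ (Finset.mem_eraseNone.1 hi) i rfl)
      have h1 := Finset.card_le_card hst
      rw [Finset.card_eraseNone_of_mem hn] at h1
      exact ⟨by omega, Finset.card_pos.2 ⟨_, hn⟩⟩
  obtain ⟨Ψ, hΨ, -⟩ := exists_extension S W (fun s hs => hs.1) (fun _ => Set.univ)
    (fun _ _ _ => le_rfl) (b + 2).toNat
    (fun s hs hs' => by
      have := hcard s hs hs'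
      omega)
    (fun s hs hs' a _ => by
      have := hcard s hs hs'
      obtain ⟨c, hc⟩ := hB (s.card - 1) (by omega) a
      exact ⟨c, hc, fun _ => Set.mem_univ _⟩)
    φ (fun _ => Set.mem_univ _)
  refine ⟨Ψ, fun x hx i => ?_⟩
  rw [hΨ x ⟨x.support_mem, hx⟩, hφ]
  rfl

/-- The vertex sets of `A`-parts and `B`-parts of simplices of `J` can be combined arbitrarily, i.e.
`J` is the join of its full subcomplexes on `A` and its complement. -/
def IsJoin (J : PreAbstractSimplicialComplex ι) (A : Set ι) : Prop :=
  ∀ s t u : Finset ι, (s = ∅ ∨ s ∈ J.faces) → (t = ∅ ∨ t ∈ J.faces) → u.Nonempty →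
    (∀ i ∈ u, (i ∈ A → i ∈ s) ∧ (i ∉ A → i ∈ t)) → u ∈ J.faces

/-- If the `B`-part of `J` is `b`-connected, then the partial cone retracts to `J`. The retraction
keeps the `A`-part of a point and applies the retraction `Ψ` of `exists_cone_retraction` to the
rest. It is stated for maps `g` from a compact space, so that finitely many vertices are involved.
-/
theorem exists_partialCone_retraction (hJ : IsJoin J A)
    (hB : IsConn b (Realization (restrict J Aᶜ))) {Z : Type*} [TopologicalSpace Z] [CompactSpace Z]
    (g : C(Z, Realization (partialCone J A b))) :
    ∃ g' : C(Z, Realization J), ∀ z, none ∉ (g z).bary.support →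
      ∀ i, (g' z).bary i = (g z).bary (some i) := by
  classical
  obtain ⟨Ψ, hΨ⟩ := exists_cone_retraction hB
  obtain ⟨F₀, hF₀⟩ := exists_finset_support_subset g
  set F := F₀.eraseNone with hF
  have hgF : ∀ z, (g z).bary.support ⊆ Finset.insertNone F := fun z o ho => by
    cases o with
    | none => simp
    | some i => simpa [hF] using hF₀ z ho
  have hcoord : ∀ o, Continuous fun z => (g z).bary o := fun o =>
    (Realization.continuous_coord o).comp g.continuous
  have hg0 : ∀ z o, 0 ≤ (g z).bary o := fun z o => (g z).nonneg o
  -- the mass `s` of the coned `B`-part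
  let s : Z → ℝ := fun z => (g z).bary none + ∑ i ∈ F.filter (· ∉ A), (g z).bary (some i)
  have hs : Continuous s := (hcoord _).add (continuous_finsetSum _ fun i _ => hcoord _)
  have hs0 : ∀ z, 0 ≤ s z := fun z => add_nonneg (hg0 z _) (Finset.sum_nonneg fun i _ => hg0 z _)
  have hsA : ∀ z, ∑ i ∈ F.filter (· ∈ A), (g z).bary (some i) = 1 - s z := fun z => by
    have h1 := (g z).sum_eq_one (hgF z)
    rw [Finset.sum_insertNone, ← Finset.sum_filter_add_sum_filter_not F (· ∈ A)] at h1
    simp only [s]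
    linarith
  -- the coned `B`-part, normalized to total mass `1`
  let cN : {z // 0 < s z} → Option ι → ℝ := fun z o =>
    if ∀ i ∈ o, i ∉ A then (g z).bary o / s z else 0
  obtain ⟨N, hN⟩ := exists_map (restrict (partialCone J A b) {o | ∀ i ∈ o, i ∉ A})
    (Finset.insertNone F) cN
    (fun z o => by
      simp only [cN]
      split_ifs
      · exact div_nonneg (hg0 z o) z.2.le
      · exact le_rfl)
    (fun z => by
      rw [Finset.sum_insertNone, ← Finset.sum_filter_add_sum_filter_not F (· ∈ A)]
      have h1 : ∀ i ∈ F.filter (· ∈ A), cN z (some i) = 0 := fun i hi =>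
        if_neg fun h => h i rfl (Finset.mem_filter.1 hi).2
      have h2 : ∀ i ∈ F.filter (· ∉ A), cN z (some i) = (g z).bary (some i) / s z := fun i hi =>
        if_pos fun j hj => by
          cases hj
          exact (Finset.mem_filter.1 hi).2
      have h3 : cN z none = (g z).bary none / s z := if_pos fun j hj => by cases hj
      rw [Finset.sum_eq_zero h1, Finset.sum_congr rfl h2, h3, zero_add, ← Finset.sum_div,
        ← add_div]
      exact div_self z.2.ne')
    (fun z o ho => by
      have : (g z).bary o = 0 := Finsupp.notMem_support_iff.1 fun h => ho (hgF z h)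
      simp [cN, this])
    (fun z => by
      have h0 : ∃ o, (∀ i ∈ o, i ∉ A) ∧ (g z).bary o ≠ 0 := by
        by_contra hcon
        push Not at hcon
        refine z.2.ne' (?_ : s z = 0)
        simp only [s]
        rw [hcon none (fun i hi => by cases hi), zero_add]
        exact Finset.sum_eq_zero fun i hi => hcon _ fun j hj => by
          cases hj
          exact (Finset.mem_filter.1 hi).2
      obtain ⟨o, hoA, ho⟩ := h0
      refine ⟨(g z).bary.support.filter fun o => ∀ i ∈ o, i ∉ A,
        ⟨((partialCone J A b).isRelLowerSet_faces (g z).support_mem).2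
          (Finset.filter_subset _ _) ⟨o, ?_⟩, fun o ho => (Finset.mem_filter.1 ho).2⟩,
        fun o ho => ?_⟩
      · exact Finset.mem_filter.2 ⟨Finsupp.mem_support_iff.2 ho, hoA⟩
      · simp only [cN] at ho
        split_ifs at ho with h
        · refine Finset.mem_filter.2 ⟨Finsupp.mem_support_iff.2 fun h' => ho ?_, h⟩
          rw [h', zero_div]
        · exact absurd rfl ho)
    (fun o => by
      by_cases h : ∀ i ∈ o, i ∉ A
      · simp only [cN, if_pos h]
        exact ((hcoord o).comp continuous_subtype_val).div (hs.comp continuous_subtype_val)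
          fun z => z.2.ne'
      · simp only [cN, if_neg h]
        exact continuous_const)
  obtain ⟨G, hG⟩ := exists_finset_support_map_subset Ψ (Finset.insertNone F)
  have hNF : ∀ z, (N z).bary.support ⊆ Finset.insertNone F := fun z o ho => by
    by_contra h
    refine Finsupp.mem_support_iff.1 ho ?_
    have : (g z).bary o = 0 := Finsupp.notMem_support_iff.1 fun h' => h (hgF z h')
    rw [hN]
    simp [cN, this]
  -- the new coordinates in `B`, up to the factor `s`; the value where `s = 0` is irrelevant
  let f : ι → Z → ℝ := fun i z => if h : 0 < s z then (Ψ (N ⟨z, h⟩)).bary i else 0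
  have hf0 : ∀ i z, 0 ≤ f i z := fun i z => by
    simp only [f]
    split_ifs
    · exact Realization.nonneg _ _
    · exact le_rfl
  have hf1 : ∀ i z, f i z ≤ 1 := fun i z => by
    simp only [f]
    split_ifs
    · exact Realization.le_one _ _
    · exact zero_le_one
  have hfpos : ∀ i z, f i z ≠ 0 → ∃ h : 0 < s z, i ∈ (Ψ (N ⟨z, h⟩)).bary.support := fun i z h => by
    simp only [f] at h
    split_ifs at h with h'
    · exact ⟨h', Finsupp.mem_support_iff.2 h⟩
    · exact absurd rfl h
  let c : Z → ι → ℝ := fun z i => if i ∈ A then (g z).bary (some i) else s z * f i z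
  have hcA : ∀ z i, i ∈ A → c z i = (g z).bary (some i) := fun z i hi => if_pos hi
  have hcB : ∀ z i, i ∉ A → c z i = s z * f i z := fun z i hi => if_neg hi
  have hFG : ∀ z i, c z i ≠ 0 → i ∈ F ∪ G := fun z i hi => by
    by_cases hiA : i ∈ A
    · rw [hcA z i hiA] at hi
      exact Finset.mem_union_left _
        (by simpa using hgF z (Finsupp.mem_support_iff.2 hi))
    · rw [hcB z i hiA] at hi
      obtain ⟨h, h'⟩ := hfpos i z (right_ne_zero_of_mul hi)
      exact Finset.mem_union_right _ (hG _ (hNF _) h')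
  have hsum : ∀ z, ∑ i ∈ F ∪ G, c z i = 1 := fun z => by
    rw [← Finset.sum_filter_add_sum_filter_not (F ∪ G) (· ∈ A)]
    have h1 : ∑ i ∈ (F ∪ G).filter (· ∈ A), c z i = 1 - s z := by
      rw [← hsA z]
      refine (Finset.sum_subset (Finset.filter_subset_filter _ Finset.subset_union_left)
        fun i hi hi' => ?_).symm.trans (Finset.sum_congr rfl fun i hi => ?_)
      · rw [Finset.mem_filter] at hi hi'
        rw [hcA z i hi.2]
        refine Finsupp.notMem_support_iff.1 fun h => hi' ⟨?_, hi.2⟩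
        simpa using hgF z h
      · exact hcA z i (Finset.mem_filter.1 hi).2
    have h2 : ∑ i ∈ (F ∪ G).filter (· ∉ A), c z i = s z := by
      rw [Finset.sum_congr rfl fun i hi => hcB z i (Finset.mem_filter.1 hi).2, ← Finset.mul_sum]
      rcases (hs0 z).eq_or_lt with h | h
      · rw [← h, zero_mul]
      · have : ∀ i, f i z = (Ψ (N ⟨z, h⟩)).bary i := fun i => dif_pos h
        simp only [this]
        rw [Realization.sum_eq_one, mul_one]
        intro i hi
        exact Finset.mem_filter.2 ⟨Finset.mem_union_right _ (hG _ (hNF _) hi),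
          (Ψ (N ⟨z, h⟩)).support_mem.2 i hi⟩
    rw [h1, h2, sub_add_cancel]
  obtain ⟨g', hg'⟩ := exists_map J (F ∪ G) c
    (fun z i => by
      simp only [c]
      split_ifs
      · exact hg0 z _
      · exact mul_nonneg (hs0 z) (hf0 i z))
    hsum (fun z i hi => by
      by_contra h
      exact hi (hFG z i h))
    (fun z => by
      refine ⟨(F ∪ G).filter (c z · ≠ 0), ?_, fun i hi => Finset.mem_filter.2 ⟨hFG z i hi, hi⟩⟩
      have hne : ((F ∪ G).filter (c z · ≠ 0)).Nonempty := by
        obtain ⟨i, hi, h0⟩ := Finset.exists_ne_zero_of_sum_ne_zero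
          (f := c z) (by rw [hsum z]; exact one_ne_zero)
        exact ⟨i, Finset.mem_filter.2 ⟨hi, h0⟩⟩
      refine hJ (g z).bary.support.eraseNone
        (if h : 0 < s z then (Ψ (N ⟨z, h⟩)).bary.support else ∅) _ (g z).support_mem.2.1 ?_ hne
        fun i hi => ⟨fun hiA => ?_, fun hiA => ?_⟩
      · split_ifs with h
        · exact Or.inr (Ψ (N ⟨z, h⟩)).support_mem.1
        · exact Or.inl rfl
      · have := (Finset.mem_filter.1 hi).2
        rw [hcA z i hiA] at this
        exact Finset.mem_eraseNone.2 (Finsupp.mem_support_iff.2 this)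
      · have := (Finset.mem_filter.1 hi).2
        rw [hcB z i hiA] at this
        obtain ⟨h, h'⟩ := hfpos i z (right_ne_zero_of_mul this)
        rwa [dif_pos h])
    (fun i => by
      by_cases hi : i ∈ A
      · simp only [c, if_pos hi]
        exact hcoord _
      · simp only [c, if_neg hi]
        refine continuous_mul_of_mem_Icc hs hs0 ?_ (hf0 i) (hf1 i)
        refine ((Realization.continuous_coord i).comp (Ψ.continuous.comp N.continuous)).congr
          fun z => ?_
        change _ = dite _ _ _
        rw [dif_pos z.2]
        rfl)
  refine ⟨g', fun z hz i => ?_⟩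
  rw [hg']
  by_cases hi : i ∈ A
  · exact hcA z i hi
  · rw [hcB z i hi]
    rcases (hs0 z).eq_or_lt with h | h
    · rw [← h, zero_mul]
      by_contra hne
      have hiF : i ∈ F := by simpa using hgF z (Finsupp.mem_support_iff.2 (Ne.symm hne))
      have h1 := Finset.single_le_sum (f := fun i => (g z).bary (some i))
        (s := F.filter (· ∉ A)) (fun i _ => hg0 z (some i)) (Finset.mem_filter.2 ⟨hiF, hi⟩)
      have h2 : (g z).bary (some i) ≤ s z := h1.trans (le_add_of_nonneg_left (hg0 z none))
      exact hne (le_antisymm (hg0 z _) (h2.trans h.symm.le))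
    · have : f i z = (Ψ (N ⟨z, h⟩)).bary i := dif_pos h
      rw [this, hΨ, hN]
      · have hi' : ∀ j ∈ some i, j ∉ A := fun j hj => by
          cases hj
          exact hi
        simp only [cN, if_pos hi']
        exact mul_div_cancel₀ _ h.ne'
      · rw [Finsupp.notMem_support_iff, hN]
        simp [cN, Finsupp.notMem_support_iff.1 hz]

/-- The join of an `a`-connected and a `b`-connected complex is `(a+b+2)`-connected.

It is enough to fill spheres in the partial cone, which retracts to the join. This is done by
carriers: the carrier of a simplex `σ` with few vertices in `A` is the join of the `A`-part of the
complex with the `B`-part of `σ`; if `σ` has more than `a + 1` vertices in `A`, then its `B`-part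
has dimension at most `b` in the range of dimensions that matters, and the apex `none` is allowed in
the carrier as well. -/
theorem IsConn.join {a : ℤ} (hJ : IsJoin J A) (hA : IsConn a (Realization (restrict J A)))
    (hB : IsConn b (Realization (restrict J Aᶜ))) : IsConn (a + b + 2) (Realization J) := by
  classical
  intro d hd g
  let j : C(Realization J, Realization (partialCone J A b)) := simplicialMap some fun s hs =>
    ⟨s.map .some, ⟨by simpa using (J.isRelLowerSet_faces hs).1, Or.inr (by simpa using hs),
      fun h => by simp at h⟩, fun i hi => by simpa using hi⟩
  have hjs : ∀ x i, (j x).bary (some i) = x.bary i := fun x i =>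
    simplicialMap_apply (Option.some_injective ι) _ x i
  have hjn : ∀ x, none ∉ (j x).bary.support := fun x h => by
    obtain ⟨i, -, hi⟩ := exists_of_mem_support_simplicialMap _ _ h
    exact Option.some_ne_none i hi
  let C : Finset ι → Set (Realization (partialCone J A b)) := fun σ =>
    {x | (∀ i ∉ A, some i ∈ x.bary.support → i ∈ σ) ∧
      (none ∈ x.bary.support → a + 1 < (σ.filter (· ∈ A)).card)}
  suffices h : ∃ c : C(Disk d, Realization (partialCone J A b)), ∀ s, c (bdry s) = j (g s) by
    obtain ⟨c, hc⟩ := h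
    obtain ⟨c', hc'⟩ := exists_partialCone_retraction hJ hB c
    refine ⟨c', fun s => Realization.ext fun i => ?_⟩
    rw [hc' _ (by rw [hc]; exact hjn _), hc, hjs]
  refine exists_extension_of_carrier j C ?_ ?_ ?_ hd g
  · rintro σ τ hστ x ⟨h1, h2⟩
    refine ⟨fun i hi hix => hστ (h1 i hi hix), fun hn => (h2 hn).trans_le ?_⟩
    exact_mod_cast Finset.card_le_card (Finset.filter_subset_filter _ hστ)
  · intro σ hσ hσcard e he
    -- adding vertices of the `B`-part of `σ` to the support of a point of the carrier
    have hface : ∀ x ∈ C σ, ∀ u : Finset ι, u.Nonempty →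
        (∀ i ∈ u, i ∈ A → some i ∈ x.bary.support) →
          (∀ i ∈ u, i ∉ A → i ∈ σ) → u ∈ J.faces := fun x hx u hu h1 h2 =>
      hJ x.bary.support.eraseNone σ u x.support_mem.2.1 hσ hu fun i hi =>
        ⟨fun h => Finset.mem_eraseNone.2 (h1 i hi h), h2 i hi⟩
    have hcards : (σ.filter (· ∈ A)).card + (σ.filter (· ∉ A)).card = σ.card :=
      Finset.card_filter_add_card_filter_not _
    by_cases hcase : ((σ.filter (· ∈ A)).card : ℤ) ≤ a + 1
    · have hnone : ∀ x ∈ C σ, none ∉ x.bary.support := fun x hx h => not_lt.2 hcase (hx.2 h)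
      rcases (σ.filter (· ∉ A)).eq_empty_or_nonempty with hemp | ⟨l, hl⟩
      · -- the carrier is the `A`-part of the join
        have hAx : ∀ x ∈ C σ, ∀ i, some i ∈ x.bary.support → i ∈ A := fun x hx i hi => by
          by_contra h
          have : i ∈ σ.filter (· ∉ A) := Finset.mem_filter.2 ⟨hx.1 i h hi, h⟩
          rw [hemp] at this
          exact Finset.notMem_empty _ this
        obtain ⟨e', he'⟩ := exists_lift (Option.some_injective ι) (restrict J A) e fun s => by
          have hsub : ∀ o ∈ (e s).bary.support, ∃ i ∈ (e s).bary.support.eraseNone, some i = o :=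
            fun o ho => by
              cases o with
              | none => exact absurd ho (hnone _ (he s))
              | some i => exact ⟨i, Finset.mem_eraseNone.2 ho, rfl⟩
          refine ⟨_, ⟨(e s).support_mem.2.1.resolve_left fun h0 => ?_, fun i hi =>
            hAx _ (he s) i (Finset.mem_eraseNone.1 hi)⟩, hsub⟩
          obtain ⟨o, ho⟩ := (e s).support_mem.1
          obtain ⟨i, hi, -⟩ := hsub o ho
          rw [h0] at hi
          exact Finset.notMem_empty i hi
        obtain ⟨c, hc⟩ := hA σ.card (by
          rw [hemp, Finset.card_empty] at hcards
          omega) e'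
        have hi : (restrict J A).faces ⊆ J.faces := fun s hs => hs.1
        refine ⟨j.comp ((inclMap hi).comp c), fun s => Realization.ext fun o => ?_, fun x => ?_⟩
        · change (j (inclMap hi (c (bdry s)))).bary o = _
          cases o with
          | none =>
            rw [Finsupp.notMem_support_iff.1 (hjn _),
              Finsupp.notMem_support_iff.1 (hnone _ (he s))]
          | some i => rw [hjs, inclMap_apply, hc, he']
        · refine ⟨fun i hiA h => ?_, fun h => absurd h (hjn _)⟩
          change some i ∈ (j (inclMap hi (c x))).bary.support at h
          rw [Finsupp.mem_support_iff, hjs, inclMap_apply, ← Finsupp.mem_support_iff] at h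
          exact absurd ((c x).support_mem.2 i h) hiA
      · -- the carrier is a cone with apex `l`
        obtain ⟨hlσ, hlA⟩ := Finset.mem_filter.1 hl
        obtain ⟨c, hc, hc'⟩ := exists_cone_extension (partialCone J A b) (some l)
          ⟨Finset.singleton_nonempty _, Or.inr (by
            have : ({some l} : Finset (Option ι)).eraseNone = {l} := by
              ext i
              simp [eq_comm]
            rw [this]
            refine hJ ∅ σ {l} (Or.inl rfl) hσ (Finset.singleton_nonempty _) fun i hi => ?_
            rw [Finset.mem_singleton] at hi
            subst hi
            exact ⟨fun h => absurd h hlA, fun _ => hlσ⟩), fun h => by simp at h⟩ e fun s => by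
          refine ⟨insert (some l) (e s).bary.support, ⟨Finset.insert_nonempty _ _, Or.inr ?_,
            fun h => ?_⟩, Finset.mem_insert_self _ _, Finset.subset_insert _ _⟩
          · refine hface _ (he s) _ ⟨l, by simp⟩ (fun i hi hiA => ?_) fun i hi hiA => ?_
            · rw [Finset.mem_eraseNone, Finset.mem_insert] at hi
              refine hi.resolve_left fun h => hlA ?_
              cases h
              exact hiA
            · rw [Finset.mem_eraseNone, Finset.mem_insert] at hi
              rcases hi with hi | hi
              · cases hi
                exact hlσ
              · exact (he s).1 i hiA hi
          · rw [Finset.mem_insert] at h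
            rcases h with h | h
            · cases h
            · exact absurd h (hnone _ (he s))
        refine ⟨c, hc, fun x => ⟨fun i hiA hi => ?_, fun hn => ?_⟩⟩
        · rcases hc' x with h | ⟨s, h⟩
          · cases h _ hi
            exact hlσ
          · rcases h _ hi with h | h
            · cases h
              exact hlσ
            · exact (he s).1 i hiA h
        · rcases hc' x with h | ⟨s, h⟩
          · cases h _ hn
          · rcases h _ hn with h | h
            · cases h
            · exact absurd h (hnone _ (he s))
    · -- the carrier is a cone with apex `none`
      rw [not_le] at hcase
      have hσB : ((σ.filter (· ∉ A)).card : ℤ) ≤ b + 1 := by omega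
      obtain ⟨c, hc, hc'⟩ := exists_cone_extension (partialCone J A b) none
        ⟨Finset.singleton_nonempty _, Or.inl (by ext; simp), fun _ => ⟨σ.filter (· ∉ A),
          fun i hi => by simp at hi, hσB⟩⟩ e fun s => by
        refine ⟨Finset.insertNone (e s).bary.support.eraseNone, ⟨⟨none, by simp⟩, ?_, fun _ =>
          ⟨σ.filter (· ∉ A), fun i hi hiA => ?_, hσB⟩⟩, by simp, fun o ho => ?_⟩
        · rw [Finset.eraseNone_insertNone]
          exact (e s).support_mem.2.1
        · exact Finset.mem_filter.2 ⟨(he s).1 i hiA (by simpa using hi), hiA⟩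
        · cases o with
          | none => simp
          | some i => simpa using ho
      refine ⟨c, hc, fun x => ⟨fun i hiA hi => ?_, fun _ => hcase⟩⟩
      rcases hc' x with h | ⟨s, h⟩
      · cases h _ hi
      · rcases h _ hi with h | h
        · cases h
        · exact (he s).1 i hiA h
  · intro x
    refine ⟨fun i _ hi => ?_, fun h => absurd h (hjn x)⟩
    rw [Finsupp.mem_support_iff, hjs] at hi
    exact Finsupp.mem_support_iff.2 hi

end Join

/-! ### A fibre theorem for poset maps -/

section Quillen

variable {ι : Type*} {X Y : Type*} [PartialOrder X] [PartialOrder Y]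

theorem simplicialMap_bary {κ : Type*} {K : PreAbstractSimplicialComplex ι}
    {L : PreAbstractSimplicialComplex κ} [DecidableEq ι] (e : κ → ι) (h) (x : Realization L)
    {F : Finset κ} (hF : x.bary.support ⊆ F) (i : ι) :
    (simplicialMap (K := K) e h x).bary i = ∑ j ∈ F.filter (e · = i), x.bary j := by
  change Finsupp.mapDomain e x.bary i = _
  rw [Finsupp.mapDomain, Finsupp.sum_apply, Finsupp.sum_of_support_subset _ hF _ (by simp),
    Finset.sum_filter]
  exact Finset.sum_congr rfl fun j _ => by rw [Finsupp.single_apply]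

/-- Connectivity of a complex that is isomorphic to the order complex of a poset `X`. -/
theorem IsConn.of_orderComplex {k : ℤ} {K : PreAbstractSimplicialComplex ι} {e : X → ι}
    (he : Function.Injective e)
    (h : ∀ s : Finset ι, s ∈ K.faces ↔ s.Nonempty ∧ (∀ i ∈ s, ∃ p, e p = i) ∧
      ∀ p q, e p ∈ s → e q ∈ s → p ≤ q ∨ q ≤ p)
    (hX : IsConn k (Realization (orderComplex X))) : IsConn k (Realization K) := by
  classical
  refine IsConn.of_injective (L := orderComplex X) he
    (fun t ht => ⟨t.map ⟨e, he⟩, (h _).2 ⟨?_, ?_, ?_⟩, ?_⟩)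
    (fun s hs => ⟨s.preimage e he.injOn, ⟨?_, ?_⟩, ?_⟩) hX
  · simpa using ht.1
  · intro i hi
    obtain ⟨p, -, hp⟩ := Finset.mem_map.1 hi
    exact ⟨p, hp⟩
  · intro p q hp hq
    have hp' : p ∈ t := (Finset.mem_map' ⟨e, he⟩).1 hp
    have hq' : q ∈ t := (Finset.mem_map' ⟨e, he⟩).1 hq
    exact ht.2.total hp' hq'
  · intro j hj
    exact (Finset.mem_map' ⟨e, he⟩).2 hj
  · obtain ⟨⟨i, hi⟩, h2, -⟩ := (h s).1 hs
    obtain ⟨p, rfl⟩ := h2 i hi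
    exact ⟨p, Finset.mem_preimage.2 hi⟩
  · intro p hp q hq _
    exact ((h s).1 hs).2.2 p q (Finset.mem_preimage.1 hp) (Finset.mem_preimage.1 hq)
  · intro i hi
    obtain ⟨p, rfl⟩ := ((h s).1 hs).2.1 i hi
    exact ⟨p, Finset.mem_preimage.2 hi, rfl⟩

theorem IsConn.of_orderIso {k : ℤ} (e : X ≃o Y)
    (hX : IsConn k (Realization (orderComplex X))) : IsConn k (Realization (orderComplex Y)) := by
  refine IsConn.of_orderComplex e.injective (fun s => ⟨fun hs => ⟨hs.1, fun i _ => e.surjective i,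
    fun p q hp hq => ?_⟩, fun hs => ⟨hs.1, fun x hx y hy _ => ?_⟩⟩) hX
  · simpa using hs.2.total hp hq
  · obtain ⟨p, rfl⟩ := e.surjective x
    obtain ⟨q, rfl⟩ := e.surjective y
    simpa using hs.2.2 p q hx hy

/-- The order of the mapping cylinder of `f`, in which `x ≤ y` if `f x ≤ y`. -/
def CylLE (f : X →o Y) : X ⊕ Y → X ⊕ Y → Prop
  | .inl x, .inl x' => x ≤ x'
  | .inl x, .inr y => f x ≤ y
  | .inr _, .inl _ => False
  | .inr y, .inr y' => y ≤ y'

/-- The order complex of the mapping cylinder of a poset map. -/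
def cylComplex (f : X →o Y) : PreAbstractSimplicialComplex (X ⊕ Y) where
  faces := {s | s.Nonempty ∧ ∀ i ∈ s, ∀ j ∈ s, CylLE f i j ∨ CylLE f j i}
  isRelLowerSet_faces := by
    rintro s ⟨h0, h1⟩
    exact ⟨h0, fun t ht hne => ⟨hne, fun i hi j hj => h1 i (ht hi) j (ht hj)⟩⟩

variable (f : X →o Y)

/-- The inclusion of the source in the mapping cylinder. -/
noncomputable def cylLeft : C(Realization (orderComplex X), Realization (cylComplex f)) :=
  simplicialMap Sum.inl fun t ht => ⟨t.map .inl, ⟨by simpa using ht.1, fun i hi j hj => by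
    simp only [Finset.mem_map, Function.Embedding.inl_apply] at hi hj
    obtain ⟨x, hx, rfl⟩ := hi
    obtain ⟨y, hy, rfl⟩ := hj
    exact ht.2.total hx hy⟩, fun j hj => by simpa using hj⟩

/-- The inclusion of the target in the mapping cylinder. -/
noncomputable def cylRight : C(Realization (orderComplex Y), Realization (cylComplex f)) :=
  simplicialMap Sum.inr fun t ht => ⟨t.map .inr, ⟨by simpa using ht.1, fun i hi j hj => by
    simp only [Finset.mem_map, Function.Embedding.inr_apply] at hi hj
    obtain ⟨x, hx, rfl⟩ := hi
    obtain ⟨y, hy, rfl⟩ := hj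
    exact ht.2.total hx hy⟩, fun j hj => by simpa using hj⟩

/-- The retraction of the mapping cylinder to the target. -/
noncomputable def cylProj : C(Realization (cylComplex f), Realization (orderComplex Y)) := by
  classical
  exact simplicialMap (Sum.elim f id) fun t ht => ⟨t.image (Sum.elim f id), ⟨ht.1.image _, by
    intro y hy y' hy' _
    rw [Finset.mem_coe, Finset.mem_image] at hy hy'
    obtain ⟨i, hi, rfl⟩ := hy
    obtain ⟨j, hj, rfl⟩ := hy'
    have key : ∀ i j, CylLE f i j → Sum.elim f id i ≤ Sum.elim f id j := by
      rintro (x | y) (x' | y') h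
      · exact f.monotone h
      · exact h
      · exact absurd h id
      · exact h
    exact (ht.2 i hi j hj).imp (key i j) (key j i)⟩, fun j hj => Finset.mem_image_of_mem _ hj⟩

theorem cylLeft_inl (x) (i : X) : (cylLeft f x).bary (.inl i) = x.bary i :=
  simplicialMap_apply Sum.inl_injective _ x i

theorem cylLeft_inr (x) (j : Y) : (cylLeft f x).bary (.inr j) = 0 :=
  simplicialMap_apply_of_notMem_range _ x (by simp)

theorem cylRight_inr (x) (i : Y) : (cylRight f x).bary (.inr i) = x.bary i :=
  simplicialMap_apply Sum.inr_injective _ x i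

theorem cylRight_inl (x) (j : X) : (cylRight f x).bary (.inl j) = 0 :=
  simplicialMap_apply_of_notMem_range _ x (by simp)

theorem cylProj_bary [DecidableEq Y] (x) {F : Finset X} {G : Finset Y}
    (h : x.bary.support ⊆ F.disjSum G) (j : Y) : (cylProj f x).bary j =
      ∑ i ∈ F.filter (f · = j), x.bary (.inl i) + ∑ i ∈ G.filter (· = j), x.bary (.inr i) := by
  classical
  refine (simplicialMap_bary _ _ x h j).trans ?_
  rw [Finset.sum_filter, Finset.sum_disjSum, Finset.sum_filter, Finset.sum_filter]
  rfl

theorem posetMap_bary [DecidableEq Y] (x) {F : Finset X} (h : x.bary.support ⊆ F) (j : Y) :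
    (posetMap f x).bary j = ∑ i ∈ F.filter (f · = j), x.bary i :=
  simplicialMap_bary (K := orderComplex Y) (L := orderComplex X) f (fun t ht => by
    classical
    refine ⟨t.image f, ⟨ht.1.image _, ?_⟩, fun j hj => Finset.mem_image_of_mem _ hj⟩
    intro y hy y' hy' _
    rw [Finset.mem_coe, Finset.mem_image] at hy hy'
    obtain ⟨i, hi, rfl⟩ := hy
    obtain ⟨j, hj, rfl⟩ := hy'
    exact (ht.2.total hi hj).imp (fun h => f.monotone h) (fun h => f.monotone h)) x h j

theorem cylProj_cylRight (x) : cylProj f (cylRight f x) = x := by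
  classical
  refine Realization.ext fun j => ?_
  rw [cylProj_bary f _ (F := ∅) (G := x.bary.support)]
  · simp only [Finset.filter_empty, Finset.sum_empty, zero_add, cylRight_inr]
    rw [Finset.sum_filter, Finset.sum_ite_eq']
    split_ifs with h
    · rfl
    · exact (Finsupp.notMem_support_iff.1 h).symm
  · intro v hv
    rw [Finsupp.mem_support_iff] at hv
    cases v with
    | inl i => exact absurd (cylRight_inl f x i) hv
    | inr j => rw [cylRight_inr] at hv; simpa using hv

theorem cylProj_cylLeft (x) : cylProj f (cylLeft f x) = posetMap f x := by
  classical
  refine Realization.ext fun j => ?_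
  rw [cylProj_bary f _ (F := x.bary.support) (G := ∅), posetMap_bary f _ subset_rfl]
  · simp only [Finset.filter_empty, Finset.sum_empty, add_zero, cylLeft_inl]
  · intro v hv
    rw [Finsupp.mem_support_iff] at hv
    cases v with
    | inl i => rw [cylLeft_inl] at hv; simpa using hv
    | inr j => exact absurd (cylLeft_inr f x j) hv

/-- The two inclusions of the source in the mapping cylinder are homotopic over the target. The
homotopy moves an amount `t` of mass from the target to the source, starting at the minimal
vertices. -/
theorem exists_cyl_homotopy {Z : Type*} [TopologicalSpace Z] [CompactSpace Z]
    (a : C(Z, Realization (orderComplex X))) :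
    ∃ H : C(unitInterval × Z, Realization (cylComplex f)),
      (∀ z, H (0, z) = cylRight f (posetMap f (a z))) ∧ (∀ z, H (1, z) = cylLeft f (a z)) ∧
        ∀ t z, cylProj f (H (t, z)) = posetMap f (a z) := by
  classical
  obtain ⟨F, hF⟩ := exists_finset_support_subset a
  -- `m p i` is the part of the mass of `i` that is still in the target
  let m : unitInterval × Z → X → ℝ := fun p i =>
    max 0 (min ((a p.2).bary i) (1 - p.1 - ∑ k ∈ F.filter (i < ·), (a p.2).bary k))
  have hm0 : ∀ (p : unitInterval × Z) i, 0 ≤ m p i := fun p i => le_max_left _ _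
  have hma : ∀ (p : unitInterval × Z) i, m p i ≤ (a p.2).bary i := fun p i =>
    max_le ((a p.2).nonneg i) (min_le_left _ _)
  have hcoord : ∀ i, Continuous fun p : unitInterval × Z => (a p.2).bary i := fun i =>
    (Realization.continuous_coord i).comp (a.continuous.comp continuous_snd)
  have hmc : ∀ i, Continuous fun p => m p i := fun i =>
    continuous_const.max ((hcoord i).min ((continuous_const.sub
      (continuous_subtype_val.comp continuous_fst)).sub
        (continuous_finsetSum _ fun k _ => hcoord k)))
  have haF : ∀ (p : unitInterval × Z) i, i ∉ F → (a p.2).bary i = 0 := fun p i hi =>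
    Finsupp.notMem_support_iff.1 fun h => hi (hF _ h)
  -- mass is moved to the source in increasing order
  have hmono : ∀ (p : unitInterval × Z) i k, 0 < m p k → m p i < (a p.2).bary i →
      k < i → False := by
    intro p i k hk hi hki
    have h1 : 0 < 1 - (p.1 : ℝ) - ∑ l ∈ F.filter (k < ·), (a p.2).bary l := by
      rcases lt_max_iff.1 hk with h | h
      · exact absurd h (lt_irrefl _)
      · exact (lt_min_iff.1 h).2
    have h2 : 1 - (p.1 : ℝ) - ∑ l ∈ F.filter (i < ·), (a p.2).bary l < (a p.2).bary i := by
      rcases min_lt_iff.1 ((le_max_right _ _).trans_lt hi) with h | h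
      · exact absurd h (lt_irrefl _)
      · exact h
    have hiF : i ∈ F := by
      by_contra h
      rw [haF p i h] at hi
      exact absurd (hm0 p i) (not_le.2 hi)
    have h3 : ∑ l ∈ insert i (F.filter (i < ·)), (a p.2).bary l ≤
        ∑ l ∈ F.filter (k < ·), (a p.2).bary l := by
      refine Finset.sum_le_sum_of_subset_of_nonneg (fun l hl => ?_) fun l _ _ => (a p.2).nonneg l
      rcases Finset.mem_insert.1 hl with rfl | hl
      · exact Finset.mem_filter.2 ⟨hiF, hki⟩
      · exact Finset.mem_filter.2 ⟨(Finset.mem_filter.1 hl).1,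
          hki.trans (Finset.mem_filter.1 hl).2⟩
    rw [Finset.sum_insert (by simp)] at h3
    linarith
  let c : unitInterval × Z → X ⊕ Y → ℝ := fun p => Sum.elim
    (fun i => (a p.2).bary i - m p i) (fun j => ∑ i ∈ F.filter (f · = j), m p i)
  have hcR : ∀ (p : unitInterval × Z) j, c p (.inr j) ≠ 0 → ∃ k ∈ F, f k = j ∧ 0 < m p k :=
      fun p j h => by
    obtain ⟨k, hk, hk'⟩ := Finset.exists_ne_zero_of_sum_ne_zero h
    obtain ⟨h1, h2⟩ := Finset.mem_filter.1 hk
    exact ⟨k, h1, h2, lt_of_le_of_ne (hm0 p k) hk'.symm⟩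
  have hcL : ∀ (p : unitInterval × Z) i, c p (.inl i) ≠ 0 → m p i < (a p.2).bary i := fun p i h =>
    lt_of_le_of_ne (hma p i) fun h' => h (sub_eq_zero.2 h'.symm)
  have hcF : ∀ (p : unitInterval × Z) v, v ∉ F.disjSum (F.image f) → c p v = 0 := fun p v hv => by
    by_contra h
    cases v with
    | inl i =>
      refine hv (Finset.inl_mem_disjSum.2 ?_)
      by_contra hi
      have := hcL p i h
      rw [haF p i hi] at this
      exact absurd (hm0 p i) (not_le.2 this)
    | inr j =>
      obtain ⟨k, hk, rfl, -⟩ := hcR p j h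
      exact hv (Finset.inr_mem_disjSum.2 (Finset.mem_image_of_mem _ hk))
  have hsum : ∀ p : unitInterval × Z, ∑ v ∈ F.disjSum (F.image f), c p v = 1 := fun p => by
    rw [Finset.sum_disjSum]
    simp only [c, Sum.elim_inl, Sum.elim_inr]
    rw [Finset.sum_fiberwise_of_maps_to (fun i hi => Finset.mem_image_of_mem f hi),
      ← Finset.sum_add_distrib]
    simp only [sub_add_cancel]
    exact (a p.2).sum_eq_one (hF _)
  have hface : ∀ (p : unitInterval × Z) v w, c p v ≠ 0 → c p w ≠ 0 →
      CylLE f v w ∨ CylLE f w v := by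
    have hpos : ∀ (p : unitInterval × Z) i, 0 < (a p.2).bary i →
        i ∈ (a p.2).bary.support := fun p i h => ((a p.2).pos_iff i).1 h
    have hchain : ∀ (p : unitInterval × Z) i k, 0 < (a p.2).bary i → 0 < (a p.2).bary k →
        i ≤ k ∨ k ≤ i := fun p i k hi hk => (a p.2).support_mem.2.total (hpos p i hi) (hpos p k hk)
    have hLR : ∀ (p : unitInterval × Z) i j, c p (.inl i) ≠ 0 → c p (.inr j) ≠ 0 → f i ≤ j := by
      intro p i j hi hj
      have hi' := hcL p i hi
      obtain ⟨k, hk, rfl, hk'⟩ := hcR p j hj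
      rcases hchain p i k ((hm0 p i).trans_lt hi') (hk'.trans_le (hma p k)) with h | h
      · exact f.monotone h
      · rcases h.eq_or_lt with h | h
        · rw [h]
        · exact (hmono p i k hk' hi' h).elim
    rintro p (i | j) (i' | j') hv hw
    · exact hchain p i i' ((hm0 p i).trans_lt (hcL p i hv)) ((hm0 p i').trans_lt (hcL p i' hw))
    · exact Or.inl (hLR p i j' hv hw)
    · exact Or.inr (hLR p i' j hw hv)
    · obtain ⟨k, -, rfl, hk⟩ := hcR p j hv
      obtain ⟨k', -, rfl, hk'⟩ := hcR p j' hw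
      exact (hchain p k k' (hk.trans_le (hma p k)) (hk'.trans_le (hma p k'))).imp
        (fun h => f.monotone h) (fun h => f.monotone h)
  obtain ⟨H, hH⟩ := exists_map (cylComplex f) (F.disjSum (F.image f)) c
    (fun p v => by
      cases v with
      | inl i => exact sub_nonneg.2 (hma p i)
      | inr j => exact Finset.sum_nonneg fun i _ => hm0 p i)
    hsum hcF
    (fun p => by
      refine ⟨(F.disjSum (F.image f)).filter (c p · ≠ 0), ⟨?_, fun v hv w hw =>
        hface p v w (Finset.mem_filter.1 hv).2 (Finset.mem_filter.1 hw).2⟩, fun v hv => ?_⟩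
      · obtain ⟨v, hv, h0⟩ := Finset.exists_ne_zero_of_sum_ne_zero
          (f := c p) (by rw [hsum p]; exact one_ne_zero)
        exact ⟨v, Finset.mem_filter.2 ⟨hv, h0⟩⟩
      · refine Finset.mem_filter.2 ⟨?_, hv⟩
        by_contra h
        exact hv (hcF p v h))
    (fun v => by
      cases v with
      | inl i => exact (hcoord i).sub (hmc i)
      | inr j => exact continuous_finsetSum _ fun i _ => hmc i)
  have hHs : ∀ p, (H p).bary.support ⊆ F.disjSum (F.image f) := fun p v hv => by
    by_contra h
    rw [Finsupp.mem_support_iff, hH] at hv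
    exact hv (hcF p v h)
  refine ⟨H, fun z => Realization.ext fun v => ?_, fun z => Realization.ext fun v => ?_,
    fun t z => Realization.ext fun j => ?_⟩
  · have hm : ∀ i, m (0, z) i = (a z).bary i := fun i => by
      by_cases hi : i ∈ F
      · have h1 : ∑ l ∈ insert i (F.filter (i < ·)), (a z).bary l ≤ 1 := by
          rw [← (a z).sum_eq_one (hF z)]
          refine Finset.sum_le_sum_of_subset_of_nonneg (fun l hl => ?_) fun l _ _ => (a z).nonneg l
          rcases Finset.mem_insert.1 hl with rfl | hl
          · exact hi
          · exact (Finset.mem_filter.1 hl).1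
        rw [Finset.sum_insert (by simp)] at h1
        simp only [m]
        rw [min_eq_left, max_eq_right ((a z).nonneg i)]
        change _ ≤ 1 - (0 : ℝ) - _
        linarith
      · exact le_antisymm (hma (0, z) i) (by rw [haF (0, z) i hi]; exact hm0 _ _)
    rw [hH]
    cases v with
    | inl i =>
      rw [cylRight_inl]
      simp only [c, Sum.elim_inl, hm, sub_self]
    | inr j =>
      rw [cylRight_inr, posetMap_bary f _ (hF z)]
      simp only [c, Sum.elim_inr, hm]
  · have hm : ∀ i, m (1, z) i = 0 := fun i => by
      have h1 : 0 ≤ ∑ k ∈ F.filter (i < ·), (a z).bary k :=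
        Finset.sum_nonneg fun k _ => (a z).nonneg k
      refine max_eq_left ((min_le_right _ _).trans ?_)
      change 1 - (1 : ℝ) - _ ≤ 0
      linarith
    rw [hH]
    cases v with
    | inl i =>
      rw [cylLeft_inl]
      simp only [c, Sum.elim_inl, hm, sub_zero]
    | inr j =>
      rw [cylLeft_inr]
      simp only [c, Sum.elim_inr, hm, Finset.sum_const_zero]
  · rw [cylProj_bary f _ (hHs (t, z)), posetMap_bary f _ (hF z)]
    simp only [hH, c, Sum.elim_inl, Sum.elim_inr]
    rw [Finset.sum_filter (fun x => x = j), Finset.sum_ite_eq']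
    have : (if j ∈ F.image f then ∑ i ∈ F.filter (f · = j), m (t, z) i else 0) =
        ∑ i ∈ F.filter (f · = j), m (t, z) i := by
      split_ifs with h
      · rfl
      · refine (Finset.sum_eq_zero fun i hi => ?_).symm
        obtain ⟨h1, rfl⟩ := Finset.mem_filter.1 hi
        exact absurd (Finset.mem_image_of_mem f h1) h
    rw [this, ← Finset.sum_add_distrib]
    simp only [sub_add_cancel]

end Quillen

section Fibre

variable {X Y : Type*} [PartialOrder X] [PartialOrder Y] (f : X →o Y)

/-- In the part of the mapping cylinder over an upward closed set `Q` of the target, the link of a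
minimal element `y` of `Q` is the join of the fibre below `y` and of the elements above `y`. -/
theorem isConn_link_cylComplex {a b : ℤ} {y : Y} {Q : Set Y} (hy : y ∈ Q)
    (hup : ∀ y', y < y' → y' ∈ Q) (hmin : ∀ y' ∈ Q, ¬ y' < y)
    (ha : IsConn a (Realization (orderComplex {x : X // f x ≤ y})))
    (hb : IsConn b (Realization (orderComplex {y' : Y // y < y'}))) :
    IsConn (a + b + 2) (Realization
      (link (restrict (cylComplex f) {v | ∀ y', v = .inr y' → y' ∈ Q}) {.inr y})) := by
  classical
  set J := link (restrict (cylComplex f) {v | ∀ y', v = .inr y' → y' ∈ Q}) {.inr y} with hJ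
  have hmem : ∀ s, s ∈ J.faces ↔ s.Nonempty ∧ .inr y ∉ s ∧
      (∀ i ∈ s, ∀ j ∈ s, CylLE f i j ∨ CylLE f j i) ∧ (∀ x, .inl x ∈ s → f x ≤ y) ∧
        ∀ y', .inr y' ∈ s → y < y' := by
    intro s
    rw [hJ, link_singleton_faces]
    constructor
    · rintro ⟨h1, h2, ⟨-, h3⟩, h4⟩
      refine ⟨h1, h2, fun i hi j hj => h3 i (Finset.mem_insert_of_mem hi) j
        (Finset.mem_insert_of_mem hj), fun x hx => ?_, fun y' hy' => ?_⟩
      · exact (h3 _ (Finset.mem_insert_of_mem hx) _ (Finset.mem_insert_self _ _)).resolve_right id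
      · rcases h3 _ (Finset.mem_insert_of_mem hy') _ (Finset.mem_insert_self _ _) with h | h
        · refine (hmin y' (h4 _ (Finset.mem_insert_of_mem hy') y' rfl) ?_).elim
          exact lt_of_le_of_ne h fun h' => h2 (h' ▸ hy')
        · exact lt_of_le_of_ne h fun h' => h2 (h' ▸ hy')
    · rintro ⟨h1, h2, h3, h4, h5⟩
      have key : ∀ i ∈ s, CylLE f i (.inr y) ∨ CylLE f (.inr y) i := by
        rintro (x | y') hi
        · exact Or.inl (h4 x hi)
        · exact Or.inr (h5 y' hi).le
      refine ⟨h1, h2, ⟨Finset.insert_nonempty _ _, fun i hi j hj => ?_⟩, fun i hi y' h => ?_⟩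
      · rcases Finset.mem_insert.1 hi with rfl | hi <;> rcases Finset.mem_insert.1 hj with rfl | hj
        · exact Or.inl (le_refl y)
        · exact (key j hj).symm
        · exact key i hi
        · exact h3 i hi j hj
      · rcases Finset.mem_insert.1 hi with rfl | hi
        · rw [← Sum.inr_injective h]
          exact hy
        · exact hup y' (h5 y' (h ▸ hi))
  have hjoin : IsJoin J (Set.range Sum.inl) := by
    intro s t u hs ht hu hst
    have hl : ∀ x, .inl x ∈ u → .inl x ∈ s ∧ s ∈ J.faces := fun x hx => by
      have h := (hst _ hx).1 ⟨x, rfl⟩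
      refine ⟨h, hs.resolve_left fun h0 => ?_⟩
      rw [h0] at h
      exact Finset.notMem_empty _ h
    have hr : ∀ y', .inr y' ∈ u → .inr y' ∈ t ∧ t ∈ J.faces := fun y' hx => by
      have h := (hst _ hx).2 (by simp)
      refine ⟨h, ht.resolve_left fun h0 => ?_⟩
      rw [h0] at h
      exact Finset.notMem_empty _ h
    have hle : ∀ x, .inl x ∈ u → f x ≤ y := fun x hx =>
      ((hmem s).1 (hl x hx).2).2.2.2.1 x (hl x hx).1
    have hlt : ∀ y', .inr y' ∈ u → y < y' := fun y' hx =>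
      ((hmem t).1 (hr y' hx).2).2.2.2.2 y' (hr y' hx).1
    refine (hmem u).2 ⟨hu, fun h => lt_irrefl _ (hlt y h), ?_, hle, hlt⟩
    rintro (x | y₁) hi (x' | y₂) hj
    · exact ((hmem s).1 (hl x hi).2).2.2.1 _ (hl x hi).1 _ (hl x' hj).1
    · exact Or.inl ((hle x hi).trans (hlt y₂ hj).le)
    · exact Or.inr ((hle x' hj).trans (hlt y₁ hi).le)
    · exact ((hmem t).1 (hr y₁ hi).2).2.2.1 _ (hr y₁ hi).1 _ (hr y₂ hj).1
  refine IsConn.join hjoin (IsConn.of_orderComplex (e := fun x : {x : X // f x ≤ y} =>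
    (.inl x.1 : X ⊕ Y)) (fun p q h => Subtype.ext (Sum.inl_injective h)) (fun s => ?_) ha)
    (IsConn.of_orderComplex (e := fun x : {y' : Y // y < y'} =>
    (.inr x.1 : X ⊕ Y)) (fun p q h => Subtype.ext (Sum.inr_injective h)) (fun s => ?_) hb)
  · constructor
    · rintro ⟨hs, hA⟩
      obtain ⟨h1, -, h3, h4, -⟩ := (hmem s).1 hs
      refine ⟨h1, fun i hi => ?_, fun p q hp hq => h3 _ hp _ hq⟩
      obtain ⟨x, rfl⟩ := hA i hi
      exact ⟨⟨x, h4 x hi⟩, rfl⟩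
    · rintro ⟨h1, h2, h3⟩
      refine ⟨(hmem s).2 ⟨h1, fun h => ?_, fun i hi j hj => ?_, fun x hx => ?_, fun y' hy' => ?_⟩,
        fun i hi => ?_⟩
      · obtain ⟨p, hp⟩ := h2 _ h
        exact absurd hp Sum.inl_ne_inr
      · obtain ⟨p, rfl⟩ := h2 _ hi
        obtain ⟨q, rfl⟩ := h2 _ hj
        exact h3 p q hi hj
      · obtain ⟨p, hp⟩ := h2 _ hx
        rw [← Sum.inl_injective hp]
        exact p.2
      · obtain ⟨p, hp⟩ := h2 _ hy'
        exact absurd hp Sum.inl_ne_inr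
      · obtain ⟨p, rfl⟩ := h2 _ hi
        exact ⟨_, rfl⟩
  · constructor
    · rintro ⟨hs, hA⟩
      obtain ⟨h1, -, h3, -, h5⟩ := (hmem s).1 hs
      refine ⟨h1, fun i hi => ?_, fun p q hp hq => h3 _ hp _ hq⟩
      rcases i with x | y'
      · exact absurd ⟨x, rfl⟩ (hA _ hi)
      · exact ⟨⟨y', h5 y' hi⟩, rfl⟩
    · rintro ⟨h1, h2, h3⟩
      refine ⟨(hmem s).2 ⟨h1, fun h => ?_, fun i hi j hj => ?_, fun x hx => ?_, fun y' hy' => ?_⟩,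
        fun i hi => ?_⟩
      · obtain ⟨p, hp⟩ := h2 _ h
        exact absurd (Sum.inr_injective hp) p.2.ne'
      · obtain ⟨p, rfl⟩ := h2 _ hi
        obtain ⟨q, rfl⟩ := h2 _ hj
        exact h3 p q hi hj
      · obtain ⟨p, hp⟩ := h2 _ hx
        exact absurd hp Sum.inr_ne_inl
      · obtain ⟨p, hp⟩ := h2 _ hy'
        rw [← Sum.inr_injective hp]
        exact p.2
      · obtain ⟨p, rfl⟩ := h2 _ hi
        rintro ⟨x, hx⟩
        exact absurd hx Sum.inl_ne_inr

variable {f} {Z : Type*} [TopologicalSpace Z] [CompactSpace Z] {k n : ℤ}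

/-- Maps from low-dimensional spaces to the mapping cylinder can be pushed off a minimal target
vertex. -/
theorem exists_homotopic_avoid_target (hZ : SmallDim k Z) (hk : k ≤ n) {y : Y} {Q : Set Y}
    (hy : y ∈ Q) (hup : ∀ y', y < y' → y' ∈ Q) (hmin : ∀ y' ∈ Q, ¬ y' < y) {a b : ℤ}
    (hab : a + b + 2 = n - 1) (ha : IsConn a (Realization (orderComplex {x : X // f x ≤ y})))
    (hb : IsConn b (Realization (orderComplex {y' : Y // y < y'})))
    (g : C(Z, Realization (cylComplex f)))
    (hg : ∀ z y', (g z).bary (.inr y') ≠ 0 → y' ∈ Q) :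
    ∃ g' : C(Z, Realization (cylComplex f)),
      g.HomotopicRel g' {z | (g z).bary (.inr y) = 0} ∧
      ∀ z y', (g' z).bary (.inr y') ≠ 0 → y' ∈ Q ∧ y' ≠ y := by
  classical
  let K := restrict (cylComplex f) {v | ∀ y', v = .inr y' → y' ∈ Q}
  have hK : K.faces ⊆ (cylComplex f).faces := fun s hs => hs.1
  obtain ⟨g₁, hg₁⟩ := exists_lift_incl K g fun z => ⟨(g z).support_mem, fun i hi y' h => by
    refine hg z y' ?_
    rw [← h]
    exact Finsupp.mem_support_iff.1 hi⟩
  obtain ⟨g₂, h₁₂, hg₂⟩ := exists_homotopic_avoid_vertex hZ hk (.inr y)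
    (hab ▸ isConn_link_cylComplex f hy hup hmin ha hb) g₁
  have e : (inclMap hK).comp g₁ = g := ContinuousMap.ext fun z => Realization.ext fun i =>
    (inclMap_apply hK _ i).trans (hg₁ z i)
  refine ⟨(inclMap hK).comp g₂, ?_, fun z y' h => ⟨?_, ?_⟩⟩
  · have h := h₁₂.comp_continuousMap (inclMap hK)
    rw [e] at h
    refine HomotopicRel.mono_set h fun z hz => ?_
    rw [Set.mem_ofPred_eq, hg₁]
    exact hz
  · rw [ContinuousMap.comp_apply, inclMap_apply] at h
    exact (g₂ z).support_mem.2 _ (Finsupp.mem_support_iff.2 h) y' rfl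
  · rintro rfl
    rw [ContinuousMap.comp_apply, inclMap_apply] at h
    exact h (hg₂ z)

theorem eq_of_homotopicRel {A B : Type*} [TopologicalSpace A] [TopologicalSpace B] {g h : C(A, B)}
    {S : Set A} (H : g.HomotopicRel h S) {x : A} (hx : x ∈ S) : g x = h x :=
  H.some.fst_eq_snd hx

/-- If the target vertices met by `g` have height at least `h`, then those of height equal to `h`
can be removed. They are pairwise incomparable, hence can be removed one at a time; `G` is a finite
set that contains the remaining ones. -/
theorem exists_homotopic_avoid_level {t : Y → ℕ} (ht : StrictMono t)
    (hfib : ∀ y, IsConn ((t y : ℤ) - 1) (Realization (orderComplex {x : X // f x ≤ y})))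
    (habove : ∀ y, IsConn (n - t y - 2) (Realization (orderComplex {y' : Y // y < y'})))
    (hZ : SmallDim k Z) (hk : k ≤ n) (h : ℕ) (G : Finset Y)
    (g : C(Z, Realization (cylComplex f)))
    (hg : ∀ z y, (g z).bary (.inr y) ≠ 0 → h < t y ∨ t y = h ∧ y ∈ G) :
    ∃ g' : C(Z, Realization (cylComplex f)),
      g.HomotopicRel g' {z | ∀ y, (g z).bary (.inr y) = 0} ∧
      ∀ z y, (g' z).bary (.inr y) ≠ 0 → h < t y := by
  classical
  induction G using Finset.induction_on generalizing g with
  | empty =>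
    exact ⟨g, ContinuousMap.HomotopicRel.refl _, fun z y hy => (hg z y hy).resolve_right (by simp)⟩
  | insert y G _ ih =>
    by_cases hy : t y = h
    · obtain ⟨g₁, h1, hg₁⟩ := exists_homotopic_avoid_target hZ hk
        (Q := {y' | h < t y' ∨ t y' = h ∧ y' ∈ insert y G}) (y := y)
        (Or.inr ⟨hy, Finset.mem_insert_self _ _⟩) (fun y' h' => Or.inl (hy ▸ ht h'))
        (fun y' h' hlt => by
          have := ht hlt
          rcases h' with h' | ⟨h', -⟩ <;> omega)
        (by ring) (hfib y) (habove y) g hg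
      obtain ⟨g₂, h2, hg₂⟩ := ih g₁ fun z y' h' => by
        obtain ⟨h3 | ⟨h3, h4⟩, h5⟩ := hg₁ z y' h'
        · exact Or.inl h3
        · exact Or.inr ⟨h3, (Finset.mem_insert.1 h4).resolve_left h5⟩
      have h1' := HomotopicRel.mono_set h1 (S := {z | ∀ y, (g z).bary (.inr y) = 0})
        fun z hz => hz y
      refine ⟨g₂, h1'.trans (HomotopicRel.mono_set h2 fun z hz => ?_), hg₂⟩
      rw [Set.mem_ofPred_eq, ← eq_of_homotopicRel h1' hz]
      exact hz
    · refine ih g fun z y' h' => (hg z y' h').imp_right fun ⟨h1, h2⟩ =>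
        ⟨h1, (Finset.mem_insert.1 h2).resolve_left fun h3 => hy (h3 ▸ h1)⟩

/-- Under the hypotheses of the fibre theorem, a map from a space of dimension at most `n` to the
mapping cylinder can be deformed into the source: the target vertices are removed in the order of
their heights. -/
theorem exists_homotopic_left {t : Y → ℕ} (ht : StrictMono t)
    (hfib : ∀ y, IsConn ((t y : ℤ) - 1) (Realization (orderComplex {x : X // f x ≤ y})))
    (habove : ∀ y, IsConn (n - t y - 2) (Realization (orderComplex {y' : Y // y < y'})))
    {N : ℕ} (hN : ∀ y, t y < N) (hZ : SmallDim k Z) (hk : k ≤ n)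
    (g : C(Z, Realization (cylComplex f))) :
    ∃ g' : C(Z, Realization (cylComplex f)),
      g.HomotopicRel g' {z | ∀ y, (g z).bary (.inr y) = 0} ∧
      ∀ z y, (g' z).bary (.inr y) = 0 := by
  classical
  have key : ∀ h : ℕ, ∃ g' : C(Z, Realization (cylComplex f)),
      g.HomotopicRel g' {z | ∀ y, (g z).bary (.inr y) = 0} ∧
      ∀ z y, (g' z).bary (.inr y) ≠ 0 → h ≤ t y := by
    intro h
    induction h with
    | zero => exact ⟨g, ContinuousMap.HomotopicRel.refl _, fun z y _ => Nat.zero_le _⟩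
    | succ h ih =>
      obtain ⟨g₁, h1, hg₁⟩ := ih
      obtain ⟨F, hF⟩ := exists_finset_support_subset g₁
      obtain ⟨g₂, h2, hg₂⟩ := exists_homotopic_avoid_level ht hfib habove hZ hk h
        (F.preimage .inr Sum.inr_injective.injOn) g₁ fun z y hy => by
          rcases (hg₁ z y hy).lt_or_eq with h3 | h3
          · exact Or.inl h3
          · exact Or.inr ⟨h3.symm, Finset.mem_preimage.2 (hF z (Finsupp.mem_support_iff.2 hy))⟩
      refine ⟨g₂, h1.trans (HomotopicRel.mono_set h2 fun z hz => ?_), hg₂⟩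
      rw [Set.mem_ofPred_eq, ← eq_of_homotopicRel h1 hz]
      exact hz
  obtain ⟨g', h1, h2⟩ := key N
  exact ⟨g', h1, fun z y => by_contra fun h => absurd (h2 z y h) (not_le.2 (hN y))⟩

theorem exists_lift_cylLeft (g : C(Z, Realization (cylComplex f)))
    (hg : ∀ z y, (g z).bary (.inr y) = 0) :
    ∃ c : C(Z, Realization (orderComplex X)), ∀ z, cylLeft f (c z) = g z := by
  classical
  have hl : ∀ z, ∀ i ∈ (g z).bary.support, ∃ x, .inl x = i := fun z i hi => by
    rcases i with x | y
    · exact ⟨x, rfl⟩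
    · exact absurd (hg z y) (Finsupp.mem_support_iff.1 hi)
  obtain ⟨c, hc⟩ := exists_lift (e := Sum.inl) Sum.inl_injective (orderComplex X) g fun z => by
    refine ⟨(g z).bary.support.preimage .inl Sum.inl_injective.injOn, ⟨?_, ?_⟩, fun i hi => ?_⟩
    · obtain ⟨i, hi⟩ := (g z).support_mem.1
      obtain ⟨x, rfl⟩ := hl z i hi
      exact ⟨x, Finset.mem_preimage.2 hi⟩
    · intro x hx x' hx' _
      exact (g z).support_mem.2 _ (Finset.mem_preimage.1 hx) _ (Finset.mem_preimage.1 hx')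
    · obtain ⟨x, rfl⟩ := hl z i hi
      exact ⟨x, Finset.mem_preimage.2 hi, rfl⟩
  refine ⟨c, fun z => Realization.ext fun i => ?_⟩
  rcases i with x | y
  · rw [cylLeft_inl, hc]
  · rw [cylLeft_inr, hg]

theorem cylLeft_injective : Function.Injective (cylLeft f) := fun x y h =>
  Realization.ext fun i => by rw [← cylLeft_inl f, h, cylLeft_inl]

/-- A version of Quillen's fibre theorem: if the fibres below `y` are `(t(y) - 1)`-connected and the
posets above `y` are `(n - t(y) - 2)`-connected, then `f` is `n`-connected. -/
theorem isConnMap_posetMap {t : Y → ℕ} (ht : StrictMono t)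
    (hfib : ∀ y, IsConn ((t y : ℤ) - 1) (Realization (orderComplex {x : X // f x ≤ y})))
    (habove : ∀ y, IsConn (n - t y - 2) (Realization (orderComplex {y' : Y // y < y'})))
    {N : ℕ} (hN : ∀ y, t y < N) : IsConnMap n (posetMap f) := by
  intro d hd a b hab
  -- `b`, regarded as a map to the mapping cylinder, with a collar that connects its boundary to the
  -- source; it is pushed into the source, relative to the boundary
  obtain ⟨H, hH0, hH1, hH⟩ := exists_cyl_homotopy f a
  obtain ⟨G, hG1, hG⟩ := exists_collar ((cylRight f).comp b) H fun s => by
    rw [hH0, ContinuousMap.comp_apply, hab]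
  have hproj : (cylProj f).comp G = b.comp (stretch d) := by
    ext1 x
    rw [ContinuousMap.comp_apply, ContinuousMap.comp_apply]
    rcases hG x with h | ⟨t, s, h, h'⟩
    · rw [h, ContinuousMap.comp_apply, cylProj_cylRight]
    · rw [h', hH, ← hab, h]
  obtain ⟨G', h1, h2⟩ := exists_homotopic_left ht hfib habove hN (smallDim_disk d) hd G
  obtain ⟨c, hc⟩ := exists_lift_cylLeft G' h2
  have hbd : ∀ s, ∀ y, (G (bdry s)).bary (.inr y) = 0 := fun s y => by
    rw [hG1, hH1, cylLeft_inr]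
  refine ⟨c, fun s => cylLeft_injective (f := f) ?_, ?_⟩
  · rw [hc, ← eq_of_homotopicRel h1 (hbd s), hG1, hH1]
  · have e : (posetMap f).comp c = (cylProj f).comp G' := by
      ext1 x
      rw [ContinuousMap.comp_apply, ContinuousMap.comp_apply, ← cylProj_cylLeft, hc]
    rw [e]
    have h3 := (h1.comp_continuousMap (cylProj f)).symm
    rw [hproj] at h3
    refine (HomotopicRel.mono_set h3 ?_).trans (homotopicRel_comp_stretch b)
    rintro _ ⟨s, rfl⟩
    exact hbd s

/-- Under the hypotheses of the fibre theorem, the target inherits the connectivity of the source in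
the range in which `f` is surjective on homotopy. -/
theorem IsConn.of_posetMap {t : Y → ℕ} (ht : StrictMono t)
    (hfib : ∀ y, IsConn ((t y : ℤ) - 1) (Realization (orderComplex {x : X // f x ≤ y})))
    (habove : ∀ y, IsConn (n - t y - 2) (Realization (orderComplex {y' : Y // y < y'})))
    {N : ℕ} (hN : ∀ y, t y < N)
    (hX : IsConn (n - 1) (Realization (orderComplex X))) :
    IsConn (n - 1) (Realization (orderComplex Y)) := by
  intro d hd a
  obtain ⟨G, h1, h2⟩ := exists_homotopic_left ht hfib habove hN (smallDim_sphere d)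
    (hd.trans (by omega)) ((cylRight f).comp a)
  obtain ⟨a', ha'⟩ := exists_lift_cylLeft G h2
  obtain ⟨c, hc⟩ := hX d hd a'
  have h3 : a.Homotopic ((cylProj f).comp G) := by
    have h4 := (ContinuousMap.Homotopic.refl (cylProj f)).comp h1.homotopic
    have e : (cylProj f).comp ((cylRight f).comp a) = a :=
      ContinuousMap.ext fun x => cylProj_cylRight f _
    rwa [e] at h4
  refine exists_extension_of_homotopic h3 ((posetMap f).comp c) fun s => ?_
  rw [ContinuousMap.comp_apply, hc, ContinuousMap.comp_apply, ← cylProj_cylLeft, ha']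

end Fibre

/-! ### Barycentric subdivision and skeleta -/

section Subdivision

variable {ι : Type*} {K : PreAbstractSimplicialComplex ι}

open Classical in
/-- For a simplex `σ`, the amount by which the coordinates of `x` in `σ` exceed those in `F \ σ`;
zero unless `σ` is a superlevel set of `x`. -/
noncomputable def levelGap (F : Finset ι) (x : ι →₀ ℝ) (σ : FacePoset K) : ℝ :=
  max 0 ((σ.1 ×ˢ (F ∪ σ.1)).inf' (((K.isRelLowerSet_faces σ.2).1).product
    (((K.isRelLowerSet_faces σ.2).1).mono Finset.subset_union_right))
      fun p => x p.1 - if p.2 ∈ σ.1 then 0 else x p.2)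

open Classical in
/-- The maps which subdivide barycentrically: the simplices in the support of the image are
superlevel sets of the coordinates. -/
theorem exists_levelSet_map {Z : Type*} [TopologicalSpace Z] (F : Finset ι)
    (g : C(Z, Realization K)) (hF : ∀ z, (g z).bary.support ⊆ F) :
    ∃ g' : C(Z, Realization (orderComplex (FacePoset K))),
      (∀ z σ, (g' z).bary σ = levelGap F (g z).bary σ /
        ∑ τ ∈ F.powerset.subtype (· ∈ K.faces), levelGap F (g z).bary τ) ∧
      ∀ z σ, (g' z).bary σ ≠ 0 → σ.1 ⊆ (g z).bary.support ∧
        ∀ v ∈ σ.1, ∀ w ∉ σ.1, (g z).bary w < (g z).bary v := by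
  let S : Finset (FacePoset K) := F.powerset.subtype (· ∈ K.faces)
  have h0 : ∀ z σ, 0 ≤ levelGap (K := K) F (g z).bary σ := fun z σ => le_max_left _ _
  have hpos : ∀ z (σ : FacePoset K), levelGap F (g z).bary σ ≠ 0 ↔
      ∀ v ∈ σ.1, ∀ w ∈ F ∪ σ.1, (if w ∈ σ.1 then 0 else (g z).bary w) < (g z).bary v := by
    intro z σ
    rw [← (h0 z σ).lt_iff_ne', levelGap, lt_max_iff, Finset.lt_inf'_iff]
    simp only [lt_irrefl, false_or, Finset.mem_product, and_imp, Prod.forall, sub_pos]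
    exact ⟨fun h v hv w hw => h v w hv hw, fun h v w hv hw => h v hv w hw⟩
  have hlev : ∀ z (σ : FacePoset K), levelGap F (g z).bary σ ≠ 0 → σ.1 ⊆ (g z).bary.support ∧
        ∀ v ∈ σ.1, ∀ w ∉ σ.1, (g z).bary w < (g z).bary v := by
    intro z σ h
    rw [hpos] at h
    have h1 : ∀ v ∈ σ.1, 0 < (g z).bary v := fun v hv => by
      simpa [hv] using h v hv v (Finset.mem_union_right _ hv)
    refine ⟨fun v hv => ((g z).pos_iff v).1 (h1 v hv), fun v hv w hw => ?_⟩
    by_cases hwF : w ∈ F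
    · simpa [hw] using h v hv w (Finset.mem_union_left _ hwF)
    · rw [Finsupp.notMem_support_iff.1 fun h' => hwF (hF z h')]
      exact h1 v hv
  have hS : ∀ z σ, σ ∉ S → levelGap F (g z).bary σ = 0 := fun z σ hσ => by
    by_contra h
    exact hσ (Finset.mem_subtype.2 (Finset.mem_powerset.2 ((hlev z σ h).1.trans (hF z))))
  have hsum : ∀ z, 0 < ∑ τ ∈ S, levelGap F (g z).bary τ := fun z => by
    let σ : FacePoset K := ⟨_, (g z).support_mem⟩
    refine Finset.sum_pos' (fun τ _ => h0 z τ) ⟨σ, ?_, (h0 z σ).lt_of_ne' ?_⟩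
    · exact Finset.mem_subtype.2 (Finset.mem_powerset.2 (hF z))
    · rw [hpos]
      intro v hv w _
      have hv' : 0 < (g z).bary v := ((g z).pos_iff v).2 hv
      split_ifs with hw
      · exact hv'
      · rwa [Finsupp.notMem_support_iff.1 hw]
  have hc : ∀ σ, Continuous fun z => levelGap (K := K) F (g z).bary σ := fun σ => by
    refine continuous_const.max (Continuous.finset_inf'_apply _ fun p _ => ?_)
    have hi : ∀ i, Continuous fun z => (g z).bary i := fun i =>
      (Realization.continuous_coord i).comp g.continuous
    split_ifs
    · exact (hi _).sub continuous_const
    · exact (hi _).sub (hi _)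
  obtain ⟨g', hg'⟩ := exists_map (orderComplex (FacePoset K)) S
    (fun z σ => levelGap F (g z).bary σ / ∑ τ ∈ S, levelGap F (g z).bary τ)
    (fun z σ => div_nonneg (h0 z σ) (hsum z).le)
    (fun z => by rw [← Finset.sum_div, div_self (hsum z).ne'])
    (fun z σ hσ => by rw [hS z σ hσ, zero_div])
    (fun z => by
      refine ⟨S.filter (levelGap F (g z).bary · ≠ 0), ⟨?_, ?_⟩, fun σ hσ => ?_⟩
      · obtain ⟨σ, hσ, h⟩ := Finset.exists_ne_zero_of_sum_ne_zero (hsum z).ne'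
        exact ⟨σ, Finset.mem_filter.2 ⟨hσ, h⟩⟩
      · intro σ hσ τ hτ _
        have h1 := (hlev z σ (Finset.mem_filter.1 hσ).2).2
        have h2 := (hlev z τ (Finset.mem_filter.1 hτ).2).2
        by_contra hcon
        obtain ⟨h3, h4⟩ := not_or.1 hcon
        obtain ⟨v, hv, hv'⟩ := Finset.not_subset.1 h3
        obtain ⟨w, hw, hw'⟩ := Finset.not_subset.1 h4
        exact lt_asymm (h1 v hv w hw') (h2 w hw v hv')
      · have h := left_ne_zero_of_mul hσ
        exact Finset.mem_filter.2 ⟨by_contra fun h' => h (hS z σ h'), h⟩)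
    (fun σ => (hc σ).div (continuous_finsetSum _ fun τ _ => hc τ) fun z => (hsum z).ne')
  refine ⟨g', hg', fun z σ h => hlev z σ ?_⟩
  rw [hg'] at h
  exact left_ne_zero_of_mul h

/-- The realization of the simplex poset of `K` is as connected as that of `K`. -/
theorem IsConn.facePoset {k : ℤ} (hK : IsConn k (Realization K)) :
    IsConn k (Realization (orderComplex (FacePoset K))) := by
  classical
  intro d hd a
  obtain ⟨F, hF⟩ := exists_finset_support_subset a
  let W : Finset ι := F.biUnion fun σ => σ.1
  have hcard : ∀ σ : FacePoset K, (0 : ℝ) < σ.1.card := fun σ =>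
    Nat.cast_pos.2 (Finset.card_pos.2 (K.isRelLowerSet_faces σ.2).1)
  -- the map that sends a simplex to its barycenter
  let c : Sphere d → ι → ℝ := fun z v =>
    ∑ σ ∈ F, (a z).bary σ * ((if v ∈ σ.1 then 1 else 0) / σ.1.card)
  have hterm : ∀ z v (σ : FacePoset K),
      0 ≤ (a z).bary σ * ((if v ∈ σ.1 then (1 : ℝ) else 0) / σ.1.card) := fun z v σ =>
    mul_nonneg ((a z).nonneg σ) (div_nonneg (by split_ifs <;> simp) (hcard σ).le)
  have hc : ∀ z v, c z v ≠ 0 → ∃ σ ∈ (a z).bary.support, v ∈ σ.1 := fun z v h => by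
    obtain ⟨σ, -, h⟩ := Finset.exists_ne_zero_of_sum_ne_zero h
    refine ⟨σ, Finsupp.mem_support_iff.2 (left_ne_zero_of_mul h), ?_⟩
    by_contra hv
    simp [hv] at h
  obtain ⟨g, hg⟩ := exists_map K W c (fun z v => Finset.sum_nonneg fun σ _ => hterm z v σ)
    (fun z => by
      refine Finset.sum_comm.trans (Eq.trans ?_ ((a z).sum_eq_one (hF z)))
      refine Finset.sum_congr rfl fun σ hσ => ?_
      rw [← Finset.mul_sum, ← Finset.sum_div, Finset.sum_ite_mem, Finset.inter_eq_right.2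
        (Finset.subset_biUnion_of_mem (fun σ : FacePoset K => σ.1) hσ), Finset.sum_const,
        nsmul_eq_mul, mul_one, div_self (hcard σ).ne', mul_one])
    (fun z v hv => by
      by_contra h
      obtain ⟨σ, hσ, hv'⟩ := hc z v h
      exact hv (Finset.mem_biUnion.2 ⟨σ, hF z hσ, hv'⟩))
    (fun z => by
      obtain ⟨h1, h2⟩ := (a z).support_mem
      obtain ⟨τ, hτ, hmax⟩ := (a z).bary.support.exists_maximal h1
      refine ⟨τ.1, τ.2, fun v hv => ?_⟩
      obtain ⟨σ, hσ, hv'⟩ := hc z v hv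
      rcases h2.total hσ hτ with h | h
      · exact h hv'
      · exact hmax hσ h hv')
    (fun v => continuous_finsetSum _ fun σ _ =>
      ((Realization.continuous_coord σ).comp a.continuous).mul continuous_const)
  obtain ⟨b, hb⟩ := hK d hd g
  obtain ⟨G, hG⟩ := exists_finset_support_subset b
  obtain ⟨b', hb', -⟩ := exists_levelSet_map G b hG
  obtain ⟨a', ha', hlev⟩ := exists_levelSet_map G g fun z => hb z ▸ hG _
  refine exists_extension_of_homotopic (a' := a') ?_ b' fun s => Realization.ext fun σ => by
    rw [hb', ha', hb]
  refine (homotopicRel_of_common_face (S := ∅) a a' (fun z => ?_) (by simp)).homotopic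
  refine ⟨(a z).bary.support ∪ (a' z).bary.support, ⟨?_, ?_⟩, Finset.subset_union_left,
    Finset.subset_union_right⟩
  · exact (a z).support_mem.1.mono Finset.subset_union_left
  · -- a superlevel set of `g z` is comparable with all simplices in the chain of `a z`
    have key : ∀ σ ∈ (a z).bary.support, ∀ τ ∈ (a' z).bary.support, σ ≤ τ ∨ τ ≤ σ := by
      intro σ hσ τ hτ
      by_contra hcon
      obtain ⟨h3, h4⟩ := not_or.1 hcon
      obtain ⟨w, hw, hw'⟩ := Finset.not_subset.1 h3
      obtain ⟨v, hv, hv'⟩ := Finset.not_subset.1 h4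
      have h := (hlev z τ (Finsupp.mem_support_iff.1 hτ)).2 v hv w hw'
      rw [hg, hg] at h
      refine absurd h (not_lt.2 (Finset.sum_le_sum fun ρ _ => ?_))
      by_cases hρ : ρ ∈ (a z).bary.support
      · by_cases hvρ : v ∈ ρ.1
        · have hwρ : w ∈ ρ.1 := by
            rcases (a z).support_mem.2.total hσ hρ with h | h
            · exact h hw
            · exact absurd (h hvρ) hv'
          rw [if_pos hvρ, if_pos hwρ]
        · rw [if_neg hvρ, zero_div, mul_zero]
          exact hterm z w ρ
      · rw [Finsupp.notMem_support_iff.1 hρ, zero_mul, zero_mul]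
    intro σ hσ τ hτ hne
    rw [Finset.coe_union] at hσ hτ
    rcases hσ with hσ | hσ <;> rcases hτ with hτ | hτ
    · exact (a z).support_mem.2 hσ hτ hne
    · exact key σ hσ τ hτ
    · exact (key τ hτ σ hσ).symm
    · exact (a' z).support_mem.2 hσ hτ hne

/-- The `k`-skeleton of a `(k - 1)`-connected complex is `(k - 1)`-connected. -/
theorem IsConn.skeleton {k : ℤ} (hK : IsConn (k - 1) (Realization K)) :
    IsConn (k - 1) (Realization (skeleton K k)) := by
  intro d hd a
  have hsub : (TitsSpan.skeleton K k).faces ⊆ K.faces := fun s hs => hs.1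
  obtain ⟨c, hc⟩ := hK d hd ((inclMap hsub).comp a)
  obtain ⟨g', h1, h2⟩ := exists_homotopic_cellular (smallDim_disk d) (TitsSpan.skeleton K k)
    (fun s hs hs' => ⟨hs, by omega⟩) c
  obtain ⟨c', hc'⟩ := exists_lift_incl _ g' fun z => (h2 z).1
  refine ⟨c', fun s => Realization.ext fun i => ?_⟩
  have hs : bdry s ∈ {z | (c z).bary.support ∈ (TitsSpan.skeleton K k).faces} := by
    rw [Set.mem_ofPred_eq, hc, ContinuousMap.comp_apply, support_inclMap]
    exact (a s).support_mem
  rw [hc', ← eq_of_homotopicRel h1 hs, hc, ContinuousMap.comp_apply, inclMap_apply]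

end Subdivision

/-! ### Ranks and summands in the lattice of submodules -/

section Summands

variable {R : Type u} [Ring R] {M : Type u} [AddCommGroup M] [Module R M]

/-- The finite set `b` is a basis of the submodule `C`. -/
def IsBasisOf (R : Type u) [Ring R] {M : Type u} [AddCommGroup M] [Module R M] (b : Finset M)
    (C : Submodule R M) : Prop :=
  LinearIndepOn R id (b : Set M) ∧ Submodule.span R (b : Set M) = C

/-- The submodule `C` is free on `k` generators. -/
def HasRank (C : Submodule R M) (k : ℕ) : Prop := ∃ b, IsBasisOf R b C ∧ b.card = k

/-- `V` is a direct summand of the submodule `C`. -/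
def IsSummand (V C : Submodule R M) : Prop := ∃ W, Disjoint V W ∧ V ⊔ W = C

theorem IsSummand.le {V C : Submodule R M} (h : IsSummand V C) : V ≤ C := by
  obtain ⟨W, -, rfl⟩ := h
  exact le_sup_left

theorem IsSummand.of_le {V U C : Submodule R M} (h : IsSummand V C) (hV : V ≤ U) (hU : U ≤ C) :
    IsSummand V U := by
  obtain ⟨W, h1, rfl⟩ := h
  refine ⟨W ⊓ U, h1.mono_right inf_le_left, ?_⟩
  rw [← sup_inf_assoc_of_le W hV, inf_eq_right.2 hU]

theorem IsSummand.trans {V U C : Submodule R M} (h : IsSummand V U) (h' : IsSummand U C) :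
    IsSummand V C := by
  obtain ⟨W, h1, rfl⟩ := h
  obtain ⟨W', h2, rfl⟩ := h'
  exact ⟨W ⊔ W', h1.disjoint_sup_right_of_disjoint_sup_left h2, (sup_assoc _ _ _).symm⟩

/-- The linear equivalence between a product of independent submodules and their sum. -/
noncomputable def prodEquivSup {V W : Submodule R M} (h : Disjoint V W) :
    (V × W) ≃ₗ[R] (V ⊔ W : Submodule R M) :=
  (LinearEquiv.ofInjective (LinearMap.coprod V.subtype W.subtype) (by
    rw [← LinearMap.ker_eq_bot, LinearMap.ker_eq_bot']
    rintro ⟨v, w⟩ hvw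
    have h1 : (v : M) + w = 0 := hvw
    have h2 : (v : M) = 0 := Submodule.disjoint_def.1 h v v.2 (by
      rw [eq_neg_of_add_eq_zero_left h1]
      exact W.neg_mem w.2)
    rw [h2, zero_add] at h1
    exact Prod.ext (Subtype.ext h2) (Subtype.ext h1))).trans
    (LinearEquiv.ofEq _ _ (by
      rw [LinearMap.range_coprod, Submodule.range_subtype, Submodule.range_subtype]))

theorem IsBasisOf.free {b : Finset M} {C : Submodule R M} (h : IsBasisOf R b C) :
    Module.Free R C := by
  obtain ⟨h1, rfl⟩ := h
  have h2 : LinearIndependent R (fun x : ((b : Set M) : Type u) => (x : M)) := h1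
  have h3 := Module.Free.of_basis (Module.Basis.span h2)
  rwa [Subtype.range_coe] at h3

theorem IsBasisOf.finite {b : Finset M} {C : Submodule R M} (h : IsBasisOf R b C) :
    Module.Finite R C := by
  rw [Module.Finite.iff_fg]
  exact ⟨b, h.2⟩

theorem IsBasisOf.mono {b c : Finset M} {C : Submodule R M} (h : IsBasisOf R b C) (hc : c ⊆ b) :
    IsBasisOf R c (Submodule.span R (c : Set M)) :=
  ⟨h.1.mono (Finset.coe_subset.2 hc), rfl⟩

/-- The span of a part of a basis is a summand, complemented by the span of the remaining part. -/
theorem IsBasisOf.isSummand_span [DecidableEq M] {b c : Finset M} {C : Submodule R M}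
    (h : IsBasisOf R b C) (hc : c ⊆ b) :
    Disjoint (Submodule.span R (c : Set M)) (Submodule.span R ((b \ c : Finset M) : Set M)) ∧
      Submodule.span R (c : Set M) ⊔ Submodule.span R ((b \ c : Finset M) : Set M) = C := by
  constructor
  · have h := LinearIndependent.disjoint_span_image (v := fun x : (b : Set M) => (x : M)) (R := R)
      h.1 (s := Subtype.val ⁻¹' (c : Set M)) (t := Subtype.val ⁻¹' ((b \ c : Finset M) : Set M))
      (by
        rw [Set.disjoint_left]
        intro x hx hx'
        exact (Finset.mem_sdiff.1 (Finset.mem_coe.1 hx')).2 hx)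
    rwa [Subtype.image_preimage_coe, Subtype.image_preimage_coe,
      Set.inter_eq_right.2 (Finset.coe_subset.2 hc),
      Set.inter_eq_right.2 (Finset.coe_subset.2 Finset.sdiff_subset)] at h
  · rw [← Submodule.span_union, ← Finset.coe_union, Finset.union_sdiff_of_subset hc, h.2]

theorem IsBasisOf.union [DecidableEq M] {b c : Finset M} {V W : Submodule R M}
    (hb : IsBasisOf R b V) (hc : IsBasisOf R c W) (h : Disjoint V W) :
    IsBasisOf R (b ∪ c) (V ⊔ W) := by
  constructor
  · rw [Finset.coe_union]
    exact hb.1.id_union hc.1 (by rwa [hb.2, hc.2])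
  · rw [Finset.coe_union, Submodule.span_union, hb.2, hc.2]

theorem IsBasisOf.disjoint [Nontrivial R] {b c : Finset M} {V W : Submodule R M}
    (hb : IsBasisOf R b V) (hc : IsBasisOf R c W) (h : Disjoint V W) : Disjoint b c := by
  rw [Finset.disjoint_left]
  intro x hx hx'
  have h0 : x = 0 := Submodule.disjoint_def.1 h x (hb.2 ▸ Submodule.subset_span hx)
    (hc.2 ▸ Submodule.subset_span hx')
  exact LinearIndependent.ne_zero (⟨x, hx⟩ : (b : Set M)) hb.1 h0

/-- A basis of a submodule, as an indexed basis. -/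
noncomputable def IsBasisOf.basis {b : Finset M} {C : Submodule R M} (h : IsBasisOf R b C) :
    Module.Basis b R C :=
  (Module.Basis.span (v := fun x : b => (x : M)) h.1).map (LinearEquiv.ofEq _ _ (by
    rw [← h.2]
    congr 1
    exact Subtype.range_coe))

theorem exists_isBasisOf [Nontrivial R] (C : Submodule R M) [Module.Free R C] [Module.Finite R C] :
    ∃ b, IsBasisOf R b C := by
  classical
  let β := Module.Free.chooseBasis R C
  have hli : LinearIndependent R fun i => (β i : M) :=
    β.linearIndependent.map' C.subtype (Submodule.ker_subtype C)
  refine ⟨Finset.univ.image fun i => (β i : M), ?_, ?_⟩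
  · rw [Finset.coe_image, Finset.coe_univ, Set.image_univ]
    exact hli.linearIndepOn_id
  · rw [Finset.coe_image, Finset.coe_univ, Set.image_univ]
    have h := congrArg (Submodule.map C.subtype) β.span_eq
    rw [Submodule.map_span, ← Set.range_comp, Submodule.map_top, Submodule.range_subtype] at h
    exact h

theorem HasRank.free {V : Submodule R M} {k : ℕ} (hV : HasRank V k) : Module.Free R V :=
  let ⟨_, hb, _⟩ := hV
  hb.free

theorem hasRank_zero_iff {V : Submodule R M} : HasRank V 0 ↔ V = ⊥ := by
  constructor
  · rintro ⟨b, hb, h⟩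
    rw [Finset.card_eq_zero] at h
    rw [← hb.2, h, Finset.coe_empty, Submodule.span_empty]
  · rintro rfl
    exact ⟨∅, ⟨by simp, by simp⟩, rfl⟩

theorem HasRank.pos {V : Submodule R M} {k : ℕ} (hV : HasRank V k) (h : V ≠ ⊥) : 0 < k := by
  rcases Nat.eq_zero_or_pos k with rfl | h'
  · exact absurd (hasRank_zero_iff.1 hV) h
  · exact h'

variable [InvariantBasisNumber R]

theorem IsBasisOf.card_eq {b c : Finset M} {C : Submodule R M} (hb : IsBasisOf R b C)
    (hc : IsBasisOf R c C) : b.card = c.card := by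
  simpa using Fintype.card_congr (hb.basis.indexEquiv hc.basis)

theorem HasRank.unique {C : Submodule R M} {k l : ℕ} (hk : HasRank C k) (hl : HasRank C l) :
    k = l := by
  obtain ⟨b, hb, rfl⟩ := hk
  obtain ⟨c, hc, rfl⟩ := hl
  exact hb.card_eq hc

theorem HasRank.sup {V W : Submodule R M} {k l : ℕ} (hV : HasRank V k) (hW : HasRank W l)
    (h : Disjoint V W) : HasRank (V ⊔ W) (k + l) := by
  classical
  have := nontrivial_of_invariantBasisNumber R
  obtain ⟨b, hb, rfl⟩ := hV
  obtain ⟨c, hc, rfl⟩ := hW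
  exact ⟨b ∪ c, hb.union hc h, Finset.card_union_of_disjoint (hb.disjoint hc h)⟩

theorem HasRank.ne_bot {V : Submodule R M} {k : ℕ} (hV : HasRank V k) (h : 0 < k) : V ≠ ⊥ :=
  fun h0 => h.ne' (hV.unique (hasRank_zero_iff.2 h0))

/-- Over a ring whose stably free modules are free, a complement of a free summand in a free module
is free of the complementary rank. -/
theorem HasRank.of_sup (hR : IsHermite R) {V W C : Submodule R M} {r c : ℕ} (hV : HasRank V r)
    (hC : HasRank C c) (h : Disjoint V W) (hVW : V ⊔ W = C) : ∃ s, HasRank W s ∧ r + s = c := by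
  have := nontrivial_of_invariantBasisNumber R
  subst hVW
  have hVf := hV.free
  obtain ⟨b, hb, hbr⟩ := hV
  obtain ⟨e, he, -⟩ := id hC
  have := hb.finite
  have hef := he.free
  have hefin := he.finite
  have := Module.Free.of_equiv (prodEquivSup h).symm
  have hWf : Module.Free R W := hR W (Module.IsStablyFree.of_free_prod' R W V)
  have hWfin : Module.Finite R W := Module.Finite.of_surjective
    (LinearMap.snd R V W ∘ₗ (prodEquivSup h).symm.toLinearMap)
    ((LinearMap.snd_surjective (R := R) (M := V) (M₂ := W)).comp (prodEquivSup h).symm.surjective)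
  obtain ⟨w, hw⟩ := exists_isBasisOf W
  exact ⟨w.card, ⟨w, hw, rfl⟩, (HasRank.sup ⟨b, hb, hbr⟩ ⟨w, hw, rfl⟩ h).unique hC⟩

theorem exists_hasRank {V C : Submodule R M} {c : ℕ} (hV : Module.Free R V)
    (hC : HasRank C c) (h : IsSummand V C) : ∃ r, HasRank V r := by
  have := nontrivial_of_invariantBasisNumber R
  obtain ⟨W, h, rfl⟩ := h
  obtain ⟨e, he, -⟩ := hC
  have := he.finite
  have : Module.Finite R V := Module.Finite.of_surjective
    (LinearMap.fst R V W ∘ₗ (prodEquivSup h).symm.toLinearMap)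
    ((LinearMap.fst_surjective (R := R) (M := V) (M₂ := W)).comp (prodEquivSup h).symm.surjective)
  obtain ⟨b, hb⟩ := exists_isBasisOf V
  exact ⟨_, b, hb, rfl⟩

theorem IsSummand.rank_lt (hR : IsHermite R) {V C : Submodule R M} {r c : ℕ} (h : IsSummand V C)
    (hV : HasRank V r) (hC : HasRank C c) (hne : V ≠ C) : r < c := by
  obtain ⟨W, h1, h2⟩ := h
  obtain ⟨s, hs, rfl⟩ := hV.of_sup hR hC h1 h2
  have : 0 < s := hs.pos fun h0 => hne (by rw [← h2, h0, sup_bot_eq])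
  omega

/-- The partial bases of a free summand `V` of `C` are the partial bases of `C` that lie in `V`. -/
theorem exists_isBasisOf_superset_iff (hR : IsHermite R) {V C : Submodule R M} {r c : ℕ}
    (hV : HasRank V r) (hC : HasRank C c) (h : IsSummand V C) {σ : Finset M} :
    (∃ b, σ ⊆ b ∧ IsBasisOf R b V) ↔
      (∃ b, σ ⊆ b ∧ IsBasisOf R b C) ∧ Submodule.span R (σ : Set M) ≤ V := by
  classical
  constructor
  · rintro ⟨b, hσ, hb⟩
    refine ⟨?_, hb.2 ▸ Submodule.span_mono (Finset.coe_subset.2 hσ)⟩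
    obtain ⟨W, h1, h2⟩ := h
    obtain ⟨s, ⟨w, hw, -⟩, -⟩ := hV.of_sup hR hC h1 h2
    exact ⟨b ∪ w, hσ.trans Finset.subset_union_left, h2 ▸ hb.union hw h1⟩
  · rintro ⟨⟨b, hσ, hb⟩, hle⟩
    obtain ⟨W, h1, h2⟩ := IsSummand.of_le ⟨_, hb.isSummand_span hσ⟩ hle h.le
    obtain ⟨s, ⟨w, hw, -⟩, -⟩ := HasRank.of_sup hR ⟨σ, hb.mono hσ, rfl⟩ hV h1 h2
    exact ⟨σ ∪ w, Finset.subset_union_left, h2 ▸ (hb.mono hσ).union hw h1⟩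

end Summands

/-! ### Complexes of partial bases of submodules -/

section PartialBases

theorem isConn_congr {ι : Type*} {k : ℤ} {K L : PreAbstractSimplicialComplex ι}
    (h : ∀ s, s ∈ K.faces ↔ s ∈ L.faces) (hL : IsConn k (Realization L)) :
    IsConn k (Realization K) :=
  IsConn.of_injective Function.injective_id (fun t ht => ⟨t, (h t).2 ht, fun _ hj => hj⟩)
    (fun s hs => ⟨s, (h s).1 hs, fun i hi => ⟨i, hi, rfl⟩⟩) hL

theorem mem_link_empty {ι : Type*} {K : PreAbstractSimplicialComplex ι} {s : Finset ι} :
    s ∈ (link K ∅).faces ↔ s ∈ K.faces := by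
  simp only [link, Finset.disjoint_empty_right, Finset.union_empty]
  exact ⟨fun h => h.2.2, fun h => ⟨(K.isRelLowerSet_faces h).1, trivial, h⟩⟩

/-- The simplices of a Cohen--Macaulay complex, including the empty one, have highly connected
links. -/
theorem IsCohenMacaulay.isConn_link {ι : Type*} {K : PreAbstractSimplicialComplex ι}
    (hK : IsCohenMacaulay K) {d : ℤ} (hd : HasDim K d) {σ : Finset ι} (hσ : σ = ∅ ∨ σ ∈ K.faces) :
    IsConn (d - σ.card - 1) (Realization (link K σ)) := by
  obtain ⟨d', ⟨h1, h2⟩, h3⟩ := hK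
  obtain rfl := hd.unique h1
  rcases hσ with rfl | hσ
  · exact isConn_congr (fun s => mem_link_empty) (h2.mono (by simp))
  · have hpos := Finset.card_pos.2 (K.isRelLowerSet_faces hσ).1
    exact (h3 (σ.card - 1) σ hσ (by omega)).2.mono (by omega)

variable {R : Type u} [Ring R] {M : Type u} [AddCommGroup M] [Module R M]

/-- The complex of partial bases of a submodule `C`. Its vertices are elements of the ambient
module, so that complexes of different submodules can be compared. -/
def basisComplex (C : Submodule R M) : PreAbstractSimplicialComplex M where
  faces := {σ | σ.Nonempty ∧ ∃ b, σ ⊆ b ∧ IsBasisOf R b C}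
  isRelLowerSet_faces := by
    rintro s ⟨h0, b, h1, hb⟩
    exact ⟨h0, fun t ht hne => ⟨hne, b, ht.trans h1, hb⟩⟩

theorem mem_partialBases_iff [Nontrivial R] [Module.Finite R M] {σ : Finset M} :
    σ ∈ (partialBases R M).faces ↔ σ ∈ (basisComplex (⊤ : Submodule R M)).faces := by
  constructor
  · rintro ⟨h, b, hb, hσ⟩
    have : Finite b := Module.Finite.finite_basis
      (Module.Basis.mk (v := fun x : b => (x : M)) hb.1 (by rw [Subtype.range_coe, hb.2]))
    have hbf : b.Finite := this
    refine ⟨h, hbf.toFinset, fun x hx => hbf.mem_toFinset.2 (hσ hx), ?_⟩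
    unfold IsBasisOf
    rw [hbf.coe_toFinset]
    exact hb
  · rintro ⟨h, b, hσ, hb⟩
    exact ⟨h, b, hb, Finset.coe_subset.2 hσ⟩

theorem IsBasisOf.map {M' : Type u} [AddCommGroup M'] [Module R M'] {b : Finset M}
    {C : Submodule R M} (hb : IsBasisOf R b C) (f : M →ₗ[R] M') (hf : Function.Injective f) :
    IsBasisOf R (b.map ⟨f, hf⟩) (C.map f) := by
  constructor
  · rw [Finset.coe_map]
    exact (hb.1.map_injOn f hf.injOn).id_image
  · rw [Finset.coe_map]
    exact (Submodule.map_span f _).symm.trans (by rw [hb.2])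

theorem IsBasisOf.of_map {M' : Type u} [AddCommGroup M'] [Module R M'] {b : Finset M}
    {C : Submodule R M} (f : M →ₗ[R] M') (hf : Function.Injective f)
    (hb : IsBasisOf R (b.map ⟨f, hf⟩) (C.map f)) : IsBasisOf R b C := by
  obtain ⟨h1, h2⟩ := hb
  rw [Finset.coe_map] at h1 h2
  refine ⟨LinearIndepOn.of_comp f ((linearIndepOn_iff_image hf.injOn).2 h1), ?_⟩
  exact Submodule.map_injective_of_injective hf ((Submodule.map_span f _).trans h2)

theorem mem_link {ι : Type*} [DecidableEq ι] {K : PreAbstractSimplicialComplex ι}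
    {s σ : Finset ι} :
    s ∈ (link K σ).faces ↔ s.Nonempty ∧ Disjoint s σ ∧ s ∪ σ ∈ K.faces := by
  simp only [link]
  change (_ ∧ _ ∧ _) ↔ _
  convert Iff.rfl

variable [InvariantBasisNumber R]

theorem hasRank_top_pi (k : ℕ) : HasRank (⊤ : Submodule R (Fin k → R)) k := by
  have := nontrivial_of_invariantBasisNumber R
  refine ⟨Finset.univ.map ⟨Pi.basisFun R (Fin k), (Pi.basisFun R (Fin k)).injective⟩, ⟨?_, ?_⟩,
    by simp⟩
  · rw [Finset.coe_map, Finset.coe_univ, Set.image_univ]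
    exact (Pi.basisFun R (Fin k)).linearIndependent.linearIndepOn_id
  · rw [Finset.coe_map, Finset.coe_univ, Set.image_univ]
    exact (Pi.basisFun R (Fin k)).span_eq

theorem hasDim_B (k : ℕ) : HasDim (B R k) ((k : ℤ) - 1) := by
  have := nontrivial_of_invariantBasisNumber R
  obtain ⟨b, hb, hk⟩ := hasRank_top_pi (R := R) k
  refine ⟨?_, ?_⟩
  · rcases Nat.eq_zero_or_pos k with rfl | h
    · exact Or.inl rfl
    · refine Or.inr ⟨b, mem_partialBases_iff.2 ⟨?_, b, subset_rfl, hb⟩, ?_⟩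
      · rw [← Finset.card_pos]
        omega
      · simp only
        rw [hk]
  · rintro _ (rfl | ⟨s, hs, rfl⟩)
    · omega
    · obtain ⟨-, c, hsc, hc⟩ := mem_partialBases_iff.1 hs
      have := Finset.card_le_card hsc
      have := hb.card_eq hc
      simp only
      omega

/-- The complex of partial bases of a free submodule of rank `c` is isomorphic to `B_c(R)`, hence
its links are highly connected. -/
theorem isConn_link_basisComplex (hCM : ∀ k : ℕ, IsCohenMacaulay (B R k)) {C : Submodule R M}
    {c : ℕ} (hC : HasRank C c) {ν : Finset M} (hν : ∃ b, ν ⊆ b ∧ IsBasisOf R b C) :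
    IsConn ((c : ℤ) - ν.card - 2) (Realization (link (basisComplex C) ν)) := by
  classical
  have := nontrivial_of_invariantBasisNumber R
  obtain ⟨b, hb, hcard⟩ := hC
  let e := (hb.basis.reindex (b.equivFinOfCardEq hcard)).equivFun
  let f : (Fin c → R) →ₗ[R] M := C.subtype ∘ₗ e.symm.toLinearMap
  have hf : Function.Injective f := Subtype.val_injective.comp e.symm.injective
  have hfC : Submodule.map f ⊤ = C := by
    rw [Submodule.map_comp, Submodule.map_top, LinearEquiv.range, Submodule.map_top,
      Submodule.range_subtype]
  -- all partial bases of `C` come from `R ^ c`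
  have hpre : ∀ s : Finset M, (∃ b, s ⊆ b ∧ IsBasisOf R b C) → ∃ t : Finset (Fin c → R),
      s = t.map ⟨f, hf⟩ := by
    rintro s ⟨b', hs, hb'⟩
    refine ⟨s.preimage f hf.injOn, Finset.ext fun x => ?_⟩
    rw [Finset.mem_map]
    constructor
    · intro hx
      have hxC : x ∈ Submodule.map f ⊤ := by
        rw [hfC, ← hb'.2]
        exact Submodule.subset_span (hs hx)
      obtain ⟨y, -, rfl⟩ := hxC
      exact ⟨y, Finset.mem_preimage.2 hx, rfl⟩
    · rintro ⟨y, hy, rfl⟩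
      exact Finset.mem_preimage.1 hy
  have hiff : ∀ t : Finset (Fin c → R), t ∈ (B R c).faces ↔
      t.map ⟨f, hf⟩ ∈ (basisComplex C).faces := by
    intro t
    rw [mem_partialBases_iff]
    constructor
    · rintro ⟨h, b', ht, hb'⟩
      refine ⟨by simpa using h, b'.map ⟨f, hf⟩, Finset.map_subset_map.2 ht, ?_⟩
      rw [← hfC]
      exact hb'.map f hf
    · rintro ⟨h, b', ht, hb'⟩
      obtain ⟨t', rfl⟩ := hpre b' ⟨b', subset_rfl, hb'⟩
      refine ⟨by simpa using h, t', Finset.map_subset_map.1 ht, IsBasisOf.of_map f hf ?_⟩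
      rwa [hfC]
  obtain ⟨ν', rfl⟩ := hpre ν hν
  have h := (hCM c).isConn_link (hasDim_B c) (σ := ν') (by
    rcases ν'.eq_empty_or_nonempty with h | h
    · exact Or.inl h
    · exact Or.inr ((hiff ν').2 ⟨by simpa using h, hν⟩))
  rw [Finset.card_map]
  refine IsConn.of_injective (L := link (B R c) ν') hf (fun t ht => ⟨t.map ⟨f, hf⟩, ?_,
    fun j hj => Finset.mem_map_of_mem ⟨f, hf⟩ hj⟩) (fun s hs => ?_) (h.mono (by omega))
  · obtain ⟨h1, h2, h3⟩ := mem_link.1 ht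
    rw [mem_link, Finset.disjoint_map, ← Finset.map_union, ← hiff]
    exact ⟨by simpa using h1, h2, h3⟩
  · obtain ⟨h1, h2, h3, b', h4, h5⟩ := mem_link.1 hs
    obtain ⟨t, rfl⟩ := hpre s ⟨b', Finset.subset_union_left.trans h4, h5⟩
    refine ⟨t, ?_, fun i hi => ?_⟩
    · rw [Finset.disjoint_map] at h2
      rw [mem_link, hiff, Finset.map_union]
      exact ⟨by simpa using h1, h2, h3, b', h4, h5⟩
    · obtain ⟨j, hj, rfl⟩ := Finset.mem_map.1 hi
      exact ⟨j, hj, rfl⟩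

end PartialBases

/-! ### Posets of summands of complements -/

section RelSummands

variable {R : Type u} [Ring R] {M : Type u} [AddCommGroup M] [Module R M]

/-- `V` is a nonzero free summand of a complement of `N` in `X`; if `p` holds, it is moreover
required to be a proper summand of it. The case `N = ⊥` with `p` is that of the Tits complex, and
the case without `p` is that of the relative Tits complex. -/
def IsRelSummand (N X : Submodule R M) (p : Prop) (V : Submodule R M) : Prop :=
  V ≠ ⊥ ∧ Module.Free R V ∧ (p → N ⊔ V ≠ X) ∧
    ∃ W, Disjoint N (V ⊔ W) ∧ Disjoint V W ∧ N ⊔ (V ⊔ W) = X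

variable {N X : Submodule R M} {p : Prop} {V : Submodule R M}

theorem IsRelSummand.isSummand (h : IsRelSummand N X p V) : IsSummand V X := by
  obtain ⟨-, -, -, W, h1, h2, rfl⟩ := h
  refine ⟨W ⊔ N, h2.disjoint_sup_right_of_disjoint_sup_left h1.symm, ?_⟩
  rw [← sup_assoc, sup_comm]

/-- Let `D` be a complement of `V` in a complement of `N`. Summands `U` of complements of `N` in
`N ⊔ D` give rise to summands `V ⊔ U` of complements of `N` in `X`, from which they are recovered by
intersecting with `N ⊔ D`. -/
theorem IsRelSummand.sup_complement {U D : Submodule R M} (h : IsRelSummand N X p V)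
    (hU : IsRelSummand N (N ⊔ D) p U)
    (h1 : Disjoint N (V ⊔ D)) (h2 : Disjoint V D) (h3 : N ⊔ (V ⊔ D) = X) :
    IsRelSummand N X p (V ⊔ U) ∧ V < V ⊔ U ∧ (V ⊔ U) ⊓ (N ⊔ D) = U := by
  have hVE : Disjoint V (N ⊔ D) := by
    rw [sup_comm]
    exact h2.disjoint_sup_right_of_disjoint_sup_left h1.symm
  have hX' : V ⊔ (N ⊔ D) = X := by rw [← h3, sup_left_comm]
  set E := N ⊔ D with hE
  have hUE := hU.isSummand.le
  obtain ⟨W, h4, h5, h6⟩ := hU.2.2.2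
  have hfree : Module.Free R (V ⊔ U : Submodule R M) := by
    have := h.2.1
    have := hU.2.1
    exact Module.Free.of_equiv (prodEquivSup (hVE.mono_right hUE))
  refine ⟨⟨fun h0 => h.1 (le_bot_iff.1 (h0 ▸ le_sup_left)), hfree, fun hp h0 => hU.2.2.1 hp ?_, W,
    ?_, ?_, ?_⟩, lt_of_le_of_ne le_sup_left fun h0 => hU.1 ?_, ?_⟩
  · have h7 : (N ⊔ U ⊔ V) ⊓ E = E := by
      rw [sup_assoc, sup_comm U, h0, ← hX']
      exact inf_eq_right.2 le_sup_right
    rwa [sup_inf_assoc_of_le _ (sup_le le_sup_left hUE), hVE.eq_bot, sup_bot_eq] at h7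
  · rw [sup_assoc, sup_comm V]
    refine h4.disjoint_sup_right_of_disjoint_sup_left ?_
    rw [h6]
    exact hVE.symm
  · exact Disjoint.disjoint_sup_left_of_disjoint_sup_right h5 (hVE.mono_right (h6 ▸ le_sup_right))
  · rw [sup_assoc, sup_left_comm, h6, hX']
  · have h7 : U ≤ V := h0 ▸ le_sup_right
    exact le_bot_iff.1 (hVE h7 hUE)
  · rw [sup_comm, sup_inf_assoc_of_le _ hUE, hVE.eq_bot, sup_bot_eq]

variable [InvariantBasisNumber R]

theorem IsRelSummand.exists_ranks (hR : IsHermite R) {ν : Finset M} {n : ℕ} (hν : IsBasisOf R ν N)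
    (hX : HasRank X (ν.card + n)) (h : IsRelSummand N X p V) {D : Submodule R M}
    (h1 : Disjoint N (V ⊔ D)) (h2 : Disjoint V D) (h3 : N ⊔ (V ⊔ D) = X) :
    ∃ r s, HasRank V r ∧ HasRank D s ∧ r + s = n ∧ 0 < r ∧ (p → 0 < s) := by
  obtain ⟨n', hn', h4⟩ := HasRank.of_sup hR ⟨ν, hν, rfl⟩ hX h1 h3
  obtain rfl : n' = n := by omega
  obtain ⟨r, hr⟩ := exists_hasRank h.2.1 hn' ⟨D, h2, rfl⟩
  obtain ⟨s, hs, hrs⟩ := hr.of_sup hR hn' h2 rfl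
  refine ⟨r, s, hr, hs, hrs, hr.pos h.1, fun hp => hs.pos fun h0 => h.2.2.1 hp ?_⟩
  rw [h0, sup_bot_eq] at h3
  exact h3

/-- In the poset of summands of complements of `N`, the elements above `V` correspond to their
intersections with a fixed complement of `V` that contains `N`. -/
theorem IsRelSummand.inf_complement (hR : IsHermite R) {x : ℕ} (hX : HasRank X x)
    {U D : Submodule R M} (h : IsRelSummand N X p V) (hU : IsRelSummand N X p U) (hVU : V < U)
    (h1 : Disjoint N (V ⊔ D)) (h2 : Disjoint V D) (h3 : N ⊔ (V ⊔ D) = X) :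
    IsRelSummand N (N ⊔ D) p (U ⊓ (N ⊔ D)) ∧ V ⊔ U ⊓ (N ⊔ D) = U := by
  have hVE : Disjoint V (N ⊔ D) := by
    rw [sup_comm]
    exact h2.disjoint_sup_right_of_disjoint_sup_left h1.symm
  have hX' : V ⊔ (N ⊔ D) = X := by rw [← h3, sup_left_comm]
  set E := N ⊔ D with hE
  have hUX := hU.isSummand
  have hsup : V ⊔ U ⊓ E = U := by
    rw [inf_comm, ← sup_inf_assoc_of_le E hVU.le, hX', inf_eq_right.2 hUX.le]
  have hd : Disjoint V (U ⊓ E) := hVE.mono_right inf_le_right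
  obtain ⟨W, h4, h5, h6⟩ := hU.2.2.2
  have hUW : Disjoint (U ⊓ E) (V ⊔ W) := by
    refine hd.symm.disjoint_sup_right_of_disjoint_sup_left ?_
    rwa [sup_comm, hsup]
  have hre : U ⊓ E ⊔ (V ⊔ W) = U ⊔ W := by
    rw [← sup_assoc, sup_comm (U ⊓ E), hsup]
  have hNUW : Disjoint (N ⊔ U ⊓ E) (V ⊔ W) :=
    Disjoint.disjoint_sup_left_of_disjoint_sup_right hUW (by rwa [hre])
  have hsum : N ⊔ U ⊓ E ⊔ (V ⊔ W) ⊓ E = E := by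
    rw [← sup_inf_assoc_of_le _ (sup_le le_sup_left inf_le_right), sup_assoc, hre, h6, ← hX']
    exact inf_eq_right.2 le_sup_right
  refine ⟨⟨fun h0 => ?_, ?_, fun hp h0 => ?_, (V ⊔ W) ⊓ E, ?_, ?_, ?_⟩, hsup⟩
  · rw [h0, sup_bot_eq] at hsup
    exact hVU.ne hsup
  · obtain ⟨u, hu⟩ := exists_hasRank hU.2.1 hX hUX
    obtain ⟨r, hr⟩ := exists_hasRank h.2.1 hX h.isSummand
    obtain ⟨s, hs, -⟩ := hr.of_sup hR hu hd hsup
    exact hs.free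
  · refine hU.2.2.1 hp ?_
    rw [← hsup, sup_left_comm, h0, hX']
  · exact (h4.mono_right (inf_le_left.trans le_sup_left)).disjoint_sup_right_of_disjoint_sup_left
      (hNUW.mono_right inf_le_left)
  · exact hUW.mono_right inf_le_left
  · rw [← sup_assoc, hsum]

/-- The elements above `V` in the poset of summands of complements of `N` in `X` form a poset of the
same kind. -/
theorem exists_orderIso_above (hR : IsHermite R) {x : ℕ} (hX : HasRank X x)
    {pY : Submodule R M → Prop} (hY : ∀ V, pY V ↔ IsRelSummand N X p V) (V : {V // pY V})
    {D : Submodule R M} (h1 : Disjoint N (V.1 ⊔ D)) (h2 : Disjoint V.1 D)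
    (h3 : N ⊔ (V.1 ⊔ D) = X) :
    Nonempty ({U // IsRelSummand N (N ⊔ D) p U} ≃o {U : {U // pY U} // V < U}) := by
  have h := (hY _).1 V.2
  have hf := fun U : {U : {U // pY U} // V < U} =>
    h.inf_complement hR hX ((hY _).1 U.1.2) U.2 h1 h2 h3
  have hg := fun U : {U // IsRelSummand N (N ⊔ D) p U} => h.sup_complement U.2 h1 h2 h3
  refine ⟨{
    toFun := fun U => ⟨⟨V.1 ⊔ U.1, (hY _).2 (hg U).1⟩, (hg U).2.1⟩
    invFun := fun U => ⟨U.1.1 ⊓ (N ⊔ D), (hf U).1⟩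
    left_inv := fun U => Subtype.ext (hg U).2.2
    right_inv := fun U => Subtype.ext (Subtype.ext (hf U).2)
    map_rel_iff' := ?_ }⟩
  intro U U'
  constructor
  · intro hle
    have h4 : (V.1 ⊔ U.1) ⊓ (N ⊔ D) ≤ (V.1 ⊔ U'.1) ⊓ (N ⊔ D) := inf_le_inf_right _ hle
    rw [(hg U).2.2, (hg U').2.2] at h4
    exact h4
  · intro hle
    exact sup_le_sup_left (show U.1 ≤ U'.1 from hle) V.1

/-- The partial bases that extend the basis `ν` of `N` and lie in `V` are the partial bases of `V`.
The bound `δ` on the dimension matters only if `p` holds: it excludes exactly those partial bases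
whose span is not proper. -/
theorem mem_skeleton_link_and_span_le_iff (hR : IsHermite R) {ν : Finset M} {n : ℕ} {δ : ℤ}
    (hν : IsBasisOf R ν N) (hX : HasRank X (ν.card + n)) (hp : p → δ = n - 2)
    (hp' : ¬ p → δ = n - 1) (h : IsRelSummand N X p V) {σ : Finset M} :
    σ ∈ (skeleton (link (basisComplex X) ν) δ).faces ∧ Submodule.span R (σ : Set M) ≤ V ↔
      σ ∈ (basisComplex V).faces := by
  classical
  have := nontrivial_of_invariantBasisNumber R
  obtain ⟨W, h1, h2, h3⟩ := h.2.2.2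
  obtain ⟨r, s, hr, hs, hrs, -, hps⟩ := h.exists_ranks hR hν hX h1 h2 h3
  constructor
  · rintro ⟨⟨hσ, -⟩, hle⟩
    obtain ⟨h4, -, -, b, h5, h6⟩ := mem_link.1 hσ
    exact ⟨h4, (exists_isBasisOf_superset_iff hR hr hX h.isSummand).2
      ⟨⟨b, Finset.subset_union_left.trans h5, h6⟩, hle⟩⟩
  · rintro ⟨h4, b, hσ, hb⟩
    obtain ⟨w, hw, -⟩ := id hs
    have hbw := hb.union hw h2
    have hcard := Finset.card_le_card hσ
    rw [HasRank.unique ⟨b, hb, rfl⟩ hr] at hcard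
    refine ⟨⟨mem_link.2 ⟨h4, ?_, ?_, ν ∪ (b ∪ w), ?_, h3 ▸ hν.union hbw h1⟩, ?_⟩, ?_⟩
    · exact ((hν.disjoint hbw h1).mono_right (hσ.trans Finset.subset_union_left)).symm
    · exact h4.mono Finset.subset_union_left
    · exact Finset.union_subset ((hσ.trans Finset.subset_union_left).trans
        Finset.subset_union_right) Finset.subset_union_left
    · by_cases hpp : p
      · have := hps hpp
        have := hp hpp
        omega
      · have := hp' hpp
        omega
    · rw [← hb.2]
      exact Submodule.span_mono (Finset.coe_subset.2 hσ)

/-- The hypotheses of the fibre theorem for the span map `f` to the poset of summands of complements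
of `N` in `X`, with the height `t` given by the rank minus one: the fibre below `V` is the simplex
poset of the complex of partial bases of `V`, and the elements above `V` form a poset of the same
kind for a submodule of smaller rank, whose connectivity is the hypothesis `ih`. The predicate `pY`
and the complex `K` are kept variable such that `f` can be any of the span maps. -/
theorem exists_height_isConn_fibre (hR : IsHermite R) (hCM : ∀ k : ℕ, IsCohenMacaulay (B R k))
    {ν : Finset M} (hν : IsBasisOf R ν N) {n : ℕ} {δ : ℤ} (hX : HasRank X (ν.card + n))
    (hp : p → δ = n - 2) (hp' : ¬ p → δ = n - 1)
    (ih : ∀ E : Submodule R M, ∀ n' < n, ∀ δ' : ℤ, HasRank E (ν.card + n') → IsSummand N E →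
      (p → δ' = n' - 2) → (¬ p → δ' = n' - 1) →
        IsConn (δ' - 1) (Realization (orderComplex {V // IsRelSummand N E p V})))
    {pY : Submodule R M → Prop} (hY : ∀ V, pY V ↔ IsRelSummand N X p V)
    {K : PreAbstractSimplicialComplex M}
    (hK : ∀ σ, σ ∈ K.faces ↔ σ ∈ (skeleton (link (basisComplex X) ν) δ).faces)
    (f : FacePoset K →o {V // pY V}) (hf : ∀ σ, (f σ).1 = Submodule.span R (σ.1 : Set M)) :
    ∃ t : {V // pY V} → ℕ, StrictMono t ∧ (∀ V, t V < n) ∧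
      (∀ V, IsConn ((t V : ℤ) - 1) (Realization (orderComplex {σ : FacePoset K // f σ ≤ V}))) ∧
      ∀ V, IsConn (δ - t V - 2) (Realization (orderComplex {U : {V // pY V} // V < U})) := by
  have hex : ∀ V : {V // pY V}, ∃ (D : Submodule R M) (r s : ℕ), Disjoint N (V.1 ⊔ D) ∧
      Disjoint V.1 D ∧ N ⊔ (V.1 ⊔ D) = X ∧ HasRank V.1 r ∧ HasRank D s ∧ r + s = n ∧ 0 < r := by
    intro V
    have h := (hY _).1 V.2
    obtain ⟨D, h1, h2, h3⟩ := h.2.2.2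
    obtain ⟨r, s, hr, hs, hrs, h0, -⟩ := h.exists_ranks hR hν hX h1 h2 h3
    exact ⟨D, r, s, h1, h2, h3, hr, hs, hrs, h0⟩
  choose D r s h1 h2 h3 hr hs hrs h0 using hex
  refine ⟨fun V => r V - 1, fun V U hVU => ?_, fun V => ?_, fun V => ?_, fun V => ?_⟩
  · have := (((hY _).1 V.2).isSummand.of_le (show V.1 ≤ U.1 from hVU.le)
      ((hY _).1 U.2).isSummand.le).rank_lt hR (hr V) (hr U) fun h => hVU.ne (Subtype.ext h)
    have := h0 V
    simp only
    omega
  · have := hrs V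
    have := h0 V
    simp only
    omega
  · have hmem := fun σ => mem_skeleton_link_and_span_le_iff (σ := σ) hR hν hX hp hp'
      ((hY _).1 V.2)
    obtain ⟨b, hb, -⟩ := id (hr V)
    have hconn : IsConn ((r V : ℤ) - 2) (Realization (basisComplex V.1)) :=
      isConn_congr (fun s => mem_link_empty.symm)
        ((isConn_link_basisComplex hCM (hr V) ⟨b, Finset.empty_subset b, hb⟩).mono (by simp))
    let e : FacePoset (basisComplex V.1) ≃o {σ : FacePoset K // f σ ≤ V} :=
      { toFun := fun σ => ⟨⟨σ.1, (hK _).2 ((hmem _).2 σ.2).1⟩, by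
          change (f _).1 ≤ V.1
          rw [hf]
          exact ((hmem _).2 σ.2).2⟩
        invFun := fun σ => ⟨σ.1.1, (hmem _).1 ⟨(hK _).1 σ.1.2, by
          rw [← hf]
          exact σ.2⟩⟩
        left_inv := fun σ => rfl
        right_inv := fun σ => rfl
        map_rel_iff' := Iff.rfl }
    refine (IsConn.of_orderIso e hconn.facePoset).mono ?_
    have := h0 V
    simp only
    omega
  · obtain ⟨e⟩ := exists_orderIso_above hR hX hY V (h1 V) (h2 V) (h3 V)
    have hN : HasRank N ν.card := ⟨ν, hν, rfl⟩
    have hND : Disjoint N (D V) := (h1 V).mono_right le_sup_right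
    have := h0 V
    have := hrs V
    refine (IsConn.of_orderIso e (ih _ (s V) (by omega) (δ - r V) (hN.sup (hs V) hND)
      ⟨D V, hND, rfl⟩ (fun h => ?_) fun h => ?_)).mono ?_
    · have := hp h
      omega
    · have := hp' h
      omega
    · simp only
      omega

/-- The poset of summands of complements of `N` in `X` is highly connected, by induction on the
rank. -/
theorem isConn_relSummands (hR : IsHermite R) (hCM : ∀ k : ℕ, IsCohenMacaulay (B R k))
    {ν : Finset M} (hν : IsBasisOf R ν N) {n : ℕ} {δ : ℤ} (hX : HasRank X (ν.card + n))
    (hNX : IsSummand N X) (hp : p → δ = n - 2) (hp' : ¬ p → δ = n - 1) :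
    IsConn (δ - 1) (Realization (orderComplex {V // IsRelSummand N X p V})) := by
  classical
  have := nontrivial_of_invariantBasisNumber R
  induction n using Nat.strong_induction_on generalizing X δ with
  | _ n ih =>
    obtain ⟨C, hNC, hC⟩ := hNX
    obtain ⟨n', ⟨c, hc, hcn⟩, hn'⟩ := HasRank.of_sup hR ⟨ν, hν, rfl⟩ hX hNC hC
    have hspan : ∀ σ ∈ (skeleton (link (basisComplex X) ν) δ).faces,
        IsRelSummand N X p (Submodule.span R (σ : Set M)) := by
      rintro σ ⟨hσ, hσ'⟩
      obtain ⟨h4, h5, h6, b, h7, h8⟩ := mem_link.1 hσ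
      obtain ⟨h9, h10⟩ := Finset.union_subset_iff.1 h7
      have hσν : σ ⊆ b \ ν := fun x hx =>
        Finset.mem_sdiff.2 ⟨h9 hx, Finset.disjoint_left.1 h5 hx⟩
      obtain ⟨h11, h12⟩ := h8.isSummand_span h10
      obtain ⟨h13, h14⟩ := (h8.mono Finset.sdiff_subset).isSummand_span hσν
      have hr : HasRank (Submodule.span R (σ : Set M)) σ.card := ⟨σ, h8.mono h9, rfl⟩
      rw [hν.2] at h11 h12
      refine ⟨hr.ne_bot (Finset.card_pos.2 h4), hr.free, fun hpp h0 => ?_, _, ?_, h13, ?_⟩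
      · have hr' := HasRank.sup ⟨ν, hν, rfl⟩ hr (h11.mono_right (h14 ▸ le_sup_left))
        rw [h0] at hr'
        have := hr'.unique hX
        have := hp hpp
        omega
      · rwa [h14]
      · rwa [h14]
    let f : FacePoset (skeleton (link (basisComplex X) ν) δ) →o {V // IsRelSummand N X p V} :=
      { toFun := fun σ => ⟨_, hspan σ.1 σ.2⟩
        monotone' := fun σ τ h => Submodule.span_mono (Finset.coe_subset.2 h) }
    obtain ⟨t, ht, htn, hfib, habove⟩ := exists_height_isConn_fibre hR hCM hν hX hp hp'
      (fun E n' hn' δ' h1 h2 h3 h4 => ih n' hn' h1 h2 h3 h4) (fun _ => Iff.rfl) (fun _ => Iff.rfl)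
      f fun _ => rfl
    have hl := isConn_link_basisComplex hCM hX
      ⟨ν ∪ c, Finset.subset_union_left, hC ▸ hν.union hc hNC⟩
    refine IsConn.of_posetMap ht hfib habove htn (hl.mono ?_).skeleton.facePoset
    by_cases h : p
    · have := hp h
      omega
    · have := hp' h
      omega

end RelSummands

/-! ### Flags of summands and links in the Tits complex -/

section Flags

/-- The converse of `IsConn.of_injective`: connectivity is inherited by the complex on the smaller
vertex set. -/
theorem IsConn.of_injective_symm {ι κ : Type*} {k : ℤ} {K : PreAbstractSimplicialComplex ι}
    {L : PreAbstractSimplicialComplex κ} {e : κ → ι}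
    (he : Function.Injective e) (hLK : ∀ t ∈ L.faces, ∃ s ∈ K.faces, ∀ j ∈ t, e j ∈ s)
    (hKL : ∀ s ∈ K.faces, ∃ t ∈ L.faces, ∀ i ∈ s, ∃ j ∈ t, e j = i)
    (hK : IsConn k (Realization K)) : IsConn k (Realization L) := by
  intro d hd a
  obtain ⟨c, hc⟩ := hK d hd ((simplicialMap e hLK).comp a)
  obtain ⟨c', hc'⟩ := exists_lift he L c fun z => hKL _ (c z).support_mem
  refine ⟨c', fun s => Realization.ext fun j => ?_⟩
  rw [hc', hc, ContinuousMap.comp_apply, simplicialMap_apply he]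

variable {R : Type u} [Ring R] {M : Type u} [AddCommGroup M] [Module R M]

theorem isRelSummand_bot_iff {X V : Submodule R M} :
    IsRelSummand ⊥ X True V ↔ V ≠ ⊥ ∧ Module.Free R V ∧ V ≠ X ∧ IsSummand V X := by
  simp only [IsRelSummand, bot_sup_eq, disjoint_bot_left, true_and, forall_const, IsSummand]

theorem isBasisOf_empty : IsBasisOf R (∅ : Finset M) ⊥ := ⟨by simp, by simp⟩

variable [InvariantBasisNumber R]

/-- The number of elements of a chain of summands is bounded in terms of the rank, since the ranks
of its elements are distinct. -/
theorem card_le_of_isChain (hR : IsHermite R) {N X : Submodule R M} {p : Prop} {ν : Finset M}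
    (hν : IsBasisOf R ν N) {n l : ℕ} (hX : HasRank X (ν.card + n)) (hp : p → n ≤ l + 1)
    (hp' : ¬ p → n ≤ l) {s : Finset (Submodule R M)} (hs : ∀ V ∈ s, IsRelSummand N X p V)
    (hch : IsChain (· ≤ ·) (s : Set (Submodule R M))) : s.card ≤ l := by
  classical
  have hex : ∀ V ∈ s, ∃ r, HasRank V r ∧ 1 ≤ r ∧ r ≤ l := fun V hV => by
    obtain ⟨D, h1, h2, h3⟩ := (hs V hV).2.2.2
    obtain ⟨r, t, hr, -, hrs, h0, hpt⟩ := (hs V hV).exists_ranks hR hν hX h1 h2 h3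
    refine ⟨r, hr, h0, ?_⟩
    by_cases h : p
    · have := hp h
      have := hpt h
      omega
    · have := hp' h
      omega
  choose! r hr h1 hl using hex
  have hinj : Set.InjOn r s := by
    intro V hV U hU hVU
    by_contra hne
    rcases hch hV hU hne with h | h
    · exact (((hs V hV).isSummand.of_le h (hs U hU).isSummand.le).rank_lt hR (hr V hV) (hr U hU)
        hne).ne hVU
    · exact (((hs U hU).isSummand.of_le h (hs V hV).isSummand.le).rank_lt hR (hr U hU) (hr V hV)
        (Ne.symm hne)).ne hVU.symm
  have h := Finset.card_le_card_of_injOn (t := Finset.Icc 1 l) r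
    (fun V hV => Finset.mem_coe.2 (Finset.mem_Icc.2 ⟨h1 V hV, hl V hV⟩)) hinj
  simpa using h

/-- Every summand of smaller rank is contained in a summand of corank one. -/
theorem exists_corank_one (hR : IsHermite R) {X U : Submodule R M} {c r : ℕ}
    (hX : HasRank X (c + 1)) (hU : HasRank U r) (hr : r < c + 1) (h : IsSummand U X) :
    ∃ V, U ≤ V ∧ HasRank V c ∧ IsSummand V X := by
  classical
  obtain ⟨D, h1, h2⟩ := h
  obtain ⟨s, ⟨d, hd, rfl⟩, hs⟩ := hU.of_sup hR hX h1 h2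
  have hd0 : 0 < d.card := by omega
  obtain ⟨x, hx⟩ := Finset.card_pos.1 hd0
  obtain ⟨h3, h4⟩ := hd.isSummand_span (Finset.erase_subset x d)
  refine ⟨U ⊔ Submodule.span R ((d.erase x : Finset M) : Set M), le_sup_left, ?_,
    Submodule.span R ((d \ d.erase x : Finset M) : Set M), ?_, ?_⟩
  · have h5 := hU.sup ⟨_, hd.mono (Finset.erase_subset x d), rfl⟩ (h1.mono_right (h4 ▸ le_sup_left))
    rw [Finset.card_erase_of_mem hx] at h5
    have : r + (d.card - 1) = c := by omega
    rwa [this] at h5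
  · exact Disjoint.disjoint_sup_left_of_disjoint_sup_right h3 (by rwa [h4])
  · rw [sup_assoc, h4, h2]

theorem exists_top_of_isChain {P : Type*} [PartialOrder P] {s : Finset P}
    (hs : IsChain (· ≤ ·) (s : Set P)) (h : s.Nonempty) : ∃ v ∈ s, ∀ u ∈ s, u ≤ v := by
  obtain ⟨v, hv, hmax⟩ := s.exists_maximal h
  exact ⟨v, hv, fun u hu => (hs.total hu hv).elim id fun h => hmax hu h⟩

/-- Every flag of summands extends to a complete flag: a summand of corank one above the flag is
added, and the construction continues inside it. -/
theorem exists_complete_flag (hR : IsHermite R) {X : Submodule R M} {c : ℕ} (hX : HasRank X c)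
    {σ : Finset (Submodule R M)} (hσ : ∀ V ∈ σ, IsRelSummand ⊥ X True V)
    (hch : IsChain (· ≤ ·) (σ : Set (Submodule R M))) :
    ∃ τ, σ ⊆ τ ∧ (∀ V ∈ τ, IsRelSummand ⊥ X True V) ∧
      IsChain (· ≤ ·) (τ : Set (Submodule R M)) ∧ τ.card = c - 1 := by
  classical
  induction c generalizing X σ with
  | zero =>
    have h := card_le_of_isChain hR isBasisOf_empty (n := 0) (l := 0) hX (fun _ => by omega)
      (fun _ => le_rfl) hσ hch
    exact ⟨σ, subset_rfl, hσ, hch, by omega⟩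
  | succ c ih =>
    rcases Nat.eq_zero_or_pos c with rfl | hc
    · have h := card_le_of_isChain hR isBasisOf_empty (n := 1) (l := 0) (by simpa using hX)
        (fun _ => by omega) (fun h => absurd trivial h) hσ hch
      exact ⟨σ, subset_rfl, hσ, hch, by omega⟩
    obtain ⟨V, hV, hVr, hVX⟩ : ∃ V, (∀ U ∈ σ, U ≤ V) ∧ HasRank V c ∧ IsSummand V X := by
      rcases σ.eq_empty_or_nonempty with rfl | hne
      · obtain ⟨V, -, h1, h2⟩ := exists_corank_one hR hX (hasRank_zero_iff.2 rfl) (by omega)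
          ⟨X, disjoint_bot_left, bot_sup_eq X⟩
        exact ⟨V, by simp, h1, h2⟩
      · obtain ⟨U, hU, hmax⟩ := exists_top_of_isChain hch hne
        obtain ⟨-, h1, h2, h3⟩ := isRelSummand_bot_iff.1 (hσ U hU)
        obtain ⟨r, hr⟩ := exists_hasRank h1 hX h3
        obtain ⟨V, h4, h5, h6⟩ := exists_corank_one hR hX hr (h3.rank_lt hR hr hX h2) h3
        exact ⟨V, fun W hW => (hmax W hW).trans h4, h5, h6⟩
    obtain ⟨τ, h1, h2, h3, h4⟩ := ih hVr (σ := σ.erase V) (fun U hU => by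
      obtain ⟨hne, hU⟩ := Finset.mem_erase.1 hU
      obtain ⟨h1, h2, -, h3⟩ := isRelSummand_bot_iff.1 (hσ U hU)
      exact isRelSummand_bot_iff.2 ⟨h1, h2, hne, h3.of_le (hV U hU) hVX.le⟩)
      (hch.mono (Finset.coe_subset.2 (Finset.erase_subset _ _)))
    have hVX' : V ≠ X := fun h => by
      have := hVr.unique (h ▸ hX)
      omega
    refine ⟨insert V τ, fun U hU => ?_, fun U hU => ?_, ?_, ?_⟩
    · by_cases h : U = V
      · exact h ▸ Finset.mem_insert_self _ _
      · exact Finset.mem_insert_of_mem (h1 (Finset.mem_erase.2 ⟨h, hU⟩))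
    · rcases Finset.mem_insert.1 hU with rfl | hU
      · exact isRelSummand_bot_iff.2 ⟨hVr.ne_bot hc, hVr.free, hVX', hVX⟩
      · obtain ⟨h5, h6, -, h7⟩ := isRelSummand_bot_iff.1 (h2 U hU)
        exact isRelSummand_bot_iff.2 ⟨h5, h6, fun h => hVX' (le_antisymm hVX.le (h ▸ h7.le)),
          h7.trans hVX⟩
    · rw [Finset.coe_insert]
      exact h3.insert fun U hU _ => Or.inr (h2 U hU).isSummand.le
    · rw [Finset.card_insert_of_notMem fun h => (isRelSummand_bot_iff.1 (h2 V h)).2.2.1 rfl, h4]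
      omega

/-- The link of a flag `σ` in the Tits complex of `X`. Its vertices are submodules of the ambient
module, so that the links for different `X` can be compared. -/
def flagLink (X : Submodule R M) (σ : Finset (Submodule R M)) :
    PreAbstractSimplicialComplex (Submodule R M) where
  faces := {s | s.Nonempty ∧ Disjoint s σ ∧ (∀ V ∈ s, IsRelSummand ⊥ X True V) ∧
    IsChain (· ≤ ·) ((s : Set (Submodule R M)) ∪ σ)}
  isRelLowerSet_faces := by
    rintro s ⟨h0, h1, h2, h3⟩
    exact ⟨h0, fun t ht hne => ⟨hne, h1.mono_left ht, fun V hV => h2 V (ht hV),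
      h3.mono (Set.union_subset_union_left _ (Finset.coe_subset.2 ht))⟩⟩

/-- The link of a flag with largest element `V` is the join of the link of the remaining flag in the
Tits complex of `V` and of the Tits complex of a complement of `V`. -/
theorem isConn_flagLink (hR : IsHermite R) (hCM : ∀ k : ℕ, IsCohenMacaulay (B R k))
    {X : Submodule R M} {c : ℕ} (hX : HasRank X c) {σ : Finset (Submodule R M)}
    (hσ : ∀ V ∈ σ, IsRelSummand ⊥ X True V)
    (hch : IsChain (· ≤ ·) (σ : Set (Submodule R M))) :
    IsConn ((c : ℤ) - 3 - σ.card) (Realization (flagLink X σ)) := by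
  classical
  have hbase : ∀ {Y : Submodule R M} {n : ℕ}, HasRank Y n →
      IsConn ((n : ℤ) - 3) (Realization (orderComplex {V // IsRelSummand ⊥ Y True V})) :=
    fun {Y n} hY => (isConn_relSummands hR hCM isBasisOf_empty (n := n) (δ := n - 2)
      (by simpa using hY) ⟨Y, disjoint_bot_left, bot_sup_eq Y⟩ (fun _ => rfl)
      fun h => absurd trivial h).mono (by omega)
  obtain ⟨k, hk⟩ : ∃ k, σ.card = k := ⟨_, rfl⟩
  induction k generalizing X c σ with
  | zero =>
    obtain rfl := Finset.card_eq_zero.1 hk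
    refine IsConn.of_orderComplex (e := fun V : {V // IsRelSummand ⊥ X True V} => V.1)
      Subtype.val_injective (fun s => ?_) ((hbase hX).mono (by simp))
    constructor
    · rintro ⟨h0, -, h1, h2⟩
      exact ⟨h0, fun V hV => ⟨⟨V, h1 V hV⟩, rfl⟩, fun V U hV hU =>
        h2.total (Or.inl hV) (Or.inl hU)⟩
    · rintro ⟨h0, h1, h2⟩
      refine ⟨h0, Finset.disjoint_empty_right _, fun V hV => ?_, fun V hV U hU _ => ?_⟩
      · obtain ⟨V, rfl⟩ := h1 V hV
        exact V.2
      · have hV' : V ∈ s := by simpa using hV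
        have hU' : U ∈ s := by simpa using hU
        obtain ⟨V, rfl⟩ := h1 V hV'
        obtain ⟨U, rfl⟩ := h1 U hU'
        exact h2 V U hV' hU'
  | succ k ih =>
    obtain ⟨V, hV, hmax⟩ := exists_top_of_isChain hch (Finset.card_pos.1 (by omega))
    have hVrel := hσ V hV
    obtain ⟨D, h1, h2, h3⟩ := hVrel.2.2.2
    obtain ⟨r, s, hr, hs, hrs, -, -⟩ := hVrel.exists_ranks hR isBasisOf_empty (n := c)
      (by simpa using hX) h1 h2 h3
    have hcomp : ∀ t ∈ (flagLink X σ).faces, ∀ U ∈ t, U ≤ V ∨ V < U := fun t ht U hU => by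
      refine (ht.2.2.2.total (Or.inl hU) (Or.inr hV)).imp id fun h => lt_of_le_of_ne h ?_
      rintro rfl
      exact Finset.disjoint_left.1 ht.2.1 hU hV
    -- the elements of the link below `V` and those above `V` form a join
    have hjoin : IsJoin (flagLink X σ) {U | U ≤ V} := by
      intro s t u hs ht hu hst
      have hl : ∀ U ∈ u, U ≤ V → U ∈ s ∧ s ∈ (flagLink X σ).faces := fun U hU hUV => by
        have h := (hst U hU).1 hUV
        exact ⟨h, hs.resolve_left fun h0 => Finset.notMem_empty U (h0 ▸ h)⟩
      have hr : ∀ U ∈ u, ¬ U ≤ V → U ∈ t ∧ t ∈ (flagLink X σ).faces ∧ V < U := fun U hU hUV => by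
        have h := (hst U hU).2 hUV
        have ht' := ht.resolve_left fun h0 => Finset.notMem_empty U (h0 ▸ h)
        exact ⟨h, ht', (hcomp t ht' U h).resolve_left hUV⟩
      have hσu : ∀ U ∈ u, ∀ W ∈ σ, U ≤ W ∨ W ≤ U := fun U hU W hW => by
        by_cases h : U ≤ V
        · exact (hl U hU h).2.2.2.2.total (Or.inl (hl U hU h).1) (Or.inr hW)
        · exact (hr U hU h).2.1.2.2.2.total (Or.inl (hr U hU h).1) (Or.inr hW)
      refine ⟨hu, Finset.disjoint_left.2 fun U hU => ?_, fun U hU => ?_, ?_⟩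
      · by_cases h : U ≤ V
        · exact Finset.disjoint_left.1 (hl U hU h).2.2.1 (hl U hU h).1
        · exact Finset.disjoint_left.1 (hr U hU h).2.1.2.1 (hr U hU h).1
      · by_cases h : U ≤ V
        · exact (hl U hU h).2.2.2.1 U (hl U hU h).1
        · exact (hr U hU h).2.1.2.2.1 U (hr U hU h).1
      · rintro U (hU | hU) W (hW | hW) hne
        · by_cases h : U ≤ V <;> by_cases h' : W ≤ V
          · exact (hl U hU h).2.2.2.2.total (Or.inl (hl U hU h).1) (Or.inl (hl W hW h').1)
          · exact Or.inl (h.trans (hr W hW h').2.2.le)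
          · exact Or.inr (h'.trans (hr U hU h).2.2.le)
          · exact (hr U hU h).2.1.2.2.2.total (Or.inl (hr U hU h).1) (Or.inl (hr W hW h').1)
        · exact hσu U hU W hW
        · exact (hσu W hW U hU).symm
        · exact hch hU hW hne
    have hA : IsConn ((r : ℤ) - 3 - k) (Realization (restrict (flagLink X σ) {U | U ≤ V})) := by
      have hcard : (σ.erase V).card = k := by
        rw [Finset.card_erase_of_mem hV, hk]
        rfl
      refine isConn_congr (L := flagLink V (σ.erase V)) (fun t => ?_) (hcard ▸ ih hr
        (fun U hU => ?_) (hch.mono (Finset.coe_subset.2 (Finset.erase_subset _ _))) hcard)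
      · constructor
        · rintro ⟨⟨h4, h5, h6, h7⟩, h8⟩
          refine ⟨h4, h5.mono_right (Finset.erase_subset _ _), fun U hU => ?_, h7.mono
            (Set.union_subset_union_right _ (Finset.coe_subset.2 (Finset.erase_subset _ _)))⟩
          obtain ⟨h9, h10, -, h11⟩ := isRelSummand_bot_iff.1 (h6 U hU)
          refine isRelSummand_bot_iff.2 ⟨h9, h10, ?_, h11.of_le (h8 U hU) hVrel.isSummand.le⟩
          rintro rfl
          exact Finset.disjoint_left.1 h5 hU hV
        · rintro ⟨h4, h5, h6, h7⟩
          have h8 : ∀ U ∈ t, U ≤ V := fun U hU => (h6 U hU).isSummand.le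
          have h9 : ∀ U ∈ t, U ≠ V := fun U hU => (isRelSummand_bot_iff.1 (h6 U hU)).2.2.1
          refine ⟨⟨h4, Finset.disjoint_left.2 fun U hU hU' => Finset.disjoint_left.1 h5 hU
            (Finset.mem_erase.2 ⟨h9 U hU, hU'⟩), fun U hU => ?_, ?_⟩, h8⟩
          · obtain ⟨h10, h11, -, h12⟩ := isRelSummand_bot_iff.1 (h6 U hU)
            refine isRelSummand_bot_iff.2 ⟨h10, h11, fun h => ?_, h12.trans hVrel.isSummand⟩
            exact (isRelSummand_bot_iff.1 hVrel).2.2.1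
              (le_antisymm hVrel.isSummand.le (h ▸ h8 U hU))
          · refine (h7.insert (a := V) fun U hU _ => Or.inr ?_).mono fun U hU => ?_
            · rcases hU with hU | hU
              · exact h8 U hU
              · exact hmax U (Finset.mem_of_mem_erase hU)
            · rcases hU with hU | hU
              · exact Or.inr (Or.inl hU)
              · by_cases h : U = V
                · exact Or.inl h
                · exact Or.inr (Or.inr (Finset.mem_erase.2 ⟨h, hU⟩))
      · obtain ⟨hne, hU⟩ := Finset.mem_erase.1 hU
        obtain ⟨h4, h5, -, h6⟩ := isRelSummand_bot_iff.1 (hσ U hU)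
        exact isRelSummand_bot_iff.2 ⟨h4, h5, hne, h6.of_le (hmax U hU) hVrel.isSummand.le⟩
    have hB : IsConn ((s : ℤ) - 3) (Realization (restrict (flagLink X σ) {U | U ≤ V}ᶜ)) := by
      obtain ⟨e⟩ := exists_orderIso_above hR hX (fun U => Iff.rfl) ⟨V, hVrel⟩ h1 h2 h3
      have hs' : HasRank (⊥ ⊔ D) s := by rwa [bot_sup_eq]
      refine IsConn.of_orderComplex
        (e := fun U : {U : {U // IsRelSummand ⊥ X True U} // ⟨V, hVrel⟩ < U} => U.1.1)
        (Subtype.val_injective.comp Subtype.val_injective) (fun t => ?_)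
        (IsConn.of_orderIso e (hbase hs'))
      constructor
      · rintro ⟨ht, h4⟩
        exact ⟨ht.1, fun U hU => ⟨⟨⟨U, ht.2.2.1 U hU⟩, (hcomp t ht U hU).resolve_left (h4 U hU)⟩,
          rfl⟩, fun U W hU hW => ht.2.2.2.total (Or.inl hU) (Or.inl hW)⟩
      · rintro ⟨h4, h5, h6⟩
        have h7 : ∀ U ∈ t, V < U := fun U hU => by
          obtain ⟨U, rfl⟩ := h5 U hU
          exact U.2
        refine ⟨⟨h4, Finset.disjoint_left.2 fun U hU hU' => ?_, fun U hU => ?_, ?_⟩,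
          fun U hU hUV => ?_⟩
        · exact absurd (hmax U hU') (h7 U hU).not_ge
        · obtain ⟨U, rfl⟩ := h5 U hU
          exact U.1.2
        · rintro U (hU | hU) W (hW | hW) hne
          · obtain ⟨U, rfl⟩ := h5 U hU
            obtain ⟨W, rfl⟩ := h5 W hW
            exact h6 U W hU hW
          · exact Or.inr ((hmax W hW).trans (h7 U hU).le)
          · exact Or.inl ((hmax U hU).trans (h7 W hW).le)
          · exact hch hU hW hne
        · exact absurd hUV (h7 U hU).not_ge
    exact (IsConn.join hjoin hA hB).mono (by omega)

end Flags

/-! ### The span maps and the Tits complexes -/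

section SpanMaps

variable {R : Type u} [Ring R]

theorem isProperFreeSummand_iff {M : Type u} [AddCommGroup M] [Module R M] {V : Submodule R M} :
    IsProperFreeSummand V ↔ IsRelSummand ⊥ ⊤ True V := by
  rw [isRelSummand_bot_iff, IsProperFreeSummand, IsSummand]
  have h : (∃ C, IsCompl V C) ↔ ∃ W, Disjoint V W ∧ V ⊔ W = ⊤ :=
    exists_congr fun C => by rw [isCompl_iff, codisjoint_iff]
  rw [h]
  tauto

/-- A summand of a complement of `N ≠ ⊥` is automatically proper. -/
theorem relTits_iff {M : Type u} [AddCommGroup M] [Module R M] {N V : Submodule R M}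
    (hN : N ≠ ⊥) : IsProperFreeSummand V ∧ IsSummandOfComplement N V ↔
      IsRelSummand N ⊤ False V := by
  constructor
  · rintro ⟨⟨h1, -, h2, -⟩, C, h3, W, h4, rfl⟩
    exact ⟨h1, h2, False.elim, W, h3.disjoint, h4, codisjoint_iff.1 h3.codisjoint⟩
  · rintro ⟨h1, h2, -, W, h3, h4, h5⟩
    have h6 : IsSummand V ⊤ :=
      IsRelSummand.isSummand (p := False) ⟨h1, h2, False.elim, W, h3, h4, h5⟩
    obtain ⟨C, h7, h8⟩ := h6
    refine ⟨⟨h1, ?_, h2, C, h7, codisjoint_iff.2 h8⟩, V ⊔ W, ⟨h3, codisjoint_iff.2 h5⟩, W, h4, rfl⟩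
    rintro rfl
    rw [top_sup_eq] at h3
    exact hN (disjoint_top.1 h3)

variable [InvariantBasisNumber R]

theorem isConnMap_spanMap (hR : IsHermite R) (hCM : ∀ k : ℕ, IsCohenMacaulay (B R k)) (n : ℕ) :
    IsConnMap ((n : ℤ) - 2) (posetMap (spanMap R n)) := by
  have := nontrivial_of_invariantBasisNumber R
  obtain ⟨t, ht, htn, hfib, habove⟩ := exists_height_isConn_fibre (N := ⊥) (X := ⊤) (p := True)
    (δ := (n : ℤ) - 2) hR hCM
    isBasisOf_empty (n := n) (by simpa using hasRank_top_pi (R := R) n) (fun _ => rfl)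
    (fun h => absurd trivial h)
    (fun E n' _ δ' h1 h2 h3 h4 => isConn_relSummands hR hCM isBasisOf_empty h1 h2 h3 h4)
    (pY := IsProperFreeSummand) (fun _ => isProperFreeSummand_iff)
    (K := skeleton (B R n) ((n : ℤ) - 2))
    (fun σ => and_congr (mem_partialBases_iff.trans mem_link_empty.symm) Iff.rfl)
    (spanMap R n) fun _ => rfl
  exact isConnMap_posetMap ht hfib habove htn

theorem isBasisOf_firstUnitVectors (m n : ℕ) :
    IsBasisOf R (firstUnitVectors R m n) (firstSummand R m n) ∧
      (firstUnitVectors R m n).card = m ∧ IsSummand (firstSummand R m n) ⊤ := by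
  classical
  have := nontrivial_of_invariantBasisNumber R
  let β := Pi.basisFun R (Fin (m + n))
  have htop : IsBasisOf R (Finset.univ.map ⟨β, β.injective⟩) ⊤ := by
    constructor
    · rw [Finset.coe_map, Finset.coe_univ, Set.image_univ]
      exact β.linearIndependent.linearIndepOn_id
    · rw [Finset.coe_map, Finset.coe_univ, Set.image_univ]
      exact β.span_eq
  have hsub : firstUnitVectors R m n ⊆ Finset.univ.map ⟨β, β.injective⟩ := by
    intro x hx
    simp only [firstUnitVectors, Finset.mem_image] at hx
    obtain ⟨i, -, rfl⟩ := hx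
    refine Finset.mem_map.2 ⟨Fin.castAdd n i, Finset.mem_univ _, ?_⟩
    exact Pi.basisFun_apply R (Fin (m + n)) _
  have hb := htop.mono hsub
  have hs := htop.isSummand_span hsub
  rw [span_firstUnitVectors] at hb hs
  refine ⟨hb, ?_, _, hs⟩
  rw [firstUnitVectors, Finset.card_image_of_injective, Finset.card_univ, Fintype.card_fin]
  intro i j hij
  refine Fin.castAdd_injective m n (β.injective ?_)
  simpa [β, Pi.basisFun_apply] using hij

theorem firstSummand_ne_bot {m n : ℕ} (hm : 0 < m) : firstSummand R m n ≠ ⊥ := by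
  obtain ⟨h1, h2, -⟩ := isBasisOf_firstUnitVectors (R := R) m n
  exact HasRank.ne_bot ⟨_, h1, h2⟩ hm

theorem isConnMap_relSpanMap (hR : IsHermite R) (hCM : ∀ k : ℕ, IsCohenMacaulay (B R k)) (m n : ℕ)
    (hm : 0 < m) : IsConnMap ((n : ℤ) - 1) (posetMap (relSpanMap R m n hm)) := by
  classical
  have := nontrivial_of_invariantBasisNumber R
  obtain ⟨hν, hcard, -⟩ := isBasisOf_firstUnitVectors (R := R) m n
  have hX : HasRank (⊤ : Submodule R (Fin (m + n) → R)) ((firstUnitVectors R m n).card + n) := by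
    rw [hcard]
    exact hasRank_top_pi _
  obtain ⟨t, ht, htn, hfib, habove⟩ := exists_height_isConn_fibre (p := False)
    (δ := (n : ℤ) - 1) hR hCM hν hX False.elim (fun _ => rfl)
    (fun E n' _ δ' h1 h2 h3 h4 => isConn_relSummands hR hCM hν h1 h2 h3 h4)
    (fun _ => relTits_iff (firstSummand_ne_bot hm)) (K := relB R m n)
    -- the `(n - 1)`-skeleton of the link is the whole link
    (fun σ => by
      constructor
      · intro h
        obtain ⟨h1, h2, h3⟩ := mem_link.1 h
        have h4 := mem_partialBases_iff.1 h3
        refine ⟨mem_link.2 ⟨h1, h2, h4⟩, ?_⟩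
        obtain ⟨-, b, h5, h6⟩ := h4
        have h7 := Finset.card_le_card h5
        rw [Finset.card_union_of_disjoint h2, HasRank.unique ⟨b, h6, rfl⟩ hX] at h7
        omega
      · rintro ⟨h, -⟩
        obtain ⟨h1, h2, h3⟩ := mem_link.1 h
        exact mem_link.2 ⟨h1, h2, mem_partialBases_iff.2 h3⟩)
    (relSpanMap R m n hm) fun _ => rfl
  exact isConnMap_posetMap ht hfib habove htn

theorem isSpherical_relT (hR : IsHermite R) (hCM : ∀ k : ℕ, IsCohenMacaulay (B R k)) (m n : ℕ)
    (hm : 0 < m) : IsSpherical ((n : ℤ) - 1) (relT R m n) := by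
  classical
  obtain ⟨hν, hcard, hNX⟩ := isBasisOf_firstUnitVectors (R := R) m n
  have hX : HasRank (⊤ : Submodule R (Fin (m + n) → R)) ((firstUnitVectors R m n).card + n) := by
    rw [hcard]
    exact hasRank_top_pi _
  have hiff := fun V => relTits_iff (V := V) (firstSummand_ne_bot (R := R) (n := n) hm)
  refine ⟨⟨?_, ?_⟩, ?_⟩
  · rcases Nat.eq_zero_or_pos n with rfl | hn
    · exact Or.inl rfl
    · -- a maximal chain: a complete flag in a complement `C`, together with `C` itself
      obtain ⟨C, h1, h2⟩ := hNX
      obtain ⟨n', hC, h3⟩ := HasRank.of_sup hR ⟨_, hν, rfl⟩ hX h1 h2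
      obtain rfl : n' = n := by omega
      obtain ⟨τ, -, h4, h5, h6⟩ := exists_complete_flag hR hC (σ := ∅) (by simp) (by simp)
      have hCτ : C ∉ τ := fun h => (isRelSummand_bot_iff.1 (h4 C h)).2.2.1 rfl
      have hmem : ∀ V ∈ insert C τ, IsProperFreeSummand V ∧
          IsSummandOfComplement (firstSummand R m n') V := by
        intro V hV
        rw [hiff]
        rcases Finset.mem_insert.1 hV with rfl | hV
        · exact ⟨hC.ne_bot hn, hC.free, False.elim, ⊥, by rwa [sup_bot_eq], disjoint_bot_right,
            by rwa [sup_bot_eq]⟩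
        · obtain ⟨h7, h8, -, W, h9, rfl⟩ := isRelSummand_bot_iff.1 (h4 V hV)
          exact ⟨h7, h8, False.elim, W, h1, h9, h2⟩
      have hcard' : ((insert C τ).subtype fun V => IsProperFreeSummand V ∧
          IsSummandOfComplement (firstSummand R m n') V).card = n' := by
        rw [Finset.card_subtype, Finset.filter_true_of_mem hmem, Finset.card_insert_of_notMem hCτ,
          h6]
        omega
      refine Or.inr ⟨_, ⟨Finset.card_pos.1 (hcard'.symm ▸ hn), ?_⟩, by simp only; rw [hcard']⟩
      intro V hV U hU hne
      have h7 : IsChain (· ≤ ·)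
          ((insert C τ : Finset _) : Set (Submodule R (Fin (m + n') → R))) := by
        rw [Finset.coe_insert]
        exact h5.insert fun U hU _ => Or.inr (h4 U hU).isSummand.le
      exact h7 (Finset.mem_subtype.1 hV) (Finset.mem_subtype.1 hU) fun h => hne (Subtype.ext h)
  · rintro _ (rfl | ⟨s, hs, rfl⟩)
    · omega
    · have h := card_le_of_isChain (p := False) hR hν hX (l := n) False.elim (fun _ => le_rfl)
        (s := s.map ⟨Subtype.val, Subtype.val_injective⟩) (fun V hV => by
          obtain ⟨V, -, rfl⟩ := Finset.mem_map.1 hV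
          exact (hiff _).1 V.2) (by
          intro V hV U hU _
          rw [Finset.mem_coe, Finset.mem_map] at hV hU
          obtain ⟨V, hV, rfl⟩ := hV
          obtain ⟨U, hU, rfl⟩ := hU
          exact hs.2.total hV hU)
      rw [Finset.card_map] at h
      simp only
      omega
  · let e : {V // IsRelSummand (firstSummand R m n) ⊤ False V} ≃o relTPoset R m n :=
      { toEquiv := Equiv.subtypeEquivRight fun V => (hiff V).symm
        map_rel_iff' := Iff.rfl }
    exact IsConn.of_orderIso e (isConn_relSummands hR hCM hν hX hNX False.elim fun _ => rfl)

/-- Flags of the Tits complex, including the empty one, have spherical links. -/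
theorem isSpherical_link_T (hR : IsHermite R) (hCM : ∀ k : ℕ, IsCohenMacaulay (B R k)) {n : ℕ}
    (hn : 1 ≤ n) {σ : Finset (TPoset R n)} (hσ : IsChain (· ≤ ·) (σ : Set (TPoset R n))) :
    IsSpherical ((n : ℤ) - 2 - σ.card) (link (T R n) σ) := by
  classical
  let ι : TPoset R n ↪ Submodule R (Fin n → R) := ⟨Subtype.val, Subtype.val_injective⟩
  have hX := hasRank_top_pi (R := R) n
  have hrel : ∀ s : Finset (TPoset R n), ∀ V ∈ s.map ι, IsRelSummand ⊥ ⊤ True V := fun s V hV => by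
    obtain ⟨V, -, rfl⟩ := Finset.mem_map.1 hV
    exact isProperFreeSummand_iff.1 V.2
  have hchain : ∀ s : Finset (TPoset R n), IsChain (· ≤ ·) (s : Set (TPoset R n)) ↔
      IsChain (· ≤ ·) ((s.map ι : Finset _) : Set (Submodule R (Fin n → R))) := fun s => by
    constructor
    · intro hs V hV U hU _
      rw [Finset.mem_coe, Finset.mem_map] at hV hU
      obtain ⟨V, hV, rfl⟩ := hV
      obtain ⟨U, hU, rfl⟩ := hU
      exact hs.total hV hU
    · intro hs V hV U hU hne
      exact hs (Finset.mem_coe.2 (Finset.mem_map_of_mem ι hV))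
        (Finset.mem_coe.2 (Finset.mem_map_of_mem ι hU)) fun h => hne (Subtype.ext h)
  have hcard : ∀ s : Finset (TPoset R n), IsChain (· ≤ ·) (s : Set (TPoset R n)) →
      s.card ≤ n - 1 := fun s hs => by
    have h := card_le_of_isChain (p := True) hR isBasisOf_empty (n := n) (l := n - 1)
      (by simpa using hX) (fun _ => by omega) (fun h => absurd trivial h) (hrel s) ((hchain s).1 hs)
    rwa [Finset.card_map] at h
  have hpull : ∀ s : Finset (Submodule R (Fin n → R)), (∀ V ∈ s, IsRelSummand ⊥ ⊤ True V) →
      ∃ s' : Finset (TPoset R n), s = s'.map ι := fun s hs => by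
    refine ⟨s.subtype IsProperFreeSummand, ?_⟩
    exact (Finset.subtype_map_of_mem fun V hV => isProperFreeSummand_iff.2 (hs V hV)).symm
  refine ⟨⟨?_, ?_⟩, ?_⟩
  · obtain ⟨τ, h1, h2, h3, h4⟩ := exists_complete_flag hR hX (hrel σ) ((hchain σ).1 hσ)
    obtain ⟨τ, rfl⟩ := hpull τ h2
    rw [Finset.card_map] at h4
    rw [Finset.map_subset_map] at h1
    have h5 := Finset.card_sdiff_add_card_eq_card h1
    rcases (τ \ σ).eq_empty_or_nonempty with h | h
    · rw [h, Finset.card_empty] at h5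
      exact Or.inl (by omega)
    · refine Or.inr ⟨τ \ σ, mem_link.2 ⟨h, Finset.sdiff_disjoint, ?_⟩, by simp only; omega⟩
      rw [Finset.sdiff_union_of_subset h1]
      exact ⟨h.mono Finset.sdiff_subset, (hchain τ).2 h3⟩
  · rintro _ (rfl | ⟨s, hs, rfl⟩)
    · have := hcard σ hσ
      omega
    · obtain ⟨-, h1, -, h2⟩ := mem_link.1 hs
      have h3 := hcard _ h2
      rw [Finset.card_union_of_disjoint h1] at h3
      simp only
      omega
  · have h := isConn_flagLink hR hCM hX (hrel σ) ((hchain σ).1 hσ)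
    rw [Finset.card_map] at h
    have hiff : ∀ s : Finset (TPoset R n), s ∈ (link (T R n) σ).faces ↔
        s.map ι ∈ (flagLink ⊤ (σ.map ι)).faces := fun s => by
      have h1 : ((s.map ι : Finset _) : Set (Submodule R (Fin n → R))) ∪ (σ.map ι : Finset _) =
          ((s ∪ σ).map ι : Finset _) := by
        rw [Finset.map_union, Finset.coe_union]
      rw [mem_link]
      constructor
      · rintro ⟨h2, h3, h4⟩
        refine ⟨by simpa using h2, (Finset.disjoint_map ι).2 h3, hrel s, ?_⟩
        rw [h1, ← hchain]
        exact h4.2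
      · rintro ⟨h2, h3, -, h4⟩
        rw [h1, ← hchain] at h4
        have h2' : s.Nonempty := by simpa using h2
        exact ⟨h2', (Finset.disjoint_map ι).1 h3, h2'.mono Finset.subset_union_left, h4⟩
    refine IsConn.of_injective_symm (e := ι) ι.injective (fun t ht => ⟨t.map ι, (hiff t).1 ht,
      fun j hj => Finset.mem_map_of_mem ι hj⟩) (fun s hs => ?_) (h.mono (by omega))
    obtain ⟨t, rfl⟩ := hpull s hs.2.2.1
    refine ⟨t, (hiff t).2 hs, fun i hi => ?_⟩
    obtain ⟨j, hj, rfl⟩ := Finset.mem_map.1 hi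
    exact ⟨j, hj, rfl⟩

theorem HasDim.congr {ι : Type*} {K L : PreAbstractSimplicialComplex ι} {d : ℤ} (hL : HasDim L d)
    (h : ∀ s, s ∈ K.faces ↔ s ∈ L.faces) : HasDim K d := by
  have : K.faces = L.faces := Set.ext h
  unfold HasDim
  rw [this]
  exact hL

theorem isCohenMacaulay_T (hR : IsHermite R) (hCM : ∀ k : ℕ, IsCohenMacaulay (B R k)) (n : ℕ) :
    IsCohenMacaulay (T R n) ∧ (1 ≤ n → HasDim (T R n) ((n : ℤ) - 2)) := by
  rcases Nat.eq_zero_or_pos n with rfl | hn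
  · have hempty : ∀ s, s ∉ (T R 0).faces := fun s hs => by
      obtain ⟨V, -⟩ := hs.1
      exact V.2.1 (Subsingleton.elim _ _)
    refine ⟨⟨-1, ⟨⟨Or.inl rfl, ?_⟩, fun d hd => absurd hd (by omega)⟩, fun p σ hσ =>
      absurd hσ (hempty σ)⟩, fun h => absurd h (by omega)⟩
    rintro _ (rfl | ⟨s, hs, rfl⟩)
    · exact le_rfl
    · exact absurd hs (hempty s)
  · obtain ⟨h1, h2⟩ := isSpherical_link_T hR hCM hn (σ := ∅) (by simp)
    rw [Finset.card_empty, Nat.cast_zero, sub_zero] at h1 h2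
    have h3 : HasDim (T R n) ((n : ℤ) - 2) := h1.congr fun s => mem_link_empty.symm
    refine ⟨⟨_, ⟨h3, isConn_congr (fun s => mem_link_empty.symm) h2⟩, fun p σ hσ hp => ?_⟩,
      fun _ => h3⟩
    have h4 := isSpherical_link_T hR hCM hn hσ.2
    have h5 : (n : ℤ) - 2 - p - 1 = n - 2 - σ.card := by
      rw [hp]
      push_cast
      ring
    rwa [h5]

end SpanMaps

end TitsSpan

theorem mainTheorem6 {R : Type u} [Ring R]
    [InvariantBasisNumber R] (hermite : IsHermite R)
    (partialBases_CM : ∀ k : ℕ, IsCohenMacaulay (B R k)) (m n : ℕ) (hm : 0 < m) :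
    IsConnMap ((n : ℤ) - 2) (posetMap (spanMap R n)) ∧
    IsConnMap ((n : ℤ) - 1) (posetMap (relSpanMap R m n hm)) ∧
    (IsCohenMacaulay (T R n) ∧ (1 ≤ n → HasDim (T R n) ((n : ℤ) - 2))) ∧
    IsSpherical ((n : ℤ) - 1) (relT R m n) :=
  ⟨isConnMap_spanMap hermite partialBases_CM n, isConnMap_relSpanMap hermite partialBases_CM m n hm,
    isCohenMacaulay_T hermite partialBases_CM n, isSpherical_relT hermite partialBases_CM m n hm⟩
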